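/- Let $n\ge 0$ be an integer and $0<q<1$. Let $C(\mathbb{S}_q^{2n+1})$ be the C*-algebra of the quantum homogeneous (Vaksman--Soibelman) sphere, realised as the unital C*-algebra of operators on $\ell^2(\mathbb{Z})\otimes\ell^2(\mathbb{Z}_{\ge 0})^{\otimes n}$ generated by $u_{n+1,m}=t\otimes\gamma^{\otimes(n+1-m)}\otimes\alpha^*\otimes 1^{\otimes(m-2)}$ for $2\le m\le n+1$ and $u_{n+1,1}=t\otimes\gamma^{\otimes n}$, where $t$ is the bilateral shift, $\alpha^*e_w=\sqrt{1-q^{2(w+1)}}\,e_{w+1}$ and $\gamma e_w=q^we_w$. For a unital C*-algebra $\mathcal{A}$ let $\mathfrak{P}(\mathcal{A})$ be the set of classes of idempotents in $M_\infty(\mathcal{A})$ under conjugation by $GL_\infty(\mathcal{A})$, an abelian monoid under the diagonal sum $\boxplus$, and let $K_0(\mathcal{A})$ be its Grothendieck group. Let $P_k$ be the projection of $\ell^2(\mathbb{Z}_{\ge0})$ onto the span of $e_0,\dots,e_{k-1}$, and $I$ the identity. Put $P_{0,k}=$ the identity of $M_k(C(\mathbb{S}_q^{2n+1}))$ for $k\ge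 0$ (so $P_{0,0}=0$), and $P_{j,k}=1\otimes P_1^{\otimes(j-1)}\otimes P_k\otimes I^{\otimes(n-j)}\in C(\mathbb{S}_q^{2n+1})$ for $1\le j\le n$ and $k>0$. There is a unique *-homomorphism $\eta:C(\mathbb{S}_q^{2n+1})\to C(\mathbb{T})$ that sends $u_{n+1,n+1}$ to the identity function $\mathrm{id}_{\mathbb{T}}$ and $u_{n+1,m}$ to $0$ for $m\le n$. Let $\mathfrak{P}_r(C(\mathbb{S}_q^{2n+1}))$ be the set of classes of idempotents $P$ of rank $r$, that is, such that the vector bundle over $\mathbb{T}$ determined by $\eta(P)$ has rank $r$. Theorem 1. $\mathfrak{P}(C(\mathbb{S}_q^{2n+1}))$ is the disjoint union of the sets $\mathfrak{P}_r(C(\mathbb{S}_q^{2n+1}))$, $r\ge0$, where $$\mathfrak{P}_0(C(\mathbb{S}_q^{2n+1}))=\{[P_{0,0}]\}\cup\{[P_{j,k}]: k>0,\ 1\le j\le n\},$$ the classes listed being pairwise distinct, and $\mathfrak{P}_k(C(\mathbb{S}_q^{2n+1}))=\{[P_{0,k}]\}$ for every $k>0$. The monoid structure is given by $[P_{0,0}]=0$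 and $$[P_{j,k}]\boxplus[P_{j',k'}]=\begin{cases}[P_{j,k}] & \text{if } 0\le j<j' \text{ and } k,k'>0,\\ [P_{j,k+k'}] & \text{if } j=j'\ge 0.\end{cases}$$ Consequently $[P_{j,k}]=0$ in $K_0(C(\mathbb{S}_q^{2n+1}))$ if and only if $1\le j\le n$ or $j=k=0$. -/

import Mathlib

/-! ### Idempotents over a ring, their equivalence, and the monoid of classes -/

/-- An idempotent over `A`: an idempotent element of some matrix algebra `M_N(A)`. -/
structure IdempotentOver (A : Type*) [Ring A] where
  size : ℕ
  mat : Matrix (Fin size) (Fin size) A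
  isIdempotentElem : IsIdempotentElem mat

namespace IdempotentOver

variable {A : Type*} [Ring A]

/-- The upper left corner embedding `M_m(A) → M_N(A)` (for `m ≤ N`), `P ↦ P ⊞ 0`. -/
def pad {m : ℕ} (N : ℕ) (P : Matrix (Fin m) (Fin m) A) : Matrix (Fin N) (Fin N) A :=
  fun i j => if h : (i : ℕ) < m ∧ (j : ℕ) < m then P ⟨i, h.1⟩ ⟨j, h.2⟩ else 0

/-- Equivalence over `A`: conjugacy in `M_∞(A)` by an element of `GL_∞(A)`, that is, conjugacy of
`P ⊞ 0` and `Q ⊞ 0` by an invertible matrix of some size `N`. -/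
def Equivalent (P Q : IdempotentOver A) : Prop :=
  ∃ N : ℕ, P.size ≤ N ∧ Q.size ≤ N ∧ ∃ U : (Matrix (Fin N) (Fin N) A)ˣ,
    (U : Matrix (Fin N) (Fin N) A) * pad N P.mat * (↑U⁻¹ : Matrix (Fin N) (Fin N) A) = pad N Q.mat

/-- The diagonal sum `P ⊞ Q`. -/
def diagSum (P Q : IdempotentOver A) : IdempotentOver A where
  size := P.size + Q.size
  mat := (Matrix.fromBlocks P.mat 0 0 Q.mat).submatrix finSumFinEquiv.symm finSumFinEquiv.symm
  isIdempotentElem := by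
    have hP : P.mat * P.mat = P.mat := P.isIdempotentElem
    have hQ : Q.mat * Q.mat = Q.mat := Q.isIdempotentElem
    rw [IsIdempotentElem, Matrix.submatrix_mul_equiv, Matrix.fromBlocks_multiply]
    simp [hP, hQ]

/-- The zero idempotent. -/
def zero : IdempotentOver A := ⟨0, 0, by simp [IsIdempotentElem]⟩

/-- The identity matrix of size `k`, as an idempotent. -/
def one (k : ℕ) : IdempotentOver A := ⟨k, 1, by simp [IsIdempotentElem]⟩

/-- An idempotent element of `A`, as an idempotent of size `1`. -/
def ofElem (a : A) (ha : IsIdempotentElem a) : IdempotentOver A :=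
  ⟨1, Matrix.of fun _ _ => a, by
    ext i j
    simpa [Matrix.mul_apply] using ha.eq⟩

def incl (A : Type*) [Ring A] (N m : ℕ) : Matrix (Fin N) (Fin m) A :=
  fun i j => if (i : ℕ) = j then 1 else 0

def proj (A : Type*) [Ring A] (m N : ℕ) : Matrix (Fin m) (Fin N) A :=
  fun i j => if (i : ℕ) = j then 1 else 0

lemma proj_mul_incl {m N : ℕ} (h : m ≤ N) : proj A m N * incl A N m = 1 := by
  ext i j
  rw [Matrix.mul_apply, Finset.sum_eq_single (Fin.castLE h i)]
  · simp [proj, incl, Matrix.one_apply, Fin.ext_iff]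
  · intro b _ hb
    have : ¬ ((i : ℕ) = b) := fun h' => hb (Fin.ext (by simp [h']))
    simp [proj, this]
  · simp

lemma pad_eq {m N : ℕ} (P : Matrix (Fin m) (Fin m) A) :
    pad N P = incl A N m * P * proj A m N := by
  ext i j
  rw [Matrix.mul_apply]
  by_cases hj : (j : ℕ) < m
  · rw [Finset.sum_eq_single ⟨j, hj⟩]
    · rw [Matrix.mul_apply]
      by_cases hi : (i : ℕ) < m
      · rw [Finset.sum_eq_single ⟨i, hi⟩]
        · simp [pad, incl, proj, hi, hj]
        · intro b _ hb
          have : ¬ ((i : ℕ) = b) := fun h' => hb (Fin.ext (by simp [h']))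
          simp [incl, this]
        · simp
      · rw [Finset.sum_eq_zero]
        · simp [pad, hi]
        · intro b _
          have : ¬ ((i : ℕ) = b) := fun h' => hi (by have := b.2; omega)
          simp [incl, this]
    · intro b _ hb
      have : ¬ ((b : ℕ) = j) := fun h' => hb (Fin.ext (by simp [h']))
      simp [proj, this]
    · simp
  · rw [Finset.sum_eq_zero]
    · simp [pad, hj]
    · intro b _
      have : ¬ ((b : ℕ) = j) := fun h' => hj (by have := b.2; omega)
      simp [proj, this]

/-- Two idempotents are equivalent if and only if `P = X Y` and `Q = Y X` for rectangular
matrices `X`, `Y`. -/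
theorem equivalent_iff (P Q : IdempotentOver A) :
    P.Equivalent Q ↔ ∃ (X : Matrix (Fin P.size) (Fin Q.size) A)
      (Y : Matrix (Fin Q.size) (Fin P.size) A), X * Y = P.mat ∧ Y * X = Q.mat := by
  obtain ⟨m, P, hP'⟩ := P
  obtain ⟨l, Q, hQ'⟩ := Q
  have hP : P * P = P := hP'
  have hQ : Q * Q = Q := hQ'
  constructor
  · rintro ⟨N, hm, hl, U, hU⟩
    dsimp only at hm hl hU ⊢
    rw [pad_eq, pad_eq] at hU
    have e1 := proj_mul_incl (A := A) hm
    have e2 := proj_mul_incl (A := A) hl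
    generalize incl A N m = a at *
    generalize proj A m N = a' at *
    generalize incl A N l = b at *
    generalize proj A l N = b' at *
    have u1 : (↑U⁻¹ : Matrix (Fin N) (Fin N) A) * (U : Matrix (Fin N) (Fin N) A) = 1 := by simp
    have u2 : (U : Matrix (Fin N) (Fin N) A) * (↑U⁻¹ : Matrix (Fin N) (Fin N) A) = 1 := by simp
    generalize (↑U⁻¹ : Matrix (Fin N) (Fin N) A) = V at *
    generalize (U : Matrix (Fin N) (Fin N) A) = U at *
    have h1 : b * Q * b' * U = U * (a * P * a') := by
      rw [← hU, Matrix.mul_assoc _ V U, u1, Matrix.mul_one]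
    have h2 : V * (b * Q * b') = a * P * a' * V := by
      rw [← hU, ← Matrix.mul_assoc, ← Matrix.mul_assoc, u1, Matrix.one_mul]
    refine ⟨a' * (V * (b * Q)), Q * (b' * (U * a)), ?_, ?_⟩
    · calc a' * (V * (b * Q)) * (Q * (b' * (U * a)))
          = a' * (V * (b * (Q * Q) * b' * U)) * a := by simp only [Matrix.mul_assoc]
        _ = (a' * a) * P * (a' * a) := by
            rw [hQ, h1, ← Matrix.mul_assoc V, u1, Matrix.one_mul]; simp only [Matrix.mul_assoc]
        _ = P := by rw [e1]; simp
    · calc Q * (b' * (U * a)) * (a' * (V * (b * Q)))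
          = Q * b' * U * a * a' * (V * (b * Q)) := by simp only [Matrix.mul_assoc]
        _ = (b' * b) * (Q * b' * U) * a * a' * (V * (b * Q * (b' * b))) := by rw [e2]; simp
        _ = b' * (b * Q * b' * U) * a * a' * (V * (b * Q * b')) * b := by
            simp only [Matrix.mul_assoc]
        _ = b' * U * (a * P * (a' * a) * (a' * a) * P * a') * V * b := by
            rw [h1, h2]; simp only [Matrix.mul_assoc]
        _ = b' * U * (a * P * a') * V * b := by
            rw [e1, Matrix.mul_one, Matrix.mul_one, Matrix.mul_assoc a P P, hP]
        _ = b' * (U * (a * P * a') * V) * b := by simp only [Matrix.mul_assoc]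
        _ = (b' * b) * Q * (b' * b) := by rw [hU]; simp only [Matrix.mul_assoc]
        _ = Q := by rw [e2]; simp
  · rintro ⟨X, Y, hXY, hYX⟩
    change Matrix (Fin m) (Fin l) A at X
    change Matrix (Fin l) (Fin m) A at Y
    change X * Y = P at hXY
    change Y * X = Q at hYX
    -- normalise so that `X = P X Q` and `Y = Q Y P`
    obtain ⟨X, Y, hXY, hYX, hX1, hX2, hY1, hY2⟩ : ∃ (X : Matrix (Fin m) (Fin l) A)
        (Y : Matrix (Fin l) (Fin m) A), X * Y = P ∧ Y * X = Q ∧ P * X = X ∧ X * Q = X ∧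
          Q * Y = Y ∧ Y * P = Y := by
      have hPX : P * X = X * Q := by rw [← hXY, Matrix.mul_assoc, hYX]
      have hYP : Y * P = Q * Y := by rw [← hXY, ← Matrix.mul_assoc, hYX]
      refine ⟨P * X, Y * P, ?_, ?_, ?_, ?_, ?_, ?_⟩
      · rw [Matrix.mul_assoc, ← Matrix.mul_assoc X, hXY, hP, hP]
      · rw [Matrix.mul_assoc, ← Matrix.mul_assoc P, hP, hPX, ← Matrix.mul_assoc, hYX, hQ]
      · rw [← Matrix.mul_assoc, hP]
      · rw [hPX, Matrix.mul_assoc, hQ]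
      · rw [hYP, ← Matrix.mul_assoc, hQ]
      · rw [Matrix.mul_assoc, hP]
    let e : Fin l ⊕ Fin m ≃ Fin (m + l) := finSumFinEquiv.trans (finCongr (Nat.add_comm l m))
    let e' : Fin m ⊕ Fin l ≃ Fin (m + l) := finSumFinEquiv
    have padP : pad (m + l) P = (Matrix.fromBlocks P 0 0 0).submatrix e'.symm e'.symm := by
      ext i j
      obtain ⟨i, rfl⟩ := e'.surjective i
      obtain ⟨j, rfl⟩ := e'.surjective j
      rcases i with i | i <;> rcases j with j | j <;> simp [pad, e']
    have padQ : pad (m + l) Q = (Matrix.fromBlocks Q 0 0 0).submatrix e.symm e.symm := by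
      ext i j
      obtain ⟨i, rfl⟩ := e.surjective i
      obtain ⟨j, rfl⟩ := e.surjective j
      rcases i with i | i <;> rcases j with j | j <;>
        simp only [Matrix.submatrix_apply, Equiv.symm_apply_apply] <;> simp [pad, e]
    let V := (Matrix.fromBlocks X (1 - P) (1 - Q) Y).submatrix e'.symm e.symm
    let U := (Matrix.fromBlocks Y (1 - Q) (1 - P) X).submatrix e.symm e'.symm
    have hUV : U * V = 1 := by
      rw [Matrix.submatrix_mul_equiv, Matrix.fromBlocks_multiply]
      simp [Matrix.mul_sub, Matrix.sub_mul, hXY, hYX, hP, hQ, hX1, hX2, hY1, hY2]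
    have hVU : V * U = 1 := by
      rw [Matrix.submatrix_mul_equiv, Matrix.fromBlocks_multiply]
      simp [Matrix.mul_sub, Matrix.sub_mul, hXY, hYX, hP, hQ, hX1, hX2, hY1, hY2]
    refine ⟨m + l, by simp, by simp, ⟨U, V, hUV, hVU⟩, ?_⟩
    simp only [Units.inv_mk]
    rw [padP, padQ, Matrix.submatrix_mul_equiv, Matrix.submatrix_mul_equiv,
      Matrix.fromBlocks_multiply, Matrix.fromBlocks_multiply]
    simp [Matrix.mul_sub, Matrix.sub_mul, hP, hY2, hYX]

theorem equivalent_equivalence : Equivalence (Equivalent (A := A)) where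
  refl P := (equivalent_iff P P).2 ⟨P.mat, P.mat, P.isIdempotentElem, P.isIdempotentElem⟩
  symm {P Q} h := by
    obtain ⟨X, Y, h1, h2⟩ := (equivalent_iff P Q).1 h
    exact (equivalent_iff Q P).2 ⟨Y, X, h2, h1⟩
  trans {P Q R} h h' := by
    obtain ⟨X, Y, h1, h2⟩ := (equivalent_iff P Q).1 h
    obtain ⟨X', Y', h1', h2'⟩ := (equivalent_iff Q R).1 h'
    have hP : P.mat * P.mat = P.mat := P.isIdempotentElem
    have hR : R.mat * R.mat = R.mat := R.isIdempotentElem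
    refine (equivalent_iff P R).2 ⟨X * X', Y' * Y, ?_, ?_⟩
    · calc X * X' * (Y' * Y) = X * (X' * Y') * Y := by simp only [Matrix.mul_assoc]
        _ = X * Y * (X * Y) := by rw [h1', ← h2]; simp only [Matrix.mul_assoc]
        _ = P.mat := by rw [h1, hP]
    · calc Y' * Y * (X * X') = Y' * (Y * X) * X' := by simp only [Matrix.mul_assoc]
        _ = Y' * X' * (Y' * X') := by rw [h2, ← h1']; simp only [Matrix.mul_assoc]
        _ = R.mat := by rw [h2', hR]

instance setoid (A : Type*) [Ring A] : Setoid (IdempotentOver A) := ⟨Equivalent, equivalent_equivalence⟩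

theorem equivalent_of_submatrix {P Q : IdempotentOver A} {ι : Type} [Fintype ι]
    (M : Matrix ι ι A) (e : Fin P.size ≃ ι) (e' : Fin Q.size ≃ ι)
    (h : P.mat = M.submatrix e e) (h' : Q.mat = M.submatrix e' e') : P.Equivalent Q := by
  have hM : M * M = M := by
    have hP : P.mat * P.mat = P.mat := P.isIdempotentElem
    rw [h, Matrix.submatrix_mul_equiv] at hP
    have := congrArg (fun B => Matrix.submatrix B e.symm e.symm) hP
    simpa [Matrix.submatrix_submatrix] using this
  refine (equivalent_iff P Q).2 ⟨M.submatrix e e', M.submatrix e' e, ?_, ?_⟩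
  · rw [Matrix.submatrix_mul_equiv, hM, h]
  · rw [Matrix.submatrix_mul_equiv, hM, h']

theorem diagSum_congr {P P' Q Q' : IdempotentOver A} (h : P.Equivalent P')
    (h' : Q.Equivalent Q') : (P.diagSum Q).Equivalent (P'.diagSum Q') := by
  obtain ⟨X, Y, h1, h2⟩ := (equivalent_iff _ _).1 h
  obtain ⟨X', Y', h1', h2'⟩ := (equivalent_iff _ _).1 h'
  let Z : Matrix (Fin (P.size + Q.size)) (Fin (P'.size + Q'.size)) A :=
    (Matrix.fromBlocks X 0 0 X').submatrix finSumFinEquiv.symm finSumFinEquiv.symm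
  let W : Matrix (Fin (P'.size + Q'.size)) (Fin (P.size + Q.size)) A :=
    (Matrix.fromBlocks Y 0 0 Y').submatrix finSumFinEquiv.symm finSumFinEquiv.symm
  have e1 : Z * W = (P.diagSum Q).mat := by
    rw [Matrix.submatrix_mul_equiv, Matrix.fromBlocks_multiply]
    simp [diagSum, h1, h1']
  have e2 : W * Z = (P'.diagSum Q').mat := by
    rw [Matrix.submatrix_mul_equiv, Matrix.fromBlocks_multiply]
    simp [diagSum, h2, h2']
  exact (equivalent_iff _ _).2 ⟨Z, W, e1, e2⟩

theorem diagSum_assoc (P Q R : IdempotentOver A) :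
    ((P.diagSum Q).diagSum R).Equivalent (P.diagSum (Q.diagSum R)) := by
  obtain ⟨m, P, hP⟩ := P
  obtain ⟨l, Q, hQ⟩ := Q
  obtain ⟨r, R, hR⟩ := R
  let M := Matrix.fromBlocks (Matrix.fromBlocks P 0 0 Q) 0 0 R
  let e : Fin ((m + l) + r) ≃ (Fin m ⊕ Fin l) ⊕ Fin r :=
    finSumFinEquiv.symm.trans (Equiv.sumCongr finSumFinEquiv.symm (Equiv.refl _))
  let e' : Fin (m + (l + r)) ≃ (Fin m ⊕ Fin l) ⊕ Fin r :=
    finSumFinEquiv.symm.trans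
      ((Equiv.sumCongr (Equiv.refl _) finSumFinEquiv.symm).trans (Equiv.sumAssoc _ _ _).symm)
  have h : (Matrix.fromBlocks ((Matrix.fromBlocks P 0 0 Q).submatrix
      finSumFinEquiv.symm finSumFinEquiv.symm) 0 0 R).submatrix
      finSumFinEquiv.symm finSumFinEquiv.symm = M.submatrix e e := by
    ext i j
    simp only [Matrix.submatrix_apply, Equiv.trans_apply, e, M]
    rcases finSumFinEquiv.symm i with i | i <;> rcases finSumFinEquiv.symm j with j | j <;> simp
  have h' : (Matrix.fromBlocks P 0 0 ((Matrix.fromBlocks Q 0 0 R).submatrix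
      finSumFinEquiv.symm finSumFinEquiv.symm)).submatrix
      finSumFinEquiv.symm finSumFinEquiv.symm = M.submatrix e' e' := by
    ext i j
    simp only [Matrix.submatrix_apply, Equiv.trans_apply, e', M]
    rcases finSumFinEquiv.symm i with i | i <;> rcases finSumFinEquiv.symm j with j | j
    · simp
    · rcases h : finSumFinEquiv.symm j with j | j <;> simp [h]
    · rcases h : finSumFinEquiv.symm i with i | i <;> simp [h]
    · rcases h : finSumFinEquiv.symm i with i | i <;>
        rcases h' : finSumFinEquiv.symm j with j | j <;> simp [h, h']
  exact equivalent_of_submatrix M e e' h h'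

theorem diagSum_comm (P Q : IdempotentOver A) : (P.diagSum Q).Equivalent (Q.diagSum P) := by
  obtain ⟨m, P, hP⟩ := P
  obtain ⟨l, Q, hQ⟩ := Q
  let e : Fin (l + m) ≃ Fin m ⊕ Fin l := finSumFinEquiv.symm.trans (Equiv.sumComm _ _)
  have h : (Matrix.fromBlocks Q 0 0 P).submatrix finSumFinEquiv.symm finSumFinEquiv.symm =
      (Matrix.fromBlocks P 0 0 Q).submatrix e e := by
    ext i j
    simp only [Matrix.submatrix_apply, Equiv.trans_apply, e]
    rcases finSumFinEquiv.symm i with i | i <;> rcases finSumFinEquiv.symm j with j | j <;> simp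
  exact equivalent_of_submatrix (Matrix.fromBlocks P 0 0 Q) finSumFinEquiv.symm e rfl h

theorem diagSum_zero (P : IdempotentOver A) : (P.diagSum zero).Equivalent P := by
  obtain ⟨m, P, hP⟩ := P
  let e : Fin (m + 0) ≃ Fin m := finSumFinEquiv.symm.trans (Equiv.sumEmpty _ _)
  have h : (Matrix.fromBlocks P 0 0 (0 : Matrix (Fin 0) (Fin 0) A)).submatrix
      finSumFinEquiv.symm finSumFinEquiv.symm = P.submatrix e e := by
    ext i j
    simp only [Matrix.submatrix_apply, Equiv.trans_apply, e]
    rcases finSumFinEquiv.symm i with i | i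
    · rcases finSumFinEquiv.symm j with j | j
      · simp
      · exact j.elim0
    · exact i.elim0
  exact equivalent_of_submatrix P e (Equiv.refl _) h rfl

end IdempotentOver

/-- The set `𝔓(A)` of equivalence classes of idempotents over `A`. -/
def IdempotentClass (A : Type*) [Ring A] : Type _ := Quotient (IdempotentOver.setoid A)

namespace IdempotentClass

open IdempotentOver

variable {A : Type*} [Ring A]

/-- The class `[P]` of an idempotent. -/
def mk (P : IdempotentOver A) : IdempotentClass A := Quotient.mk _ P

instance : Add (IdempotentClass A) :=
  ⟨Quotient.map₂ diagSum fun _ _ h _ _ h' => diagSum_congr h h'⟩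

instance : Zero (IdempotentClass A) := ⟨mk IdempotentOver.zero⟩

theorem mk_add_mk (P Q : IdempotentOver A) : mk P + mk Q = mk (P.diagSum Q) := rfl

/-- `𝔓(A)` is an abelian monoid, with `[P] + [Q] = [P ⊞ Q]` and `0 = [0]`. -/
instance : AddCommMonoid (IdempotentClass A) where
  nsmul := nsmulRec
  add_assoc := by
    rintro ⟨P⟩ ⟨Q⟩ ⟨R⟩
    exact Quotient.sound (diagSum_assoc P Q R)
  zero_add := by
    rintro ⟨P⟩
    exact Quotient.sound (equivalent_equivalence.trans (diagSum_comm zero P) (diagSum_zero P))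
  add_zero := by
    rintro ⟨P⟩
    exact Quotient.sound (diagSum_zero P)
  add_comm := by
    rintro ⟨P⟩ ⟨Q⟩
    exact Quotient.sound (diagSum_comm P Q)

end IdempotentClass

/-- The group `K₀(A)` of a unital ring `A`: the Grothendieck group of `𝔓(A)`. -/
abbrev KZero (A : Type*) [Ring A] : Type _ := Algebra.GrothendieckAddGroup (IdempotentClass A)

/-! ### The C*-algebra `C(S_q^{2n+1})` and its standard projections -/

namespace QuantumSphere

open scoped ENNReal

/-- The Hilbert space `ℓ²(ℤ × ℕⁿ) = ℓ²(ℤ) ⊗ ℓ²(ℕ)^{⊗ n}`. -/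
abbrev Hilb (n : ℕ) : Type := lp (fun _ : ℤ × (Fin n → ℕ) => ℂ) 2

/-- For an injective `φ` and a function `c` bounded by `1`, the bounded operator on `ℓ²(ι)` given
by `(T f) i = c i * f (φ i)`; its adjoint maps the basis vector `e_i` to `conj (c i) • e_{φ i}`. -/
noncomputable def weightedComp {ι : Type} (φ : ι → ι) (hφ : Function.Injective φ) (c : ι → ℂ)
    (hc : ∀ i, ‖c i‖ ≤ 1) : lp (fun _ : ι => ℂ) 2 →L[ℂ] lp (fun _ : ι => ℂ) 2 :=
  have key : ∀ f : lp (fun _ : ι => ℂ) 2, ∀ i, ‖c i * f (φ i)‖ ^ (2 : ℝ≥0∞).toReal ≤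
      ‖f (φ i)‖ ^ (2 : ℝ≥0∞).toReal := fun f i => by
    have : ‖c i * f (φ i)‖ ≤ ‖f (φ i)‖ := by
      rw [norm_mul]
      exact mul_le_of_le_one_left (norm_nonneg _) (hc i)
    gcongr
  have summ : ∀ f : lp (fun _ : ι => ℂ) 2,
      Summable fun i => ‖f (φ i)‖ ^ (2 : ℝ≥0∞).toReal := fun f =>
    ((lp.memℓp f).summable (by norm_num)).comp_injective hφ
  LinearMap.mkContinuous
    { toFun := fun f => ⟨fun i => c i * f (φ i), memℓp_gen
        ((summ f).of_nonneg_of_le (fun i => by positivity) (key f))⟩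
      map_add' := fun f g => by
        ext i
        exact mul_add (c i) (f (φ i)) (g (φ i))
      map_smul' := fun a f => by
        ext i
        simp [mul_left_comm] } 1 (fun f => by
    rw [one_mul]
    refine lp.norm_le_of_tsum_le (by norm_num) (norm_nonneg _) ?_
    rw [lp.norm_rpow_eq_tsum (by norm_num) f]
    refine le_trans (Summable.tsum_le_tsum (key f)
      ((summ f).of_nonneg_of_le (fun i => by positivity) (key f)) (summ f)) ?_
    exact tsum_comp_le_tsum_of_inj ((lp.memℓp f).summable (by norm_num))
      (fun i => by positivity) hφ)

theorem weightedComp_apply {ι : Type} (φ : ι → ι) (hφ : Function.Injective φ) (c : ι → ℂ)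
    (hc : ∀ i, ‖c i‖ ≤ 1) (f : lp (fun _ : ι => ℂ) 2) (i : ι) :
    weightedComp φ hφ c hc f i = c i * f (φ i) := rfl

theorem star_weightedComp_apply {ι : Type} [DecidableEq ι] (φ : ι → ι)
    (hφ : Function.Injective φ) (c : ι → ℂ) (hc : ∀ i, ‖c i‖ ≤ 1)
    (f : lp (fun _ : ι => ℂ) 2) (i : ι) :
    star (weightedComp φ hφ c hc) f (φ i) = starRingEnd ℂ (c i) * f i := by
  have h : weightedComp φ hφ c hc (lp.single 2 (φ i) 1) = lp.single 2 i (c i) := by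
    ext j
    rw [weightedComp_apply]
    by_cases hj : j = i
    · subst hj; simp
    · have : φ j ≠ φ i := fun h => hj (hφ h)
      simp [hj, this]
  have h2 := ContinuousLinearMap.adjoint_inner_right (weightedComp φ hφ c hc)
    (lp.single 2 (φ i) 1) f
  rw [h, lp.inner_single_left, lp.inner_single_left] at h2
  simpa [ContinuousLinearMap.star_eq_adjoint, mul_comm] using h2

variable {n : ℕ}

/-- The map `(z, w) ↦ (z + 1, w + δ_i)` on `ℤ × ℕⁿ`, and `(z, w) ↦ (z + 1, w)` for `i = n`. -/
def stepIdx (i : Fin (n + 1)) (x : ℤ × (Fin n → ℕ)) : ℤ × (Fin n → ℕ) :=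
  (x.1 + 1, fun l => if (l : ℕ) = i then x.2 l + 1 else x.2 l)

theorem stepIdx_injective (i : Fin (n + 1)) : Function.Injective (stepIdx i) := by
  rintro ⟨a, w⟩ ⟨b, v⟩ h
  simp only [stepIdx, Prod.mk.injEq] at h
  refine Prod.ext (by simpa using h.1) (funext fun l => ?_)
  have := congrFun h.2 l
  split_ifs at this <;> simp_all

/-- The weight of the `i`-th generator at `(z, w)`: the product of `q ^ w_l` over the tensor factors
`l < i` and of `√(1 - q ^ (2 (w_i + 1)))` for the factor `i` (if `i < n`). -/
noncomputable def stepWeight (q : Set.Ioo (0 : ℝ) 1) (i : Fin (n + 1)) (x : ℤ × (Fin n → ℕ)) : ℝ :=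
  ∏ l : Fin n, if (l : ℕ) < i then (q : ℝ) ^ x.2 l else
    if (l : ℕ) = i then √(1 - (q : ℝ) ^ (2 * (x.2 l + 1))) else 1

theorem stepWeight_nonneg (q : Set.Ioo (0 : ℝ) 1) (i : Fin (n + 1)) (x : ℤ × (Fin n → ℕ)) :
    0 ≤ stepWeight q i x := by
  have := q.2.1
  refine Finset.prod_nonneg fun l _ => ?_
  split_ifs <;> positivity

theorem norm_stepWeight_le (q : Set.Ioo (0 : ℝ) 1) (i : Fin (n + 1)) (x : ℤ × (Fin n → ℕ)) :
    ‖(stepWeight q i x : ℂ)‖ ≤ 1 := by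
  have h0 := q.2.1
  have h1 := q.2.2
  rw [Complex.norm_real, Real.norm_of_nonneg (stepWeight_nonneg q i x)]
  refine Finset.prod_le_one (fun l _ => ?_) (fun l _ => ?_)
  · split_ifs <;> positivity
  · split_ifs
    · exact pow_le_one₀ h0.le h1.le
    · rw [Real.sqrt_le_left zero_le_one]
      have : 0 < (q : ℝ) ^ (2 * (x.2 l + 1)) := by positivity
      linarith
    · exact le_rfl

/-- The generator `u_{n+1,n+1-i} = t ⊗ γ^{⊗ i} ⊗ α* ⊗ 1^{⊗ (n-1-i)}` for `0 ≤ i < n`, and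
`u_{n+1,1} = t ⊗ γ^{⊗ n}` for `i = n`. Here `t` is the bilateral shift of `ℓ²(ℤ)`,
`α* e_w = √(1 - q ^ (2 (w + 1))) e_{w+1}` and `γ e_w = q ^ w e_w`; see `gen_single`. -/
noncomputable def gen (q : Set.Ioo (0 : ℝ) 1) (i : Fin (n + 1)) : Hilb n →L[ℂ] Hilb n :=
  star (weightedComp (stepIdx i) (stepIdx_injective i) (fun x => (stepWeight q i x : ℂ))
    (norm_stepWeight_le q i))

theorem gen_single (q : Set.Ioo (0 : ℝ) 1) (i : Fin (n + 1)) (x : ℤ × (Fin n → ℕ)) :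
    gen q i (lp.single 2 x 1) = lp.single 2 (stepIdx i x) (stepWeight q i x : ℂ) := by
  refine lp.ext (funext fun y => ?_)
  have h := ContinuousLinearMap.adjoint_inner_right (weightedComp (stepIdx i) (stepIdx_injective i)
    (fun x => (stepWeight q i x : ℂ)) (norm_stepWeight_le q i)) (lp.single 2 y 1) (lp.single 2 x 1)
  rw [lp.inner_single_left, lp.inner_single_right, ← ContinuousLinearMap.star_eq_adjoint,
    weightedComp_apply] at h
  have h' : gen q i (lp.single 2 x 1) y = starRingEnd ℂ
      ((stepWeight q i x : ℂ) * (lp.single 2 y (1 : ℂ) : lp (fun _ => ℂ) 2) (stepIdx i x)) := by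
    simpa [gen] using h
  rw [h']
  by_cases hy : stepIdx i x = y
  · subst hy; simp
  · simp [hy, Ne.symm hy]

/-- The C*-algebra `C(S_q^{2n+1})`, realised on `ℓ²(ℤ × ℕⁿ)`: the norm closed unital
*-algebra of operators generated by the `u_{n+1,m}`, `1 ≤ m ≤ n + 1`. -/
noncomputable def sphereAlgebra (n : ℕ) (q : Set.Ioo (0 : ℝ) 1) :
    StarSubalgebra ℂ (Hilb n →L[ℂ] Hilb n) :=
  (StarAlgebra.adjoin ℂ (Set.range (gen (n := n) q))).topologicalClosure

theorem gen_mem (q : Set.Ioo (0 : ℝ) 1) (i : Fin (n + 1)) : gen q i ∈ sphereAlgebra n q :=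
  StarSubalgebra.le_topologicalClosure _ (StarAlgebra.subset_adjoin ℂ _ ⟨i, rfl⟩)

/-- The diagonal projection of `ℓ²(ι)` onto the closed span of the `e_i` with `i ∈ s`. -/
noncomputable def diagProj {ι : Type} (s : Set ι) : lp (fun _ : ι => ℂ) 2 →L[ℂ] lp (fun _ : ι => ℂ) 2 :=
  weightedComp id Function.injective_id (s.indicator 1) fun i => by
    by_cases h : i ∈ s <;> simp [h]

theorem diagProj_apply {ι : Type} (s : Set ι) (f : lp (fun _ : ι => ℂ) 2) (i : ι) :
    diagProj s f i = s.indicator 1 i * f i := rfl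

theorem diagProj_isIdempotentElem {ι : Type} (s : Set ι) : IsIdempotentElem (diagProj s) := by
  ext f i
  by_cases h : i ∈ s <;> simp [diagProj_apply, h]

/-- The operator `1 ⊗ P₁^{⊗ j} ⊗ P_k ⊗ I^{⊗ (n-1-j)}` (`j` counted from `0`), where `P_k` is the
projection of `ℓ²(ℕ)` onto the span of `e_0, …, e_{k-1}`. -/
noncomputable def stdOp (j : Fin n) (k : ℕ) : Hilb n →L[ℂ] Hilb n :=
  diagProj {x | (∀ l : Fin n, l < j → x.2 l = 0) ∧ x.2 j < k}

section Membership

/-- `T` is the diagonal operator with entries `c`. -/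
def IsDiag {ι : Type} (T : lp (fun _ : ι => ℂ) 2 →L[ℂ] lp (fun _ : ι => ℂ) 2) (c : ι → ℂ) : Prop :=
  ∀ f i, T f i = c i * f i

namespace IsDiag

variable {ι : Type} {S T : lp (fun _ : ι => ℂ) 2 →L[ℂ] lp (fun _ : ι => ℂ) 2} {c d : ι → ℂ}

theorem ext (hS : IsDiag S c) (hT : IsDiag T c) : S = T := by
  refine ContinuousLinearMap.ext fun f => lp.ext (funext fun i => ?_)
  rw [hS, hT]

theorem add (hS : IsDiag S c) (hT : IsDiag T d) : IsDiag (S + T) (c + d) := fun f i => by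
  simp [hS f i, hT f i, add_mul]

theorem sub (hS : IsDiag S c) (hT : IsDiag T d) : IsDiag (S - T) (c - d) := fun f i => by
  simp [hS f i, hT f i, sub_mul]

theorem smul (a : ℂ) (hS : IsDiag S c) : IsDiag (a • S) (a • c) := fun f i => by
  simp [hS f i, mul_assoc]

theorem mul (hS : IsDiag S c) (hT : IsDiag T d) : IsDiag (S * T) (c * d) := fun f i => by
  simp [hS (T f) i, hT f i, mul_assoc]

theorem one : IsDiag (1 : lp (fun _ : ι => ℂ) 2 →L[ℂ] lp (fun _ : ι => ℂ) 2) 1 := fun f i => by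
  simp

theorem pow (hS : IsDiag S c) (N : ℕ) : IsDiag (S ^ N) (c ^ N) := by
  induction N with
  | zero => simpa using one
  | succ N ih => simpa [pow_succ] using ih.mul hS

theorem diagProj (s : Set ι) : IsDiag (diagProj s) (s.indicator 1) := fun _ _ => rfl

theorem norm_le (hS : IsDiag S c) {r : ℝ} (hr : 0 ≤ r) (h : ∀ i, ‖c i‖ ≤ r) : ‖S‖ ≤ r := by
  refine ContinuousLinearMap.opNorm_le_bound _ hr fun f => ?_
  rw [← Real.norm_of_nonneg hr, ← norm_smul]
  refine lp.norm_mono (by norm_num) fun i => ?_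
  rw [hS f i]
  simp only [lp.coeFn_smul, Pi.smul_apply, norm_mul, norm_smul, Real.norm_of_nonneg hr]
  exact mul_le_mul_of_nonneg_right (h i) (norm_nonneg _)

/-- If `c = 1` on `s` and `|c| ≤ r < 1` off `s`, then the powers of `S` converge to the projection
onto `s`. -/
theorem diagProj_mem (A : StarSubalgebra ℂ (lp (fun _ : ι => ℂ) 2 →L[ℂ] lp (fun _ : ι => ℂ) 2))
    (hA : IsClosed (A : Set (lp (fun _ : ι => ℂ) 2 →L[ℂ] lp (fun _ : ι => ℂ) 2)))
    (hS : IsDiag S c) (hSA : S ∈ A) (s : Set ι) {r : ℝ} (hr0 : 0 ≤ r) (hr : r < 1)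
    (h1 : ∀ i ∈ s, c i = 1) (h2 : ∀ i ∉ s, ‖c i‖ ≤ r) : QuantumSphere.diagProj s ∈ A := by
  refine hA.mem_of_tendsto (f := fun N : ℕ => S ^ (N + 1)) (b := Filter.atTop) ?_
    (Filter.Eventually.of_forall fun N => pow_mem hSA _)
  rw [tendsto_iff_norm_sub_tendsto_zero]
  refine squeeze_zero (fun _ => norm_nonneg _) (fun N => ?_)
    ((tendsto_pow_atTop_nhds_zero_of_lt_one hr0 hr).comp (Filter.tendsto_add_atTop_nat 1))
  refine ((hS.pow (N + 1)).sub (diagProj s)).norm_le (pow_nonneg hr0 _) fun i => ?_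
  by_cases hi : i ∈ s
  · simp only [Pi.sub_apply, Pi.pow_apply, h1 i hi, Set.indicator_of_mem hi, Pi.one_apply, one_pow,
      sub_self, norm_zero]
    exact pow_nonneg hr0 _
  · simp only [Pi.sub_apply, Pi.pow_apply, Set.indicator_of_notMem hi, sub_zero, norm_pow]
    exact pow_le_pow_left₀ (norm_nonneg _) (h2 i hi) _

end IsDiag

/-- The partial sum `w_0 + ⋯ + w_{i-1}`. -/
def partialSum (i : ℕ) (x : ℤ × (Fin n → ℕ)) : ℕ := ∑ l : Fin n, if (l : ℕ) < i then x.2 l else 0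

theorem partialSum_succ (i : Fin n) (x : ℤ × (Fin n → ℕ)) :
    partialSum (i + 1) x = partialSum i x + x.2 i := by
  have : x.2 i = ∑ l : Fin n, if l = i then x.2 l else 0 := by simp
  rw [this, partialSum, partialSum, ← Finset.sum_add_distrib]
  refine Finset.sum_congr rfl fun l _ => ?_
  by_cases h : l = i
  · subst h; simp
  · have h' : (l : ℕ) ≠ i := fun h' => h (Fin.ext h')
    have : (l : ℕ) < i + 1 ↔ (l : ℕ) < i := by omega
    simp [this, h]

theorem stepWeight_sq (q : Set.Ioo (0 : ℝ) 1) (i : Fin n) (x : ℤ × (Fin n → ℕ)) :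
    stepWeight q i.castSucc x ^ 2 =
      (q : ℝ) ^ (2 * partialSum i x) - q ^ 2 * q ^ (2 * partialSum (i + 1) x) := by
  have h0 := q.2.1
  have h1 := q.2.2
  have key : stepWeight q i.castSucc x ^ 2 =
      (∏ l : Fin n, if (l : ℕ) < i then (q : ℝ) ^ (2 * x.2 l) else 1) *
        ∏ l : Fin n, if l = i then (1 - (q : ℝ) ^ (2 * (x.2 l + 1))) else 1 := by
    rw [stepWeight, ← Finset.prod_pow, ← Finset.prod_mul_distrib]
    refine Finset.prod_congr rfl fun l _ => ?_
    have hle : (q : ℝ) ^ (2 * (x.2 l + 1)) ≤ 1 := pow_le_one₀ h0.le h1.le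
    rcases lt_trichotomy (l : ℕ) i with h | h | h
    · have : l ≠ i := fun h' => by simp [h'] at h
      simp [h, this, ← pow_mul, mul_comm]
    · obtain rfl : l = i := Fin.ext h
      simp [Real.sq_sqrt (sub_nonneg.2 hle)]
    · have h2 : l ≠ i := fun h' => by simp [h'] at h
      simp [h2, h.not_gt, h.ne']
  have key2 : (∏ l : Fin n, if (l : ℕ) < i then (q : ℝ) ^ (2 * x.2 l) else 1) =
      (q : ℝ) ^ (2 * partialSum i x) := by
    rw [partialSum, Finset.mul_sum, ← Finset.prod_pow_eq_pow_sum]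
    refine Finset.prod_congr rfl fun l _ => ?_
    split_ifs <;> simp
  rw [key, key2, partialSum_succ]
  simp
  ring

theorem star_gen_mul_gen_isDiag (q : Set.Ioo (0 : ℝ) 1) (i : Fin (n + 1)) :
    IsDiag (star (gen q i) * gen q i) (fun x => ((stepWeight q i x ^ 2 : ℝ) : ℂ)) := fun f x => by
  classical
  rw [gen, star_star, mul_apply_eq_comp, weightedComp_apply, star_weightedComp_apply]
  simp only [Complex.conj_ofReal]
  push_cast
  ring

theorem exists_isDiag (q : Set.Ioo (0 : ℝ) 1) (i : ℕ) (hi : i ≤ n) :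
    ∃ D ∈ sphereAlgebra n q, IsDiag D (fun x => (((q : ℝ) ^ (2 * partialSum i x) : ℝ) : ℂ)) := by
  induction i with
  | zero => exact ⟨1, one_mem _, by simpa [partialSum] using! IsDiag.one⟩
  | succ i ih =>
    obtain ⟨D, hD, hd⟩ := ih (by omega)
    let j : Fin n := ⟨i, hi⟩
    have hg := gen_mem q j.castSucc
    have hq : ((q : ℝ) : ℂ) ≠ 0 := by exact_mod_cast q.2.1.ne'
    refine ⟨((((q : ℝ) : ℂ) ^ 2)⁻¹) • (D - star (gen q j.castSucc) * gen q j.castSucc),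
      SMulMemClass.smul_mem _ (sub_mem hD (mul_mem (star_mem hg) hg)), ?_⟩
    convert! (hd.sub (star_gen_mul_gen_isDiag q j.castSucc)).smul ((((q : ℝ) : ℂ) ^ 2)⁻¹) using 1
    funext x
    simp only [Pi.smul_apply, Pi.sub_apply, stepWeight_sq, j]
    push_cast
    rw [sub_sub_cancel, smul_eq_mul, inv_mul_cancel_left₀ (pow_ne_zero 2 hq)]

theorem sphereAlgebra_isClosed (n : ℕ) (q : Set.Ioo (0 : ℝ) 1) :
    IsClosed (sphereAlgebra n q : Set (Hilb n →L[ℂ] Hilb n)) :=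
  StarSubalgebra.isClosed_topologicalClosure _

theorem diagProj_partialSum_mem (q : Set.Ioo (0 : ℝ) 1) (i : ℕ) (hi : i ≤ n) (k : ℕ) :
    diagProj {x | partialSum i x < k} ∈ sphereAlgebra n q := by
  have h0 := q.2.1
  have h1 := q.2.2
  induction k with
  | zero =>
    have : diagProj {x : ℤ × (Fin n → ℕ) | partialSum i x < 0} = 0 := by
      ext f x
      simp [diagProj_apply]
    rw [this]
    exact zero_mem _
  | succ k ih =>
    obtain ⟨D, hD, hd⟩ := exists_isDiag q i hi
    have hE : diagProj {x : ℤ × (Fin n → ℕ) | partialSum i x = k} ∈ sphereAlgebra n q := by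
      refine IsDiag.diagProj_mem (r := (q : ℝ) ^ 2) _ (sphereAlgebra_isClosed n q)
        ((hd.sub (hd.mul (IsDiag.diagProj {x | partialSum i x < k}))).smul
          (((((q : ℝ) ^ (2 * k))⁻¹ : ℝ) : ℂ)))
        (SMulMemClass.smul_mem _ (sub_mem hD (mul_mem hD ih))) _ (by positivity)
        (pow_lt_one₀ h0.le h1 (by norm_num)) ?_ ?_
      · intro x hx
        have hx' : partialSum i x = k := hx
        have hq : ((q : ℝ) : ℂ) ≠ 0 := by exact_mod_cast h0.ne'
        simp [hx', hq]
      · intro x hx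
        have hx' : partialSum i x ≠ k := hx
        rcases lt_or_gt_of_ne hx' with h | h
        · simp [h]
          positivity
        · have h3 : ¬ (partialSum i x < k) := by omega
          obtain ⟨d, hd'⟩ := Nat.exists_eq_add_of_lt h
          have : (((q : ℝ) ^ (2 * k))⁻¹ * (q : ℝ) ^ (2 * partialSum i x)) ≤ (q : ℝ) ^ 2 := by
            rw [hd', show 2 * (k + d + 1) = 2 * k + (2 + 2 * d) by ring, pow_add,
              inv_mul_cancel_left₀ (by positivity), pow_add]
            exact mul_le_of_le_one_right (by positivity) (pow_le_one₀ h0.le h1.le)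
          have h4 : 0 ≤ ((q : ℝ) ^ (2 * k))⁻¹ * (q : ℝ) ^ (2 * partialSum i x) := by positivity
          simp only [Pi.smul_apply, Pi.sub_apply, Pi.mul_apply, smul_eq_mul]
          rw [Set.indicator_of_notMem (by simpa using h3), mul_zero, sub_zero, ← Complex.ofReal_mul,
            Complex.norm_real, Real.norm_of_nonneg h4]
          exact this
    have : diagProj {x : ℤ × (Fin n → ℕ) | partialSum i x < k + 1} =
        diagProj {x | partialSum i x < k} + diagProj {x | partialSum i x = k} := by
      ext f x
      have h3 : ∀ s : Set (ℤ × (Fin n → ℕ)), ∀ y, y ∉ s → diagProj s f y = 0 := fun s y hy => by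
        simp [diagProj_apply, hy]
      have h4 : ∀ s : Set (ℤ × (Fin n → ℕ)), ∀ y ∈ s, diagProj s f y = f y := fun s y hy => by
        simp [diagProj_apply, hy]
      rw [add_apply, lp.coeFn_add, Pi.add_apply]
      rcases lt_trichotomy (partialSum i x) k with h | h | h
      · rw [h4 _ x (show partialSum i x < k + 1 by omega), h4 _ x h, h3 _ x h.ne, add_zero]
      · rw [h4 _ x (show partialSum i x < k + 1 by omega), h3 {x | partialSum i x < k} x
          (show ¬ partialSum i x < k by omega), h4 _ x h, zero_add]
      · rw [h3 _ x (show ¬ partialSum i x < k + 1 by omega), h3 {x | partialSum i x < k} x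
          (show ¬ partialSum i x < k by omega), h3 _ x h.ne', zero_add]
    rw [this]
    exact add_mem ih hE

theorem stdOp_mem (q : Set.Ioo (0 : ℝ) 1) (j : Fin n) (k : ℕ) : stdOp j k ∈ sphereAlgebra n q := by
  have : stdOp j k = diagProj {x : ℤ × (Fin n → ℕ) | partialSum j x < 1} *
      diagProj {x | partialSum (j + 1) x < k} := by
    have hset : {x : ℤ × (Fin n → ℕ) | (∀ l : Fin n, l < j → x.2 l = 0) ∧ x.2 j < k} =
        {x | partialSum j x < 1} ∩ {x | partialSum (j + 1) x < k} := by
      ext x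
      simp only [Set.mem_ofPred_eq, Set.mem_inter_iff, Nat.lt_one_iff, partialSum_succ]
      have : partialSum j x = 0 ↔ ∀ l : Fin n, l < j → x.2 l = 0 := by
        simp [partialSum]
      rw [this]
      refine and_congr_right fun h => ?_
      rw [this.2 h, zero_add]
    rw [stdOp, hset]
    ext f x
    by_cases h1 : partialSum j x < 1 <;> by_cases h2 : partialSum (j + 1) x < k <;>
      simp only [diagProj_apply, mul_apply_eq_comp, Set.indicator, Set.mem_inter_iff,
        Set.mem_ofPred_eq, h1, h2] <;> simp
  rw [this]
  exact mul_mem (diagProj_partialSum_mem q _ (by omega) _)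
    (diagProj_partialSum_mem q _ (by omega) _)

end Membership

/-- The standard projection `P_{j,k}`, `0 ≤ j ≤ n`, over `C(S_q^{2n+1})`: the identity of
`M_k(C(S_q^{2n+1}))` for `j = 0`, and the element
`1 ⊗ P₁^{⊗ (j-1)} ⊗ P_k ⊗ I^{⊗ (n-j)}` of `C(S_q^{2n+1})` for `1 ≤ j ≤ n`. -/
noncomputable def stdProj (n : ℕ) (q : Set.Ioo (0 : ℝ) 1) (j : Fin (n + 1)) (k : ℕ) :
    IdempotentOver (sphereAlgebra n q) :=
  Fin.cases (IdempotentOver.one k)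
    (fun i => IdempotentOver.ofElem ⟨stdOp i k, stdOp_mem q i k⟩
      (Subtype.ext (diagProj_isIdempotentElem _))) j

theorem isHermitian_stdProj (q : Set.Ioo (0 : ℝ) 1) (j : Fin (n + 1)) (k : ℕ) :
    (stdProj n q j k).mat.IsHermitian := by
  classical
  refine Fin.cases ?_ (fun i => ?_) j
  · exact Matrix.isHermitian_one
  · refine Matrix.ext fun _ _ => Subtype.ext ?_
    change star (stdOp i k) = stdOp i k
    refine ContinuousLinearMap.ext fun f => lp.ext (funext fun x => ?_)
    rw [stdOp, diagProj_apply]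
    refine (star_weightedComp_apply id _ _ _ f x).trans ?_
    congr 1
    simp only [Set.indicator]
    split_ifs <;> simp

/-- The quotient map `η : C(S_q^{2n+1}) → C(𝕋)`, determined by its values on the generators:
`u_{n+1,n+1}` goes to the identity function of the circle and `u_{n+1,m}`, `m ≤ n`, to `0`. -/
def IsSymbolMap {q : Set.Ioo (0 : ℝ) 1} (η : sphereAlgebra n q →⋆ₐ[ℂ] C(Circle, ℂ)) : Prop :=
  (∀ s : Circle, η ⟨gen q 0, gen_mem q 0⟩ s = s) ∧
    ∀ i : Fin (n + 1), i ≠ 0 → η ⟨gen q i, gen_mem q i⟩ = 0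

/-- The idempotent `P` has rank `r`: the vector bundle over the circle determined by the
idempotent `η(P)` over `C(𝕋)` has rank `r`. -/
def HasRank {q : Set.Ioo (0 : ℝ) 1} (P : IdempotentOver (sphereAlgebra n q)) (r : ℕ) : Prop :=
  ∃ η : sphereAlgebra n q →⋆ₐ[ℂ] C(Circle, ℂ), IsSymbolMap η ∧
    ∀ s : Circle, (P.mat.map fun a => η a s).rank = r

/-- The set `𝔓_r(C(S_q^{2n+1}))` of classes of idempotents of rank `r`. -/
def rankClasses (n : ℕ) (q : Set.Ioo (0 : ℝ) 1) (r : ℕ) :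
    Set (IdempotentClass (sphereAlgebra n q)) :=
  {x | ∃ P, HasRank P r ∧ IdempotentClass.mk P = x}

end QuantumSphere

open QuantumSphere

/-! Write S for the isometry `shift n`, that is t ⊗ s ⊗ 1 ⊗ ⋯ ⊗ 1 with s the unilateral shift (S =
t, a unitary, if n = 0). It lies in the algebra of the sphere (`shift_mem`): the generator
u_{n+1,n+1} is S times a positive diagonal operator whose entries tend to 1. The other generators
carry a factor γ in the place where S shifts, so they commute with S and S* up to a factor q. Hence
modulo the ideal of those a for which S*^m a and S*^m a* tend to 0, the algebra is generated by a
unitary. The symbol map η is onto C(𝕋), and its kernel is exactly this ideal (`symbol_surjective`,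
`symbol_eq_zero_iff`).

Complex vector bundles over the circle are trivial (`exists_eq_mk_one`), so η(P) is equivalent to an
identity matrix 1_r. The Whitehead trick lifts the conjugation, and P may be taken to be diag(1, …,
1, 0, …, 0) modulo the ideal (`exists_map_eq_diagonal`). An element of the ideal is the limit of its
corners by 1 - S^m S*^m. Newton's iteration therefore gives an idempotent near P, hence equivalent
to P, which is the sum of a copy of 1_r and an idempotent over such a corner
(`exists_ofMatrix_eq_one_add`).

The projection 1 - S^m S*^m is the sum of the m equivalent projections S^k (1 - S S*) S*^k, and the
corner of 1 - S S* is the algebra of the preceding sphere (`inflate_mem`, `compress_mem`). So the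
second summand comes from an idempotent over C(S_q^{2n-1}), and the classification proceeds by
induction on n (`exists_eq_stdClass`). The corner embedding sends [P_{j,k}] to [P_{j+1,k}] and is
injective on classes (`inflateClass_stdClass`, `inflateClass_injective`); with the rank, this
separates the classes listed.

Absorption comes from the isometry: 1 ~ S^m S*^m gives [1] + [1 - S^m S*^m] = [1], and the corner
embedding transports this to every level (`stdClass_add_of_lt`). So [P_{j,k}] with j ≥ 1 dies in K₀,
while the rank is additive and detects [P_{0,k}] for k > 0. -/

/-! ### Classes of idempotent matrices -/

namespace IdempotentClass

open Matrix IdempotentOver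

variable {A B : Type*} [Ring A] [Ring B]

/-- The class of an idempotent matrix with an arbitrary finite index type. -/
noncomputable def ofMatrix {ι : Type} [Fintype ι] (M : Matrix ι ι A)
    (hM : IsIdempotentElem M) : IdempotentClass A :=
  mk ⟨Fintype.card ι, M.submatrix (Fintype.equivFin ι).symm (Fintype.equivFin ι).symm, by
    rw [IsIdempotentElem, Matrix.submatrix_mul_equiv, hM.eq]⟩

theorem mk_eq_mk_iff {P Q : IdempotentOver A} : mk P = mk Q ↔ P.Equivalent Q :=
  Quotient.eq (r := IdempotentOver.setoid A)

variable {ι κ : Type} [Fintype ι] [Fintype κ]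

/-- Arbitrary finite index types are allowed so that block matrices and products of index sets need
no arithmetic in `Fin`. Nearly every later equivalence is proved by exhibiting X and Y. -/
theorem ofMatrix_eq_ofMatrix_iff {M : Matrix ι ι A} {N : Matrix κ κ A}
    (hM : IsIdempotentElem M) (hN : IsIdempotentElem N) :
    ofMatrix M hM = ofMatrix N hN ↔
      ∃ (X : Matrix ι κ A) (Y : Matrix κ ι A), X * Y = M ∧ Y * X = N := by
  rw [ofMatrix, ofMatrix, mk_eq_mk_iff, equivalent_iff]
  constructor
  · rintro ⟨X, Y, hXY, hYX⟩
    refine ⟨X.submatrix (Fintype.equivFin ι) (Fintype.equivFin κ),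
      Y.submatrix (Fintype.equivFin κ) (Fintype.equivFin ι), ?_, ?_⟩
    · rw [Matrix.submatrix_mul_equiv]
      erw [hXY]
      simp
    · rw [Matrix.submatrix_mul_equiv]
      erw [hYX]
      simp
  · rintro ⟨X, Y, hXY, hYX⟩
    refine ⟨X.submatrix (Fintype.equivFin ι).symm (Fintype.equivFin κ).symm,
      Y.submatrix (Fintype.equivFin κ).symm (Fintype.equivFin ι).symm, ?_, ?_⟩
    · rw [Matrix.submatrix_mul_equiv, hXY]
    · rw [Matrix.submatrix_mul_equiv, hYX]

theorem ofMatrix_congr {M N : Matrix ι ι A} (hM : IsIdempotentElem M) (h : M = N) :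
    ofMatrix M hM = ofMatrix N (h ▸ hM) := by
  subst h; rfl

theorem mk_eq_ofMatrix (P : IdempotentOver A) : mk P = ofMatrix P.mat P.isIdempotentElem := by
  obtain ⟨m, P, hP⟩ := P
  rw [ofMatrix, mk_eq_mk_iff]
  exact equivalent_of_submatrix P (Equiv.refl _)
    ((Fintype.equivFin (Fin m)).symm) rfl rfl

theorem exists_ofMatrix (x : IdempotentClass A) :
    ∃ (N : ℕ) (M : Matrix (Fin N) (Fin N) A) (hM : IsIdempotentElem M), x = ofMatrix M hM := by
  obtain ⟨P, rfl⟩ := Quotient.exists_rep x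
  exact ⟨_, _, _, mk_eq_ofMatrix P⟩

theorem mk_mk_eq_ofMatrix {m : ℕ} (P : Matrix (Fin m) (Fin m) A) (hP : IsIdempotentElem P) :
    mk ⟨m, P, hP⟩ = ofMatrix P hP :=
  mk_eq_ofMatrix _

theorem ofMatrix_submatrix (e : κ ≃ ι) {M : Matrix ι ι A} (hM : IsIdempotentElem M)
    (h : IsIdempotentElem (M.submatrix e e)) : ofMatrix (M.submatrix e e) h = ofMatrix M hM := by
  rw [ofMatrix_eq_ofMatrix_iff]
  refine ⟨M.submatrix e id, M.submatrix id e, ?_, ?_⟩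
  · rw [← Matrix.submatrix_mul _ _ e id e Function.bijective_id, hM.eq]
  · rw [Matrix.submatrix_mul_equiv, hM.eq, Matrix.submatrix_id_id]

theorem mk_one (k : ℕ) :
    mk (IdempotentOver.one k) = ofMatrix (1 : Matrix (Fin k) (Fin k) A) .one :=
  mk_mk_eq_ofMatrix _ _

theorem mk_one_eq_ofMatrix [DecidableEq ι] :
    mk (IdempotentOver.one (Fintype.card ι)) = ofMatrix (1 : Matrix ι ι A) .one := by
  have h : (1 : Matrix ι ι A).submatrix (Fintype.equivFin ι).symm (Fintype.equivFin ι).symm = 1 :=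
    Matrix.submatrix_one_equiv _
  rw [mk_one, ← ofMatrix_submatrix (Fintype.equivFin ι).symm .one (h ▸ .one)]
  exact (ofMatrix_congr _ h).symm

theorem ofMatrix_of_isEmpty [IsEmpty ι] {M : Matrix ι ι A} (hM : IsIdempotentElem M) :
    ofMatrix M hM = 0 := by
  have h0 : (0 : IdempotentClass A) = ofMatrix (0 : Matrix (Fin 0) (Fin 0) A) .zero :=
    mk_mk_eq_ofMatrix _ _
  rw [h0, ofMatrix_eq_ofMatrix_iff]
  exact ⟨0, 0, Subsingleton.elim _ _, Subsingleton.elim _ _⟩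

theorem mk_one_zero : mk (IdempotentOver.one 0) = (0 : IdempotentClass A) := by
  rw [mk_one, ofMatrix_of_isEmpty]

/-- The class of an idempotent element. -/
noncomputable def ofElem (a : A) (ha : IsIdempotentElem a) : IdempotentClass A :=
  mk (IdempotentOver.ofElem a ha)

theorem isIdempotentElem_of {a : A} (ha : IsIdempotentElem a) :
    IsIdempotentElem (Matrix.of fun _ _ : Fin 1 => a) := by
  ext i j
  simpa [Matrix.mul_apply] using ha.eq

theorem ofElem_eq_ofMatrix (a : A) (ha : IsIdempotentElem a) :
    ofElem a ha = ofMatrix (Matrix.of fun _ _ : Fin 1 => a) (isIdempotentElem_of ha) :=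
  mk_mk_eq_ofMatrix _ _

/-- The algebraic form of Murray–von Neumann equivalence, for idempotents of A itself. -/
theorem ofElem_eq_of_mul {a b x y : A} (ha : IsIdempotentElem a) (hb : IsIdempotentElem b)
    (hxy : x * y = a) (hyx : y * x = b) : ofElem a ha = ofElem b hb := by
  rw [ofElem_eq_ofMatrix, ofElem_eq_ofMatrix, ofMatrix_eq_ofMatrix_iff]
  refine ⟨Matrix.of fun _ _ => x, Matrix.of fun _ _ => y, ?_, ?_⟩ <;> ext i j <;>
    simp [Matrix.mul_apply, hxy, hyx]

theorem ofElem_one : ofElem (1 : A) .one = mk (IdempotentOver.one 1) := by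
  rw [ofElem_eq_ofMatrix, mk_one]
  refine ofMatrix_congr _ ?_
  ext i j
  simp [Matrix.one_apply, Subsingleton.elim i j]

theorem ofElem_congr {a b : A} (ha : IsIdempotentElem a) (h : a = b) :
    ofElem a ha = ofElem b (h ▸ ha) := by
  subst h; rfl

theorem ofMatrix_fromBlocks {M : Matrix ι ι A} {N : Matrix κ κ A} (hM : IsIdempotentElem M)
    (hN : IsIdempotentElem N) (h : IsIdempotentElem (Matrix.fromBlocks M 0 0 N)) :
    ofMatrix (Matrix.fromBlocks M 0 0 N) h = ofMatrix M hM + ofMatrix N hN := by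
  have key : (Matrix.fromBlocks (M.submatrix (Fintype.equivFin ι).symm (Fintype.equivFin ι).symm) 0
      0 (N.submatrix (Fintype.equivFin κ).symm (Fintype.equivFin κ).symm)).submatrix
        finSumFinEquiv.symm finSumFinEquiv.symm = (Matrix.fromBlocks M 0 0 N).submatrix
          (finSumFinEquiv.symm.trans
            (Equiv.sumCongr (Fintype.equivFin ι).symm (Fintype.equivFin κ).symm))
          (finSumFinEquiv.symm.trans
            (Equiv.sumCongr (Fintype.equivFin ι).symm (Fintype.equivFin κ).symm)) := by
    ext i j
    simp only [Matrix.submatrix_apply, Equiv.trans_apply]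
    rcases finSumFinEquiv.symm i with i | i <;> rcases finSumFinEquiv.symm j with j | j <;> simp
  rw [ofMatrix, ofMatrix, ofMatrix, mk_add_mk, mk_eq_mk_iff]
  exact equivalent_of_submatrix (Matrix.fromBlocks M 0 0 N) (Fintype.equivFin (ι ⊕ κ)).symm
    (finSumFinEquiv.symm.trans
      (Equiv.sumCongr (Fintype.equivFin ι).symm (Fintype.equivFin κ).symm)) rfl key

theorem ofMatrix_zero : ofMatrix (0 : Matrix ι ι A) .zero = 0 := by
  rw [← mk_one_zero, mk_one, ofMatrix_eq_ofMatrix_iff]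
  exact ⟨0, 0, by simp, Subsingleton.elim _ _⟩

/-- The row (M N) times the column with blocks M and N is M + N, since both are idempotent;
orthogonality makes the product in the other order block diagonal. -/
theorem ofMatrix_add {M N : Matrix ι ι A} (hM : IsIdempotentElem M)
    (hN : IsIdempotentElem N) (h : IsIdempotentElem (M + N)) (hMN : M * N = 0) (hNM : N * M = 0) :
    ofMatrix (M + N) h = ofMatrix M hM + ofMatrix N hN := by
  have hb : IsIdempotentElem (Matrix.fromBlocks M 0 0 N) := by
    rw [IsIdempotentElem, Matrix.fromBlocks_multiply]
    simp [hM.eq, hN.eq]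
  rw [← ofMatrix_fromBlocks hM hN hb, ofMatrix_eq_ofMatrix_iff]
  refine ⟨Matrix.fromCols M N, Matrix.fromRows M N, ?_, ?_⟩
  · rw [Matrix.fromCols_mul_fromRows, hM.eq, hN.eq]
  · rw [Matrix.fromRows_mul_fromCols, hM.eq, hN.eq, hMN, hNM]

theorem ofElem_add {a b : A} (ha : IsIdempotentElem a) (hb : IsIdempotentElem b)
    (h : IsIdempotentElem (a + b)) (hab : a * b = 0) (hba : b * a = 0) :
    ofElem (a + b) h = ofElem a ha + ofElem b hb := by
  rw [ofElem_eq_ofMatrix, ofElem_eq_ofMatrix, ofElem_eq_ofMatrix,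
    ← ofMatrix_add (h := by
      ext i j; simpa [Matrix.mul_apply] using h.eq)]
  · rfl
  · ext i j; simpa [Matrix.mul_apply] using hab
  · ext i j; simpa [Matrix.mul_apply] using hba

theorem mk_one_add (k l : ℕ) :
    mk (IdempotentOver.one k) + mk (IdempotentOver.one l) =
      (mk (IdempotentOver.one (k + l)) : IdempotentClass A) := by
  have h := Matrix.fromBlocks_one (l := Fin k) (m := Fin l) (α := A)
  have h' := mk_one_eq_ofMatrix (A := A) (ι := Fin k ⊕ Fin l)
  rw [Fintype.card_sum, Fintype.card_fin, Fintype.card_fin] at h'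
  rw [h', mk_one, mk_one, ← ofMatrix_fromBlocks _ _ (h ▸ .one)]
  exact ofMatrix_congr _ h

theorem isIdempotentElem_map (f : A →ₙ+* B) {M : Matrix ι ι A} (hM : IsIdempotentElem M) :
    IsIdempotentElem (M.map f) := by
  rw [IsIdempotentElem, ← Matrix.map_mul, hM.eq]

/-- The map of classes induced by a (not necessarily unital) ring homomorphism. -/
def map (f : A →ₙ+* B) : IdempotentClass A → IdempotentClass B :=
  Quotient.map (fun P => ⟨P.size, P.mat.map f, isIdempotentElem_map f P.isIdempotentElem⟩)
    fun P Q h => by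
      obtain ⟨X, Y, hXY, hYX⟩ := (equivalent_iff P Q).1 h
      exact (equivalent_iff _ _).2 ⟨X.map f, Y.map f,
        (Matrix.map_mul (f := f)).symm.trans (congrArg (fun M => M.map f) hXY),
        (Matrix.map_mul (f := f)).symm.trans (congrArg (fun M => M.map f) hYX)⟩

theorem map_ofMatrix (f : A →ₙ+* B) {M : Matrix ι ι A} (hM : IsIdempotentElem M) :
    map f (ofMatrix M hM) = ofMatrix (M.map f) (isIdempotentElem_map f hM) := rfl

theorem map_ofElem (f : A →ₙ+* B) {a : A} (ha : IsIdempotentElem a) :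
    map f (ofElem a ha) = ofElem (f a) (ha.map f) := rfl

theorem map_add (f : A →ₙ+* B) (x y : IdempotentClass A) : map f (x + y) = map f x + map f y := by
  obtain ⟨m, M, hM, rfl⟩ := exists_ofMatrix x
  obtain ⟨l, N, hN, rfl⟩ := exists_ofMatrix y
  have hb : IsIdempotentElem (Matrix.fromBlocks M 0 0 N) := by
    rw [IsIdempotentElem, Matrix.fromBlocks_multiply]
    simp [hM.eq, hN.eq]
  rw [← ofMatrix_fromBlocks hM hN hb, map_ofMatrix, map_ofMatrix, map_ofMatrix,
    ← ofMatrix_fromBlocks (h := by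
      have := isIdempotentElem_map f hb
      rwa [Matrix.fromBlocks_map, Matrix.map_zero _ (_root_.map_zero f),
        Matrix.map_zero _ (_root_.map_zero f)] at this)]
  refine ofMatrix_congr _ ?_
  rw [Matrix.fromBlocks_map, Matrix.map_zero _ (_root_.map_zero f),
    Matrix.map_zero _ (_root_.map_zero f)]

theorem map_zero (f : A →ₙ+* B) : map f 0 = 0 := by
  rw [← ofMatrix_zero (ι := Fin 0), map_ofMatrix, ← ofMatrix_zero (ι := Fin 0)]
  exact ofMatrix_congr _ (Subsingleton.elim _ _)

/-- An isomorphism onto a corner `e B e` induces an injective map on classes. -/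
theorem map_injective (f : A →ₙ+* B) (hf : Function.Injective f)
    (hcorner : ∀ b : B, ∃ a : A, f a = f 1 * b * f 1) : Function.Injective (map f) := by
  intro x y h
  obtain ⟨m, M, hM, rfl⟩ := exists_ofMatrix x
  obtain ⟨l, N, hN, rfl⟩ := exists_ofMatrix y
  rw [map_ofMatrix, map_ofMatrix, ofMatrix_eq_ofMatrix_iff] at h
  obtain ⟨X, Y, hXY, hYX⟩ := h
  choose g hg using hcorner
  rw [ofMatrix_eq_ofMatrix_iff]
  have hinj : ∀ k l : ℕ, Function.Injective fun M : Matrix (Fin k) (Fin l) A => M.map f :=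
    fun _ _ => Matrix.map_injective hf
  -- sandwiching by the unit of the corner
  have hlift : ∀ {k l : ℕ} (P : Matrix (Fin k) (Fin k) A) (Q : Matrix (Fin l) (Fin l) A)
      (Z : Matrix (Fin k) (Fin l) B),
      (P * Z.map g * Q).map f = P.map f * Z * Q.map f := by
    intro k l P Q Z
    have h1 : ∀ a : A, f a * f 1 = f a := fun a => by rw [← _root_.map_mul, mul_one]
    have h2 : ∀ a : A, f 1 * f a = f a := fun a => by rw [← _root_.map_mul, one_mul]
    rw [Matrix.map_mul, Matrix.map_mul]
    ext i j
    simp only [Matrix.mul_apply, Matrix.map_apply, hg, Finset.sum_mul]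
    refine Finset.sum_congr rfl fun s _ => Finset.sum_congr rfl fun t _ => ?_
    calc f (P i t) * (f 1 * Z t s * f 1) * f (Q s j)
        = (f (P i t) * f 1) * Z t s * (f 1 * f (Q s j)) := by simp only [mul_assoc]
      _ = _ := by rw [h1, h2]
  have hMf := (isIdempotentElem_map f hM).eq
  have hNf := (isIdempotentElem_map f hN).eq
  -- The entries of X and Y need not lie in the corner. Multiplying by the images of M and N on the
  -- two sides moves them there, where g supplies preimages.
  refine ⟨M * X.map g * N, N * Y.map g * M, hinj _ _ ?_, hinj _ _ ?_⟩ <;> dsimp only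
  · rw [Matrix.map_mul, hlift, hlift]
    calc M.map f * X * N.map f * (N.map f * Y * M.map f)
        = M.map f * X * (N.map f * N.map f) * Y * M.map f := by simp only [Matrix.mul_assoc]
      _ = M.map f * (X * Y) * (X * Y) * M.map f := by
          rw [hNf, ← hYX]; simp only [Matrix.mul_assoc]
      _ = M.map f := by rw [hXY, hMf, hMf, hMf]
  · rw [Matrix.map_mul, hlift, hlift]
    calc N.map f * Y * M.map f * (M.map f * X * N.map f)
        = N.map f * Y * (M.map f * M.map f) * X * N.map f := by simp only [Matrix.mul_assoc]
      _ = N.map f * (Y * X) * (Y * X) * N.map f := by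
          rw [hMf, ← hXY]; simp only [Matrix.mul_assoc]
      _ = N.map f := by rw [hYX, hNf, hNf, hNf]

/-- A one-sided inverse suffices, because U M and M V already realise the equivalence. -/
theorem ofMatrix_conj [DecidableEq ι] {M : Matrix ι ι A} (hM : IsIdempotentElem M)
    {U V : Matrix ι ι A} (hVU : V * U = 1) (h : IsIdempotentElem (U * M * V)) :
    ofMatrix (U * M * V) h = ofMatrix M hM := by
  rw [ofMatrix_eq_ofMatrix_iff]
  refine ⟨U * M, M * V, ?_, ?_⟩
  · rw [Matrix.mul_assoc, ← Matrix.mul_assoc M, hM.eq, Matrix.mul_assoc]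
  · rw [Matrix.mul_assoc, ← Matrix.mul_assoc V, hVU, Matrix.one_mul, hM.eq]

theorem isIdempotentElem_pad {m N : ℕ} (h : m ≤ N) {P : Matrix (Fin m) (Fin m) A}
    (hP : IsIdempotentElem P) : IsIdempotentElem (pad N P) := by
  rw [pad_eq]
  calc incl A N m * P * proj A m N * (incl A N m * P * proj A m N)
      = incl A N m * (P * (proj A m N * incl A N m) * P) * proj A m N := by
        simp only [Matrix.mul_assoc]
    _ = _ := by rw [proj_mul_incl h, Matrix.mul_one, hP.eq]

theorem ofMatrix_pad {m N : ℕ} (h : m ≤ N) {P : Matrix (Fin m) (Fin m) A}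
    (hP : IsIdempotentElem P) : ofMatrix (pad N P) (isIdempotentElem_pad h hP) = ofMatrix P hP := by
  rw [ofMatrix_eq_ofMatrix_iff]
  refine ⟨incl A N m * P, P * proj A m N, ?_, ?_⟩
  · rw [pad_eq, Matrix.mul_assoc, ← Matrix.mul_assoc P P, hP.eq, Matrix.mul_assoc]
  · rw [Matrix.mul_assoc, ← Matrix.mul_assoc _ _ P, proj_mul_incl h, Matrix.one_mul, hP.eq]

/-- The product of elementary matrices equal to `diag(a, b)` if `b = a⁻¹`. -/
def whitehead [DecidableEq ι] (a b : Matrix ι ι A) : Matrix (ι ⊕ ι) (ι ⊕ ι) A :=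
  fromBlocks 1 a 0 1 * fromBlocks 1 0 (-b) 1 * fromBlocks 1 a 0 1 * fromBlocks 0 (-1) 1 0

/-- The inverse of `whitehead a b`. -/
def whiteheadInv [DecidableEq ι] (a b : Matrix ι ι A) : Matrix (ι ⊕ ι) (ι ⊕ ι) A :=
  fromBlocks 0 1 (-1) 0 * (fromBlocks 1 (-a) 0 1 * (fromBlocks 1 0 b 1 * fromBlocks 1 (-a) 0 1))

/-- The elementary factors cancel one by one for arbitrary a and b. So the product stays invertible
when a and b are mere lifts of two mutually inverse matrices. -/
theorem whiteheadInv_mul_whitehead [DecidableEq ι] (a b : Matrix ι ι A) :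
    whiteheadInv a b * whitehead a b = 1 := by
  have h1 : (fromBlocks 1 (-a) 0 1 : Matrix (ι ⊕ ι) (ι ⊕ ι) A) * fromBlocks 1 a 0 1 = 1 := by
    simp [fromBlocks_multiply]
  have h2 : (fromBlocks 1 0 b 1 : Matrix (ι ⊕ ι) (ι ⊕ ι) A) * fromBlocks 1 0 (-b) 1 = 1 := by
    simp [fromBlocks_multiply]
  have h3 : fromBlocks 0 1 (-1) 0 * fromBlocks 0 (-1) 1 0 = (1 : Matrix (ι ⊕ ι) (ι ⊕ ι) A) := by
    simp [fromBlocks_multiply]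
  rw [whiteheadInv, whitehead]
  simp only [Matrix.mul_assoc]
  rw [← Matrix.mul_assoc (fromBlocks 1 (-a) 0 1) (fromBlocks 1 a 0 1), h1, Matrix.one_mul,
    ← Matrix.mul_assoc (fromBlocks 1 0 b 1) (fromBlocks 1 0 (-b) 1), h2, Matrix.one_mul,
    ← Matrix.mul_assoc (fromBlocks 1 (-a) 0 1) (fromBlocks 1 a 0 1), h1, Matrix.one_mul, h3]

theorem whitehead_eq [DecidableEq ι] {a b : Matrix ι ι A} (hab : a * b = 1) (hba : b * a = 1) :
    whitehead a b = fromBlocks a 0 0 b := by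
  simp [whitehead, fromBlocks_multiply, hab, hba]

theorem whiteheadInv_eq [DecidableEq ι] {a b : Matrix ι ι A} (hab : a * b = 1) (hba : b * a = 1) :
    whiteheadInv a b = fromBlocks b 0 0 a := by
  simp [whiteheadInv, fromBlocks_multiply, hab, hba]

theorem map_whitehead [DecidableEq ι] (f : A →+* B) (a b : Matrix ι ι A) :
    (whitehead a b).map f = whitehead (a.map f) (b.map f) := by
  simp [whitehead, Matrix.map_mul, fromBlocks_map, Matrix.map_neg]

theorem map_whiteheadInv [DecidableEq ι] (f : A →+* B) (a b : Matrix ι ι A) :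
    (whiteheadInv a b).map f = whiteheadInv (a.map f) (b.map f) := by
  simp [whiteheadInv, Matrix.map_mul, fromBlocks_map, Matrix.map_neg]

theorem map_pad (f : A →+* B) {m N : ℕ} (P : Matrix (Fin m) (Fin m) A) :
    (pad N P).map f = pad N (P.map f) := by
  ext i j
  by_cases h : (i : ℕ) < m ∧ (j : ℕ) < m <;> simp [pad, h]

/-- If `f` is surjective and the image of an idempotent under `f` is equivalent to an identity
matrix of size `r`, then the idempotent is equivalent to one which `f` maps to a diagonal matrix
with `r` entries `1` and all other entries `0`. -/
theorem exists_map_eq_diagonal (f : A →+* B) (hf : Function.Surjective f) (x : IdempotentClass A)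
    (r : ℕ) (h : map (f : A →ₙ+* B) x = mk (IdempotentOver.one r)) :
    ∃ (N : ℕ) (M : Matrix (Fin N ⊕ Fin N) (Fin N ⊕ Fin N) A) (hM : IsIdempotentElem M)
      (s : Finset (Fin N ⊕ Fin N)), s.card = r ∧ x = ofMatrix M hM ∧
        M.map f = diagonal fun i => if i ∈ s then 1 else 0 := by
  obtain ⟨P, rfl⟩ := Quotient.exists_rep x
  change mk _ = mk _ at h
  obtain ⟨m, P, hP⟩ := P
  obtain ⟨N, hPN, hrN, U, hU⟩ := mk_eq_mk_iff.1 h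
  replace hU : U.1 * pad N (P.map f) * U⁻¹.1 = pad N (1 : Matrix (Fin r) (Fin r) B) := hU
  change m ≤ N at hPN
  change r ≤ N at hrN
  -- A set-theoretic lift is enough: no algebraic property of g is used.
  choose g hg using hf
  have hg' : ∀ Z : Matrix (Fin N) (Fin N) B, (Z.map g).map f = Z := fun Z => by
    ext i j; simp [hg]
  have hUV : U.1 * U⁻¹.1 = 1 := U.mul_inv
  have hVU : U⁻¹.1 * U.1 = 1 := U.inv_mul
  generalize U⁻¹.1 = V at *
  generalize U.1 = U at *
  have hpad := isIdempotentElem_pad hPN hP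
  -- The extra zero block doubles the size, making room for U ⊕ U⁻¹. Unlike U alone, this lifts to
  -- an invertible matrix.
  have hQ : IsIdempotentElem (fromBlocks (pad N P) 0 0 (0 : Matrix (Fin N) (Fin N) A)) := by
    rw [IsIdempotentElem, fromBlocks_multiply]
    simp [hpad.eq]
  have hL := whiteheadInv_mul_whitehead (U.map g) (V.map g)
  have hM : IsIdempotentElem (whitehead (U.map g) (V.map g) *
      fromBlocks (pad N P) 0 0 (0 : Matrix (Fin N) (Fin N) A) *
        whiteheadInv (U.map g) (V.map g)) := by
    rw [IsIdempotentElem, Matrix.mul_assoc, ← Matrix.mul_assoc (whiteheadInv _ _),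
      ← Matrix.mul_assoc (whiteheadInv _ _), hL, Matrix.one_mul, ← Matrix.mul_assoc,
      Matrix.mul_assoc _ _ (fromBlocks (pad N P) 0 0 0), hQ.eq]
  refine ⟨N, _, hM, (Finset.univ.image (Fin.castLE hrN)).map Function.Embedding.inl, ?_, ?_, ?_⟩
  · rw [Finset.card_map, Finset.card_image_of_injective _ (Fin.castLE_injective hrN)]
    simp
  · rw [ofMatrix_conj hQ hL, ofMatrix_fromBlocks hpad .zero, ofMatrix_zero, add_zero,
      ofMatrix_pad hPN hP]
    exact mk_mk_eq_ofMatrix _ _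
  · rw [Matrix.map_mul, Matrix.map_mul, map_whitehead, map_whiteheadInv, hg', hg',
      whitehead_eq hUV hVU, whiteheadInv_eq hUV hVU, fromBlocks_map, map_pad, fromBlocks_multiply,
      fromBlocks_multiply]
    simp only [Matrix.map_zero _ (_root_.map_zero f), Matrix.mul_zero, Matrix.zero_mul, add_zero]
    rw [hU]
    ext i j
    have key : ∀ i : Fin N, (∃ a : Fin r, Fin.castLE hrN a = i) ↔ (i : ℕ) < r := fun i =>
      ⟨by rintro ⟨a, rfl⟩; exact a.2, fun h => ⟨⟨i, h⟩, rfl⟩⟩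
    rcases i with i | i <;> rcases j with j | j
    · by_cases hij : i = j
      · subst hij
        by_cases hi : (i : ℕ) < r <;> simp [pad, key, hi]
      · have : (i : ℕ) ≠ j := fun h => hij (Fin.ext h)
        by_cases hi : (i : ℕ) < r ∧ (j : ℕ) < r <;> simp [pad, hi, hij, this]
    · simp
    · simp
    · simp [diagonal_apply]

end IdempotentClass

/-! ### Nearby idempotents in Banach algebras -/

section BanachAlgebra

variable {B : Type*} [NormedRing B] [CompleteSpace B]

/-- Newton's method for idempotents: near an almost idempotent element there is an idempotent, in
every closed set stable under `y ↦ 3 y² - 2 y³`. -/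
theorem exists_isIdempotentElem_near (C : ℝ) {ε : ℝ} (hε : 0 < ε) :
    ∃ δ > 0, ∀ x : B, ‖x‖ ≤ C → ‖x * x - x‖ ≤ δ → ∀ T : Set B, IsClosed T → x ∈ T →
      (∀ y ∈ T, 3 * (y * y) - 2 * (y * y * y) ∈ T) →
        ∃ p ∈ T, IsIdempotentElem p ∧ ‖p - x‖ ≤ ε := by
  rcases lt_or_ge C 0 with hC | hC
  · exact ⟨1, one_pos, fun x hx => absurd ((norm_nonneg x).trans hx) hC.not_ge⟩
  -- The bound 1/8 makes each step at least halve the defect. The other bound keeps the total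
  -- displacement, at most 2L, below both 1 and ε. Thus all iterates have norm at most C + 1, where
  -- the step is at most 2C + 3 times the defect.
  set δ : ℝ := min (1 / 8) (min 1 ε / (2 * (2 * C + 3))) with hδ
  have hδ0 : 0 < δ := by
    have : 0 < min 1 ε := lt_min one_pos hε
    exact lt_min (by norm_num) (by positivity)
  have hδ1 : δ ≤ 1 / 8 := min_le_left _ _
  set L : ℝ := (2 * C + 3) * δ with hL
  have hL0 : 0 < L := by positivity
  have hL1 : 2 * L ≤ min 1 ε := by
    have : δ ≤ min 1 ε / (2 * (2 * C + 3)) := min_le_right _ _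
    rw [le_div_iff₀ (by positivity)] at this
    linarith
  refine ⟨δ, hδ0, fun x hx hxδ T hT hxT hstep => ?_⟩
  -- This polynomial fixes 0 and 1 and has zero derivative at both, so its iteration converges
  -- quadratically to idempotents.
  let f : B → B := fun y => 3 * (y * y) - 2 * (y * y * y)
  let u : ℕ → B := fun k => f^[k] x
  have hu : ∀ k, u (k + 1) = f (u k) := fun k => Function.iterate_succ_apply' f k x
  have huT : ∀ k, u k ∈ T := by
    intro k
    induction k with
    | zero => exact hxT
    | succ k ih => rw [hu]; exact hstep _ ih
  have hdiff : ∀ y : B, f y - y = (y * y - y) - 2 * (y * (y * y - y)) := fun y => by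
    simp only [f]; noncomm_ring
  -- With d = y² - y the new defect is 4d³ - 3d², which has norm at most half of ‖d‖ when ‖d‖ ≤ 1/8.
  have hdef : ∀ y : B, f y * f y - f y = 4 * ((y * y - y) * (y * y - y) * (y * y - y)) -
      3 * ((y * y - y) * (y * y - y)) := fun y => by
    simp only [f]; noncomm_ring
  have hnat : ∀ (k : ℕ) (y : B), ‖(k : B) * y‖ ≤ k * ‖y‖ := fun k y => by
    rw [← nsmul_eq_mul]; exact norm_nsmul_le
  have hdiff' : ∀ y : B, ‖f y - y‖ ≤ (1 + 2 * ‖y‖) * ‖y * y - y‖ := fun y => by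
    rw [hdiff]
    refine (norm_sub_le _ _).trans ?_
    have h1 := hnat 2 (y * (y * y - y))
    have h2 := norm_mul_le y (y * y - y)
    push_cast at h1
    nlinarith
  have hdef' : ∀ y : B, ‖f y * f y - f y‖ ≤ 4 * ‖y * y - y‖ ^ 3 + 3 * ‖y * y - y‖ ^ 2 := fun y => by
    rw [hdef]
    generalize y * y - y = d
    refine (norm_sub_le _ _).trans ?_
    have h1 := hnat 4 (d * d * d)
    have h2 := hnat 3 (d * d)
    have h3 := norm_mul_le d d
    have h4 := norm_mul_le (d * d) d
    have h5 := mul_le_mul_of_nonneg_right h3 (norm_nonneg d)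
    push_cast at h1 h2
    nlinarith
  have key : ∀ k : ℕ, ‖u k * u k - u k‖ ≤ δ * (1 / 2) ^ k ∧
      ‖u k - x‖ ≤ 2 * L * (1 - (1 / 2) ^ k) := by
    intro k
    induction k with
    | zero => simpa [u] using hxδ
    | succ k ih =>
      obtain ⟨ih1, ih2⟩ := ih
      have hk : (0 : ℝ) < (1 / 2) ^ k := by positivity
      have hk1 : ((1 : ℝ) / 2) ^ k ≤ 1 := pow_le_one₀ (by norm_num) (by norm_num)
      have hd0 := norm_nonneg (u k * u k - u k)
      have hd1 : ‖u k * u k - u k‖ ≤ 1 / 8 := by nlinarith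
      have hn : ‖u k‖ ≤ C + 1 := by
        have : ‖u k‖ ≤ ‖u k - x‖ + ‖x‖ := by simpa using norm_add_le (u k - x) x
        have := hL1.trans (min_le_left _ _)
        nlinarith
      constructor
      · rw [hu, pow_succ]
        refine (hdef' _).trans ?_
        nlinarith
      · have h1 : ‖u (k + 1) - x‖ ≤ ‖u (k + 1) - u k‖ + ‖u k - x‖ := by
          simpa using norm_add_le (u (k + 1) - u k) (u k - x)
        have h2 : ‖u (k + 1) - u k‖ ≤ L * (1 / 2) ^ k := by
          rw [hu, hL, mul_assoc]
          exact (hdiff' _).trans (mul_le_mul (by linarith) ih1 hd0 (by positivity))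
        rw [pow_succ]
        linarith
  have hdist : ∀ k, dist (u k) (u (k + 1)) ≤ 2 * L / 2 / 2 ^ k := fun k => by
    obtain ⟨ih1, ih2⟩ := key k
    have hk1 : (0 : ℝ) < (1 / 2) ^ k := by positivity
    have hn : ‖u k‖ ≤ C + 1 := by
      have : ‖u k‖ ≤ ‖u k - x‖ + ‖x‖ := by simpa using norm_add_le (u k - x) x
      have := hL1.trans (min_le_left _ _)
      nlinarith
    rw [dist_comm, dist_eq_norm, hu, mul_div_cancel_left₀ _ (two_ne_zero), div_eq_mul_inv,
      ← inv_pow, ← one_div, hL, mul_assoc]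
    exact (hdiff' _).trans (mul_le_mul (by linarith) ih1 (norm_nonneg _) (by positivity))
  obtain ⟨p, hp⟩ := cauchySeq_tendsto_of_complete (cauchySeq_of_le_geometric_two hdist)
  refine ⟨p, hT.mem_of_tendsto hp (Filter.Eventually.of_forall huT), ?_, ?_⟩
  · have h1 : Filter.Tendsto (fun k => u k * u k - u k) Filter.atTop (nhds (p * p - p)) :=
      (hp.mul hp).sub hp
    have h2 : Filter.Tendsto (fun k => u k * u k - u k) Filter.atTop (nhds 0) := by
      refine squeeze_zero_norm (fun k => (key k).1) ?_
      simpa using (tendsto_pow_atTop_nhds_zero_of_lt_one (r := (1 / 2 : ℝ)) (by norm_num)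
        (by norm_num)).const_mul δ
    exact sub_eq_zero.1 (tendsto_nhds_unique h1 h2)
  · have := dist_le_of_le_geometric_two_of_tendsto₀ hdist hp
    rw [dist_comm, dist_eq_norm] at this
    exact this.trans (hL1.trans (min_le_right _ _))

/-- Idempotents which are close are intertwined by an invertible element. -/
theorem isUnit_of_idempotents_near {P Q : B} (hP : IsIdempotentElem P)
    (h : (1 + 2 * ‖P‖) * ‖Q - P‖ < 1) : IsUnit (P * Q + (1 - P) * (1 - Q)) := by
  -- The term 2(P - P²) is kept so that the identity holds in every ring; it vanishes for an
  -- idempotent P.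
  have h1 : P * Q + (1 - P) * (1 - Q) = 1 - ((Q - P) - 2 * (P * (Q - P)) + 2 * (P - P * P)) := by
    noncomm_ring
  rw [h1, hP.eq, sub_self, mul_zero, add_zero]
  refine isUnit_one_sub_of_norm_lt_one (lt_of_le_of_lt ?_ h)
  refine (norm_sub_le _ _).trans ?_
  have h2 : ‖2 * (P * (Q - P))‖ ≤ 2 * ‖P * (Q - P)‖ := by
    rw [two_mul, two_mul]
    exact norm_add_le _ _
  have h3 := norm_mul_le P (Q - P)
  linarith

/-- An idempotent `P` which differs from an idempotent `D` by an element approximated by the corners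
of idempotents `F m` commuting with `D` is close to an idempotent `(1 - F m) D + p`, with `p` in
the corner of `F m`. -/
theorem exists_idempotent_corner_near {P D : B} {F : ℕ → B} (hP : IsIdempotentElem P)
    (hD : IsIdempotentElem D) (hF : ∀ m, IsIdempotentElem (F m)) (hFD : ∀ m, F m * D = D * F m)
    {c : ℝ} (hc : ∀ m, ‖F m‖ ≤ c)
    (hlim : Filter.Tendsto (fun m => F m * (P - D) * F m) Filter.atTop (nhds (P - D)))
    {ε : ℝ} (hε : 0 < ε) :
    ∃ (m : ℕ) (p : B), IsIdempotentElem p ∧ F m * p = p ∧ p * F m = p ∧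
      ‖(1 - F m) * D + p - P‖ < ε := by
  obtain ⟨δ, hδ, H⟩ := exists_isIdempotentElem_near (B := B) (c * ‖P‖ * c) (half_pos hε)
  have hlim2 : Filter.Tendsto (fun m => F m * (P - D) * F m + D) Filter.atTop (nhds P) := by
    simpa using hlim.add_const D
  have hlim3 : Filter.Tendsto (fun m => (F m * (P - D) * F m + D) * (F m * (P - D) * F m + D) -
      (F m * (P - D) * F m + D)) Filter.atTop (nhds 0) := by
    have := (hlim2.mul hlim2).sub hlim2
    rwa [hP.eq, sub_self] at this
  have e1 := (Metric.tendsto_nhds.1 hlim2) (ε / 2) (half_pos hε)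
  have e2 := (Metric.tendsto_nhds.1 hlim3) δ hδ
  obtain ⟨m, hm1, hm2⟩ := (e1.and e2).exists
  rw [dist_eq_norm] at hm1
  rw [dist_zero_right] at hm2
  have hF' := (hF m).eq
  have hD' := hD.eq
  have hFD' := hFD m
  have hFm : F m * (P - D) * F m + D = F m * P * F m + (1 - F m) * D := by
    have : F m * D * F m = F m * D := by rw [mul_assoc, ← hFD', ← mul_assoc, hF']
    rw [mul_sub, sub_mul, this, sub_mul, one_mul]
    abel
  rw [hFm] at hm1 hm2
  -- The idempotent (1 - F m) D is orthogonal to the corner of F m, so only F m P F m contributes to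
  -- the defect.
  have hsq : (F m * P * F m + (1 - F m) * D) * (F m * P * F m + (1 - F m) * D) -
      (F m * P * F m + (1 - F m) * D) = F m * P * F m * (F m * P * F m) - F m * P * F m := by
    have a1 : F m * P * F m * ((1 - F m) * D) = 0 := by
      rw [mul_assoc (F m * P), ← mul_assoc (F m) (1 - F m), mul_sub, mul_one, hF', sub_self,
        zero_mul, mul_zero]
    have a2 : (1 - F m) * D * (F m * P * F m) = 0 := by
      rw [mul_assoc (1 - F m), mul_assoc (F m), ← mul_assoc D, ← hFD', mul_assoc (F m) D,
        ← mul_assoc (1 - F m), sub_mul, one_mul, hF', sub_self, zero_mul]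
    have a3 : (1 - F m) * D * ((1 - F m) * D) = (1 - F m) * D := by
      have : D * (1 - F m) = (1 - F m) * D := by rw [mul_sub, sub_mul, hFD']; simp
      rw [mul_assoc, ← mul_assoc D, this, mul_assoc _ D D, hD', ← mul_assoc, (hF m).one_sub.eq]
    rw [add_mul, mul_add, mul_add, a1, a2, a3]
    abel
  rw [hsq] at hm2
  have hnorm : ‖F m * P * F m‖ ≤ c * ‖P‖ * c := by
    refine (norm_mul_le _ _).trans (mul_le_mul ((norm_mul_le _ _).trans ?_) (hc m) (norm_nonneg _) ?_)
    · exact mul_le_mul_of_nonneg_right (hc m) (norm_nonneg _)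
    · exact mul_nonneg ((norm_nonneg _).trans (hc m)) (norm_nonneg _)
  -- The corner of F m is closed and stable under Newton's step, so the idempotent found there stays
  -- in it.
  obtain ⟨p, hpT, hp, hpx⟩ := H _ hnorm hm2.le {y | F m * y = y ∧ y * F m = y}
    ((isClosed_eq (by fun_prop) (by fun_prop)).inter (isClosed_eq (by fun_prop) (by fun_prop)))
    ⟨by rw [← mul_assoc, ← mul_assoc, hF'], by rw [mul_assoc, hF']⟩ (by
      rintro y ⟨h1, h2⟩
      have h3 : 3 * (y * y) - 2 * (y * y * y) = y * (3 * y - 2 * (y * y)) := by noncomm_ring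
      have h4 : 3 * (y * y) - 2 * (y * y * y) = (3 * y - 2 * (y * y)) * y := by noncomm_ring
      exact ⟨by rw [h3, ← mul_assoc, h1], by rw [h4, mul_assoc, h2]⟩)
  refine ⟨m, p, hp, hpT.1, hpT.2, ?_⟩
  have : (1 - F m) * D + p - P =
      (p - F m * P * F m) + (F m * P * F m + (1 - F m) * D - P) := by abel
  rw [this]
  refine (norm_add_le _ _).trans_lt ?_
  linarith

end BanachAlgebra

/-! ### Perturbation of idempotent matrices -/

namespace IdempotentClass

open Matrix

attribute [local instance] Matrix.linftyOpNormedRing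

variable {A : Type*} [NormedRing A] [CompleteSpace A] {ι : Type} [Fintype ι] [DecidableEq ι]

/-- The uniform structure of the row-sum norm is the product structure, so completeness is inherited
entrywise. -/
theorem completeSpace_matrix :
    @CompleteSpace (Matrix ι ι A) PseudoMetricSpace.toUniformSpace :=
  inferInstanceAs (CompleteSpace (ι → ι → A))

/-- The invertible element u = PQ + (1 - P)(1 - Q) satisfies P u = PQ = u Q, so it conjugates Q into
P. -/
theorem ofMatrix_eq_of_near {P Q : Matrix ι ι A} (hP : IsIdempotentElem P)
    (hQ : IsIdempotentElem Q) (h : (1 + 2 * ‖P‖) * ‖Q - P‖ < 1) : ofMatrix P hP = ofMatrix Q hQ := by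
  have := completeSpace_matrix (A := A) (ι := ι)
  obtain ⟨u, hu⟩ := isUnit_of_idempotents_near hP h
  have h1 : P * u.1 = u.1 * Q := by
    have e1 : P * (1 - P) = 0 := by rw [mul_sub, mul_one, hP.eq, sub_self]
    have e2 : (1 - Q) * Q = 0 := by rw [sub_mul, one_mul, hQ.eq, sub_self]
    rw [hu, mul_add, add_mul, ← mul_assoc, hP.eq, ← mul_assoc P (1 - P), e1, mul_assoc P Q Q, hQ.eq,
      mul_assoc (1 - P), e2, zero_mul, mul_zero]
  have h2 : u.1 * Q * u⁻¹.1 = P := by rw [← h1, mul_assoc, Units.mul_inv, mul_one]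
  have := ofMatrix_conj hQ (U := u.1) (V := u⁻¹.1) u.inv_mul (h2 ▸ hP)
  rw [← this]
  exact ofMatrix_congr _ h2.symm

/-- Let `F m = 1 - x^m y^m` with `y x = 1`, of norm at most `c`. If `P` is an idempotent matrix and
the entries of `P - diag(1_s)` are approximated by corners of the `F m`, then `P` is equivalent to
the sum of an identity matrix and an idempotent matrix over the corner of some `F m`. -/
theorem exists_ofMatrix_eq_one_add {P : Matrix ι ι A} (hP : IsIdempotentElem P) (s : Finset ι)
    {x y : A} (hyx : y * x = 1) {c : ℝ} (hc : ∀ m, ‖1 - x ^ m * y ^ m‖ ≤ c)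
    (hlim : ∀ i j, Filter.Tendsto (fun m => (1 - x ^ m * y ^ m) *
      (P - diagonal fun i => if i ∈ s then (1 : A) else 0) i j * (1 - x ^ m * y ^ m)) Filter.atTop
        (nhds ((P - diagonal fun i => if i ∈ s then (1 : A) else 0) i j))) :
    ∃ (m : ℕ) (p : Matrix ι ι A) (hp : IsIdempotentElem p),
      (∀ i j, (1 - x ^ m * y ^ m) * p i j = p i j ∧ p i j * (1 - x ^ m * y ^ m) = p i j) ∧
      ofMatrix P hP = mk (IdempotentOver.one s.card) + ofMatrix p hp := by
  have := completeSpace_matrix (A := A) (ι := ι)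
  have hyx' : ∀ m, y ^ m * x ^ m = 1 := fun m => by
    induction m with
    | zero => simp
    | succ m ih => rw [pow_succ, pow_succ', mul_assoc, ← mul_assoc y, hyx, one_mul, ih]
  have hE : ∀ m, IsIdempotentElem (1 - x ^ m * y ^ m) := fun m => IsIdempotentElem.one_sub (by
    rw [IsIdempotentElem, mul_assoc, ← mul_assoc (y ^ m), hyx', one_mul])
  set D : Matrix ι ι A := diagonal fun i => if i ∈ s then (1 : A) else 0 with hDdef
  have hD : IsIdempotentElem D := by
    rw [IsIdempotentElem, diagonal_mul_diagonal, hDdef]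
    congr 1
    funext i
    split_ifs <;> simp
  let F : ℕ → Matrix ι ι A := fun m => diagonal fun _ => 1 - x ^ m * y ^ m
  have hF : ∀ m, IsIdempotentElem (F m) := fun m => by
    rw [IsIdempotentElem, diagonal_mul_diagonal, (hE m).eq]
  have hFD : ∀ m, F m * D = D * F m := fun m => by
    rw [diagonal_mul_diagonal, diagonal_mul_diagonal]
    simp
  have hFlim : Filter.Tendsto (fun m => F m * (P - D) * F m) Filter.atTop (nhds (P - D)) := by
    refine tendsto_pi_nhds.2 fun i => tendsto_pi_nhds.2 fun j => ?_
    simpa only [F, diagonal_mul, mul_diagonal] using hlim i j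
  have hFc : ∀ m, ‖F m‖ ≤ c := fun m => by
    rw [Matrix.linfty_opNorm_diagonal]
    exact (pi_norm_le_iff_of_nonneg ((norm_nonneg _).trans (hc 0))).2 fun _ => hc m
  -- This ε turns the approximation into the hypothesis of `ofMatrix_eq_of_near`.
  obtain ⟨m, p, hp, hp1, hp2, hnear⟩ := exists_idempotent_corner_near hP hD hF hFD hFc hFlim
    (ε := (1 + 2 * ‖P‖)⁻¹) (by positivity)
  have hDm : IsIdempotentElem ((1 - F m) * D) := by
    have : D * (1 - F m) = (1 - F m) * D := by rw [mul_sub, sub_mul, hFD]; simp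
    rw [IsIdempotentElem, mul_assoc, ← mul_assoc D, this, mul_assoc _ D D, hD.eq, ← mul_assoc,
      (hF m).one_sub.eq]
  have h1 : (1 - F m) * D * p = 0 := by
    rw [← hp1, ← mul_assoc, mul_assoc _ D, ← hFD, ← mul_assoc, sub_mul, one_mul, (hF m).eq,
      sub_self, zero_mul, zero_mul]
  have h2 : p * ((1 - F m) * D) = 0 := by
    rw [← hp2, mul_assoc, ← mul_assoc (F m), mul_sub, mul_one, (hF m).eq, sub_self, zero_mul,
      mul_zero]
  have hsum : IsIdempotentElem ((1 - F m) * D + p) := by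
    rw [IsIdempotentElem, add_mul, mul_add, mul_add, h1, h2, hDm.eq, hp.eq, zero_add, add_zero]
  refine ⟨m, p, hp, fun i j => ⟨?_, ?_⟩, ?_⟩
  · simpa [F] using congrFun (congrFun hp1 i) j
  · simpa [F] using congrFun (congrFun hp2 i) j
  have h3 : ofMatrix P hP = ofMatrix _ hsum := ofMatrix_eq_of_near hP hsum (by
    rwa [mul_comm, ← lt_div_iff₀ (by positivity), one_div])
  rw [h3, ofMatrix_add hDm hp hsum h1 h2]
  congr 1
  have h4 := mk_one_eq_ofMatrix (A := A) (ι := s)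
  rw [Fintype.card_coe] at h4
  rw [h4, ofMatrix_eq_ofMatrix_iff]
  -- Since y^m x^m = 1, the identity over s is equivalent to diag(x^m y^m) supported on s, which is
  -- (1 - F m) D.
  refine ⟨Matrix.of fun i t => if i = t then x ^ m else 0,
    Matrix.of fun t i => if i = t then y ^ m else 0, ?_, ?_⟩
  · have : (1 - F m) * D = diagonal fun i => if i ∈ s then x ^ m * y ^ m else 0 := by
      have h5 : (1 - F m) = diagonal fun _ => x ^ m * y ^ m := by
        rw [← diagonal_one, diagonal_sub]
        simp
      rw [h5, diagonal_mul_diagonal]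
      simp
    rw [this]
    ext i j
    rw [Matrix.mul_apply]
    by_cases hi : i ∈ s
    · rw [Finset.sum_eq_single ⟨i, hi⟩]
      · by_cases hij : i = j
        · subst hij; simp [hi]
        · simp [hij, Ne.symm hij]
      · intro b _ hb
        have : i ≠ b := fun h => hb (Subtype.ext h.symm)
        simp [this]
      · simp
    · rw [Finset.sum_eq_zero]
      · simp [diagonal_apply, hi]
      · intro b _
        have : i ≠ b := fun h => hi (h ▸ b.2)
        simp [this]
  · ext t t'
    rw [Matrix.mul_apply, Finset.sum_eq_single t.1]
    · by_cases h : t = t'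
      · subst h; simp [hyx']
      · have : t.1 ≠ t'.1 := fun h' => h (Subtype.ext h')
        simp [h, this]
    · intro b _ hb
      simp [hb]
    · simp

end IdempotentClass

/-! ### Surjectivity of *-homomorphisms into algebras of continuous functions -/

section Surjective

open ComplexStarModule

/-- Clamp a to [-r, r] by functional calculus, with r = ‖φ a‖. The spectrum of φ a already lies in
this interval, so the image does not change. -/
theorem StarAlgHom.exists_eq_norm_le_of_isSelfAdjoint {A B : Type*} [CStarAlgebra A]
    [CStarAlgebra B] (φ : A →⋆ₐ[ℂ] B) {a : A}
    (ha : IsSelfAdjoint a) : ∃ a' : A, φ a' = φ a ∧ ‖a'‖ ≤ ‖φ a‖ := by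
  set r := ‖φ a‖ with hr
  have hr0 : 0 ≤ r := norm_nonneg _
  have hcont : Continuous fun x : ℝ => max (-r) (min r x) := by fun_prop
  have hφ : Continuous φ := AddMonoidHomClass.continuous_of_bound φ 1 fun a => by
    rw [one_mul]; exact NonUnitalStarAlgHom.norm_apply_le φ a
  refine ⟨cfc (fun x : ℝ => max (-r) (min r x)) a, ?_, ?_⟩
  · rw [StarAlgHomClass.map_cfc (S := ℂ) φ _ a hcont.continuousOn hφ ha (ha.map φ)]
    conv_rhs => rw [← cfc_id ℝ (φ a) (ha.map φ)]
    refine cfc_congr fun x hx => ?_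
    have : ‖x‖ ≤ r := by
      rcases subsingleton_or_nontrivial B with h | h
      · exact absurd hx (by simp)
      · exact spectrum.norm_le_norm_of_mem hx
    rw [Real.norm_eq_abs, abs_le] at this
    simp [this.1, this.2]
  · refine norm_cfc_le hr0 fun x _ => ?_
    rw [Real.norm_eq_abs, abs_le]
    exact ⟨le_max_left _ _, max_le (by linarith) (min_le_left _ _)⟩

/-- The real and imaginary parts are lifted separately, whence the factor 2. A lift with any uniform
bound is enough to make the range closed. -/
theorem StarAlgHom.exists_eq_norm_le {A B : Type*} [CStarAlgebra A]
    [CStarAlgebra B] (φ : A →⋆ₐ[ℂ] B) (a : A) : ∃ a' : A, φ a' = φ a ∧ ‖a'‖ ≤ 2 * ‖φ a‖ := by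
  obtain ⟨a₁, h₁, h₁'⟩ := φ.exists_eq_norm_le_of_isSelfAdjoint (ℜ a).2
  obtain ⟨a₂, h₂, h₂'⟩ := φ.exists_eq_norm_le_of_isSelfAdjoint (ℑ a).2
  refine ⟨a₁ + Complex.I • a₂, ?_, ?_⟩
  · rw [map_add, map_smul, h₁, h₂, ← map_smul, ← map_add, realPart_add_I_smul_imaginaryPart]
  · have hreal : ∀ (r : ℝ) (x : A), φ (r • x) = r • φ x := fun r x =>
      φ.toAlgHom.toLinearMap.map_smul_of_tower r x
    have e₁ : φ (ℜ a : A) = (ℜ (φ a) : B) := by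
      simp only [realPart_apply_coe, hreal, map_add, map_star]
    have e₂ : φ (ℑ a : A) = (ℑ (φ a) : B) := by
      simp only [imaginaryPart_apply_coe, hreal, map_sub, map_star, map_smul]
    have n₁ : ‖(ℜ (φ a) : B)‖ ≤ ‖φ a‖ := realPart.norm_le (φ a)
    have n₂ : ‖(ℑ (φ a) : B)‖ ≤ ‖φ a‖ := imaginaryPart.norm_le (φ a)
    refine (norm_add_le _ _).trans ?_
    rw [norm_smul, Complex.norm_I, one_mul]
    rw [e₁] at h₁'
    rw [e₂] at h₂'
    linarith

/-- A *-homomorphism from a C*-algebra to `C(X, ℂ)` whose range separates points is surjective. -/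
theorem StarAlgHom.surjective_of_separatesPoints {A : Type*} [CStarAlgebra A] {X : Type*}
    [TopologicalSpace X] [CompactSpace X] (φ : A →⋆ₐ[ℂ] C(X, ℂ))
    (hφ : φ.range.SeparatesPoints) : Function.Surjective φ := by
  have hle : ∀ a, ‖φ a‖ ≤ 1 * ‖a‖ := fun a => by
    rw [one_mul]; exact NonUnitalStarAlgHom.norm_apply_le φ a
  let f : NormedAddGroupHom A C(X, ℂ) :=
    AddMonoidHom.mkNormedAddGroupHom (φ : A →+ C(X, ℂ)) 1 hle
  -- Lifts of controlled norm give, by successive approximation in the complete algebra A, lifts of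
  -- the whole closure of the range. By Stone–Weierstrass that closure is everything.
  have hsurj : f.SurjectiveOnWith f.range 2 := by
    rintro _ ⟨a, rfl⟩
    exact φ.exists_eq_norm_le a
  have hcl := controlled_closure_of_complete (by norm_num) (one_pos) hsurj
  have htop := ContinuousMap.starSubalgebra_topologicalClosure_eq_top_of_separatesPoints _ hφ
  intro h
  have hmem : h ∈ f.range.topologicalClosure := by
    have h1 : h ∈ φ.range.topologicalClosure := htop ▸ trivial
    have h2 : h ∈ closure (φ.range : Set C(X, ℂ)) := h1
    have h3 : (f.range : Set C(X, ℂ)) = φ.range := rfl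
    change h ∈ closure (f.range : Set C(X, ℂ))
    rwa [h3]
  obtain ⟨a, ha, -⟩ := hcl h hmem
  exact ⟨a, ha⟩

end Surjective

/-! ### Idempotents over the circle -/

section Circle

open Matrix

/-- A continuous function on `[0, 2π]` with equal values at the end points is a continuous function
of the circle. -/
theorem exists_continuousMap_circle_exp {f : ℝ → ℂ} (hf : ContinuousOn f (Set.Icc 0 (2 * Real.pi)))
    (h : f 0 = f (2 * Real.pi)) :
    ∃ F : C(Circle, ℂ), ∀ x ∈ Set.Ico 0 (2 * Real.pi), F (Circle.exp x) = f x := by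
  have : Fact (0 < 2 * Real.pi) := ⟨Real.two_pi_pos⟩
  refine ⟨⟨AddCircle.liftIco (2 * Real.pi) 0 f ∘ AddCircle.homeomorphCircle'.symm,
    (AddCircle.liftIco_continuous (by simpa using h) (by simpa using hf)).comp
      AddCircle.homeomorphCircle'.symm.continuous⟩, fun x hx => ?_⟩
  have : AddCircle.homeomorphCircle' (x : AddCircle (2 * Real.pi)) = Circle.exp x :=
    AddCircle.homeomorphCircle'_apply_mk x
  change AddCircle.liftIco (2 * Real.pi) 0 f (AddCircle.homeomorphCircle'.symm (Circle.exp x)) = f x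
  rw [← this, Homeomorph.symm_apply_apply, AddCircle.liftIco_coe_apply (by simpa using hx)]

theorem Circle.exists_exp_eq (s : Circle) : ∃ x ∈ Set.Ico 0 (2 * Real.pi), Circle.exp x = s := by
  have : Fact (0 < 2 * Real.pi) := ⟨Real.two_pi_pos⟩
  obtain ⟨t, rfl⟩ := AddCircle.homeomorphCircle'.surjective s
  obtain ⟨x, hx, rfl⟩ := AddCircle.eq_coe_Ico t
  exact ⟨x, hx, (AddCircle.homeomorphCircle'_apply_mk x).symm⟩

/-- Parallel transport along a path of idempotents. -/
theorem exists_transport {B : Type*} [NormedRing B] [CompleteSpace B] {P : ℝ → B}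
    (hP : Continuous P) (hidem : ∀ x, IsIdempotentElem (P x)) (T : ℝ) :
    ∃ g : ℝ → B, Continuous g ∧ g 0 = 1 ∧
      ∀ x ∈ Set.Icc 0 T, IsUnit (g x) ∧ g x * P 0 = P x * g x := by
  obtain ⟨C, hC⟩ := (isCompact_Icc (a := 0) (b := T)).exists_bound_of_continuousOn hP.continuousOn
  have huc := (isCompact_Icc (a := 0) (b := T)).uniformContinuousOn_of_continuous hP.continuousOn
  have hC1 : 0 < 1 + 2 * |C| := by positivity
  obtain ⟨δ, hδ, hδ'⟩ := Metric.uniformContinuousOn_iff.1 huc (1 + 2 * |C|)⁻¹ (by positivity)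
  have hz : ∀ x ∈ Set.Icc 0 T, ∀ y ∈ Set.Icc 0 T, dist y x < δ →
      IsUnit (P x * P y + (1 - P x) * (1 - P y)) := fun x hx y hy hxy => by
    refine isUnit_of_idempotents_near (hidem x) ?_
    have h1 := hδ' y hy x hx hxy
    rw [dist_eq_norm] at h1
    have h2 : 1 + 2 * ‖P x‖ ≤ 1 + 2 * |C| := by
      have := (hC x hx).trans (le_abs_self C)
      linarith
    calc (1 + 2 * ‖P x‖) * ‖P y - P x‖ ≤ (1 + 2 * |C|) * ‖P y - P x‖ :=
          mul_le_mul_of_nonneg_right h2 (norm_nonneg _)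
      _ < (1 + 2 * |C|) * (1 + 2 * |C|)⁻¹ := mul_lt_mul_of_pos_left h1 hC1
      _ = 1 := mul_inv_cancel₀ hC1.ne'
  -- The transport is extended by steps of length δ/2; after the time k δ/2 the path of idempotents
  -- is frozen by the minimum.
  have key : ∀ k : ℕ, ∃ g : ℝ → B, Continuous g ∧ g 0 = 1 ∧
      ∀ x ∈ Set.Icc 0 T, IsUnit (g x) ∧ g x * P 0 = P (min x (k * (δ / 2))) * g x := by
    intro k
    induction k with
    | zero =>
      refine ⟨fun _ => 1, continuous_const, rfl, fun x hx => ⟨isUnit_one, ?_⟩⟩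
      simp [min_eq_right hx.1]
    | succ k ih =>
      obtain ⟨g, hg, hg0, hgx⟩ := ih
      let a : ℝ → ℝ := fun x => min x ((k + 1 : ℕ) * (δ / 2))
      let b : ℝ → ℝ := fun x => min x (k * (δ / 2))
      have hk : (0 : ℝ) ≤ k * (δ / 2) := by positivity
      have hk' : (0 : ℝ) ≤ (k + 1 : ℕ) * (δ / 2) := by positivity
      -- The new factor intertwines P (b x) with P (a x) and is invertible because a x and b x are
      -- at distance at most δ/2. It equals 1 as long as x ≤ k δ/2, where a x = b x.
      refine ⟨fun x => (P (a x) * P (b x) + (1 - P (a x)) * (1 - P (b x))) * g x,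
        by fun_prop, ?_, fun x hx => ⟨?_, ?_⟩⟩
      · simp only [a, b, min_eq_left hk, min_eq_left hk', hg0, mul_one, (hidem 0).eq,
          (hidem 0).one_sub.eq]
        abel
      · refine (hz _ ⟨le_min hx.1 hk', (min_le_left _ _).trans hx.2⟩ _
          ⟨le_min hx.1 hk, (min_le_left _ _).trans hx.2⟩ ?_).mul (hgx x hx).1
        refine lt_of_le_of_lt ?_ (half_lt_self hδ)
        rw [Real.dist_eq]
        refine (abs_min_sub_min_le_max _ _ _ _).trans ?_
        rw [sub_self, abs_zero, max_eq_right (abs_nonneg _), abs_le]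
        push_cast
        constructor <;> linarith
      · change _ = P (a x) * _
        rw [mul_assoc, (hgx x hx).2]
        change _ * (P (b x) * _) = _
        have e1 : (1 - P (b x)) * P (b x) = 0 := by
          rw [sub_mul, one_mul, (hidem _).eq, sub_self]
        have e2 : P (a x) * (1 - P (a x)) = 0 := by
          rw [mul_sub, mul_one, (hidem _).eq, sub_self]
        rw [← mul_assoc, ← mul_assoc, add_mul, mul_add, mul_assoc _ (P (b x)) (P (b x)),
          (hidem _).eq, mul_assoc _ _ (P (b x)), e1, ← mul_assoc (P (a x)) (1 - P (a x)), e2,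
          ← mul_assoc (P (a x)), (hidem (a x)).eq]
        simp
  obtain ⟨k, hk⟩ := exists_nat_ge (T / (δ / 2))
  obtain ⟨g, hg, hg0, hgx⟩ := key k
  refine ⟨g, hg, hg0, fun x hx => ⟨(hgx x hx).1, ?_⟩⟩
  have : min x (k * (δ / 2)) = x := min_eq_left (hx.2.trans (by
    rwa [div_le_iff₀ (half_pos hδ)] at hk))
  rw [(hgx x hx).2, this]

/-- An idempotent complex matrix is equivalent to an identity matrix. -/
theorem exists_mul_eq_one_of_isIdempotentElem {N : ℕ} {M : Matrix (Fin N) (Fin N) ℂ}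
    (hM : IsIdempotentElem M) :
    ∃ (r : ℕ) (X : Matrix (Fin N) (Fin r) ℂ) (Y : Matrix (Fin r) (Fin N) ℂ),
      X * Y = M ∧ Y * X = 1 := by
  let f := Matrix.toLin' M
  let b := Module.finBasis ℂ (LinearMap.range f)
  have hf : ∀ v, f (f v) = f v := fun v => by
    simp only [f, Matrix.toLin'_apply, Matrix.mulVec_mulVec, hM.eq]
  -- The idempotent is factored through its range, on which it acts as the identity.
  refine ⟨_, LinearMap.toMatrix b (Pi.basisFun ℂ (Fin N)) (LinearMap.range f).subtype,
    LinearMap.toMatrix (Pi.basisFun ℂ (Fin N)) b f.rangeRestrict, ?_, ?_⟩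
  · rw [← LinearMap.toMatrix_comp]
    have : (LinearMap.range f).subtype ∘ₗ f.rangeRestrict = f := rfl
    rw [this]
    exact LinearMap.toMatrix'_toLin' M
  · rw [← LinearMap.toMatrix_comp]
    have : f.rangeRestrict ∘ₗ (LinearMap.range f).subtype = LinearMap.id := by
      ext ⟨_, v, rfl⟩ i
      exact congrFun (hf v) i
    rw [this, LinearMap.toMatrix_id]

/-- An invertible complex matrix is joined to `1` by a path of invertible affine combinations of
`1` and the matrix. -/
theorem exists_path_of_isUnit {N : ℕ} {G : Matrix (Fin N) (Fin N) ℂ} (hG : IsUnit G) :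
    ∃ z : ℝ → ℂ, Continuous z ∧ z 0 = 0 ∧ z 1 = 1 ∧
      ∀ x, IsUnit ((1 - z x) • (1 : Matrix (Fin N) (Fin N) ℂ) + z x • G) := by
  -- Along the complex line through 1 and G the determinant is a polynomial, nonzero at 0 and at 1.
  -- It has finitely many zeros, and the complement of a countable set in ℂ is path connected.
  open Polynomial in
  let M : Matrix (Fin N) (Fin N) ℂ[X] := (1 - X : ℂ[X]) • 1 + (X : ℂ[X]) • G.map Polynomial.C
  have hM : ∀ z, M.det.eval z = ((1 - z) • (1 : Matrix (Fin N) (Fin N) ℂ) + z • G).det := fun z => by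
    rw [← Polynomial.coe_evalRingHom, RingHom.map_det]
    congr 1
    ext i j
    simp [M, Matrix.one_apply, apply_ite]
    ring
  have h0 : M.det.eval 0 ≠ 0 := by simp [hM]
  have h1 : M.det.eval 1 ≠ 0 := by
    rw [hM]
    simpa using ((Matrix.isUnit_iff_isUnit_det _).1 hG).ne_zero
  have hne : M.det ≠ 0 := fun h => h0 (by simp [h])
  have hcount : {z | M.det.IsRoot z}.Countable :=
    (Polynomial.finite_setOfPred_isRoot hne).countable
  have hpath := hcount.isPathConnected_compl_of_one_lt_rank
    (by rw [Complex.rank_real_complex]; norm_num)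
  have hj : JoinedIn {z | M.det.IsRoot z}ᶜ 0 1 := hpath.joinedIn _ h0 _ h1
  refine ⟨hj.somePath.extend, hj.somePath.continuous_extend, by simp, by simp, fun x => ?_⟩
  have hx : hj.somePath.extend x ∈ {z | M.det.IsRoot z}ᶜ := hj.somePath_mem _
  rw [Matrix.isUnit_iff_isUnit_det, ← hM, isUnit_iff_ne_zero]
  exact hx

/-- By Cramer's formula: the adjugate and the determinant are continuous, and the determinant does
not vanish. -/
theorem continuousOn_matrix_inv {N : ℕ} {s : Set ℝ} {g : ℝ → Matrix (Fin N) (Fin N) ℂ}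
    (hg : ContinuousOn g s) (hu : ∀ x ∈ s, IsUnit (g x)) : ContinuousOn (fun x => (g x)⁻¹) s := by
  rw [continuousOn_iff_continuous_domRestrict] at hg ⊢
  simp only [Set.domRestrict_def, Matrix.inv_def, Ring.inverse_eq_inv'] at hg ⊢
  refine Continuous.smul (Continuous.inv₀ hg.matrix_det fun x => ?_) hg.matrix_adjugate
  exact ((Matrix.isUnit_iff_isUnit_det _).1 (hu x x.2)).ne_zero

end Circle

namespace IdempotentClass

open Matrix

attribute [local instance] Matrix.linftyOpNormedRing

/-- Every idempotent over `C(𝕋)` is equivalent to an identity matrix: complex vector bundles over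
the circle are trivial. -/
theorem exists_eq_mk_one (x : IdempotentClass C(Circle, ℂ)) :
    ∃ r, x = mk (IdempotentOver.one r) := by
  obtain ⟨N, M, hM, rfl⟩ := exists_ofMatrix x
  let ev : Circle → C(Circle, ℂ) →+* ℂ := fun s =>
    (ContinuousMap.evalAlgHom ℂ ℂ s : C(Circle, ℂ) →ₐ[ℂ] ℂ).toRingHom
  let P : ℝ → Matrix (Fin N) (Fin N) ℂ := fun x => M.map fun a => a (Circle.exp x)
  have hPc : Continuous P := continuous_pi fun i => continuous_pi fun j =>
    (M i j).continuous.comp Circle.exp.continuous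
  have hP : ∀ x, IsIdempotentElem (P x) := fun x => by
    have := congrArg (fun M => M.map (ev (Circle.exp x))) hM.eq
    rw [Matrix.map_mul] at this
    exact this
  have := completeSpace_matrix (A := ℂ) (ι := Fin N)
  obtain ⟨g, hg, hg0, hgx⟩ := exists_transport hPc hP (2 * Real.pi)
  have hpi := Real.two_pi_pos
  have hend := hgx (2 * Real.pi) ⟨hpi.le, le_rfl⟩
  have hP2 : P (2 * Real.pi) = P 0 := by simp [P]
  rw [hP2] at hend
  -- The holonomy g(2π) commutes with P 0. It is joined to 1 by affine combinations of 1 and itself,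
  -- which therefore commute with P 0 as well.
  obtain ⟨z, hz, hz0, hz1, hzu⟩ := exists_path_of_isUnit hend.1
  set G := g (2 * Real.pi) with hG
  let c : ℝ → Matrix (Fin N) (Fin N) ℂ := fun x =>
    (1 - z (x / (2 * Real.pi))) • (1 : Matrix (Fin N) (Fin N) ℂ) + z (x / (2 * Real.pi)) • G
  have hc : Continuous c := by fun_prop
  have hc0 : c 0 = 1 := by simp [c, hz0]
  have hc1 : c (2 * Real.pi) = G := by simp [c, hz1]
  have hcu : ∀ x, IsUnit (c x) := fun x => hzu _
  have hcP : ∀ x, c x * P 0 = P 0 * c x := fun x => by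
    simp only [c, add_mul, mul_add, smul_mul_assoc, mul_smul_comm, hend.2, one_mul, mul_one]
  obtain ⟨r, X₀, Y₀, hXY, hYX⟩ := exists_mul_eq_one_of_isIdempotentElem (hP 0)
  have hdet : ∀ {M : Matrix (Fin N) (Fin N) ℂ}, IsUnit M → IsUnit M.det :=
    fun h => (Matrix.isUnit_iff_isUnit_det _).1 h
  -- Dividing the transport g by the path c closes it up: g c⁻¹ is 1 at both ends and still carries
  -- P 0 to P x, as c commutes with P 0.
  let X : ℝ → Matrix (Fin N) (Fin r) ℂ := fun x => g x * (c x)⁻¹ * X₀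
  let Y : ℝ → Matrix (Fin r) (Fin N) ℂ := fun x => Y₀ * (c x * (g x)⁻¹)
  have hXc : ContinuousOn X (Set.Icc 0 (2 * Real.pi)) := by
    have := continuousOn_matrix_inv (s := Set.Icc 0 (2 * Real.pi)) hc.continuousOn fun x _ => hcu x
    have h2 := hg.continuousOn (s := Set.Icc 0 (2 * Real.pi))
    rw [continuousOn_iff_continuous_domRestrict] at *
    exact (h2.matrix_mul this).matrix_mul continuous_const
  have hYc : ContinuousOn Y (Set.Icc 0 (2 * Real.pi)) := by
    have := continuousOn_matrix_inv hg.continuousOn fun x hx => (hgx x hx).1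
    have h2 := hc.continuousOn (s := Set.Icc 0 (2 * Real.pi))
    rw [continuousOn_iff_continuous_domRestrict] at *
    exact continuous_const.matrix_mul (h2.matrix_mul this)
  have hX0 : X 0 = X (2 * Real.pi) := by
    simp only [X, hg0, hc0, hc1, ← hG, Matrix.mul_nonsing_inv _ (hdet hend.1)]
    simp
  have hY0 : Y 0 = Y (2 * Real.pi) := by
    simp only [Y, hg0, hc0, hc1, ← hG, Matrix.mul_nonsing_inv _ (hdet hend.1)]
    simp
  have hXYx : ∀ x ∈ Set.Icc 0 (2 * Real.pi), X x * Y x = P x := fun x hx => by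
    obtain ⟨h1, h2⟩ := hgx x hx
    calc g x * (c x)⁻¹ * X₀ * (Y₀ * (c x * (g x)⁻¹))
        = g x * (c x)⁻¹ * (X₀ * Y₀) * (c x * (g x)⁻¹) := by simp only [Matrix.mul_assoc]
      _ = g x * (c x)⁻¹ * (P 0 * c x) * (g x)⁻¹ := by rw [hXY]; simp only [Matrix.mul_assoc]
      _ = g x * ((c x)⁻¹ * c x) * P 0 * (g x)⁻¹ := by rw [← hcP]; simp only [Matrix.mul_assoc]
      _ = P x := by
        rw [Matrix.nonsing_inv_mul _ (hdet (hcu x)), Matrix.mul_one, h2, Matrix.mul_assoc,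
          Matrix.mul_nonsing_inv _ (hdet h1), Matrix.mul_one]
  have hYXx : ∀ x ∈ Set.Icc 0 (2 * Real.pi), Y x * X x = 1 := fun x hx => by
    obtain ⟨h1, h2⟩ := hgx x hx
    calc Y₀ * (c x * (g x)⁻¹) * (g x * (c x)⁻¹ * X₀)
        = Y₀ * (c x * ((g x)⁻¹ * g x) * (c x)⁻¹) * X₀ := by simp only [Matrix.mul_assoc]
      _ = 1 := by
        rw [Matrix.nonsing_inv_mul _ (hdet h1), Matrix.mul_one,
          Matrix.mul_nonsing_inv _ (hdet (hcu x)), Matrix.mul_one, hYX]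
  have hentry : ∀ {k l : ℕ} {Z : ℝ → Matrix (Fin k) (Fin l) ℂ},
      ContinuousOn Z (Set.Icc 0 (2 * Real.pi)) → Z 0 = Z (2 * Real.pi) →
      ∃ F : Matrix (Fin k) (Fin l) C(Circle, ℂ), ∀ x ∈ Set.Ico 0 (2 * Real.pi),
        (F.map fun a => a (Circle.exp x)) = Z x := by
    intro k l Z hZ hZ0
    choose F hF using fun (i : Fin k) (j : Fin l) =>
      exists_continuousMap_circle_exp (f := fun x => Z x i j)
        (continuousOn_pi.1 (continuousOn_pi.1 hZ i) j) (by rw [hZ0])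
    refine ⟨Matrix.of F, fun x hx => ?_⟩
    ext i j
    exact hF i j x hx
  obtain ⟨FX, hFX⟩ := hentry hXc hX0
  obtain ⟨FY, hFY⟩ := hentry hYc hY0
  have hext : ∀ {k : ℕ} {Z Z' : Matrix (Fin k) (Fin k) C(Circle, ℂ)},
      (∀ x ∈ Set.Ico 0 (2 * Real.pi), Z.map (ev (Circle.exp x)) = Z'.map (ev (Circle.exp x))) →
        Z = Z' := by
    intro k Z Z' h
    ext i j s
    obtain ⟨x, hx, rfl⟩ := Circle.exists_exp_eq s
    exact congrFun (congrFun (h x hx) i) j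
  refine ⟨r, ?_⟩
  rw [mk_one, ofMatrix_eq_ofMatrix_iff]
  refine ⟨FX, FY, hext fun x hx => ?_, hext fun x hx => ?_⟩
  · rw [Matrix.map_mul]
    exact (congrArg₂ (· * ·) (hFX x hx) (hFY x hx)).trans (hXYx x ⟨hx.1, hx.2.le⟩)
  · rw [Matrix.map_mul, Matrix.map_one _ (_root_.map_zero _) (_root_.map_one _)]
    exact (congrArg₂ (· * ·) (hFY x hx) (hFX x hx)).trans (hYXx x ⟨hx.1, hx.2.le⟩)

end IdempotentClass

open Filter Topology

/-! ### The ideal attached to an isometry -/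

namespace IsometryIdeal

variable {B : Type*} [CStarAlgebra B] {S : B}

theorem norm_le_one (hS : star S * S = 1) : ‖S‖ ≤ 1 := by
  rcases subsingleton_or_nontrivial B with h | h
  · simp [Subsingleton.elim S 0]
  · have h1 := CStarRing.norm_star_mul_self (x := S)
    rw [hS, CStarRing.norm_one] at h1
    nlinarith [norm_nonneg S]

theorem star_pow_mul_pow (hS : star S * S = 1) (m : ℕ) : star S ^ m * S ^ m = 1 := by
  induction m with
  | zero => simp
  | succ m ih => rw [pow_succ, pow_succ', mul_assoc, ← mul_assoc (star S), hS, one_mul, ih]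

theorem star_pow_add_mul_pow (hS : star S * S = 1) (m k : ℕ) :
    star S ^ (m + k) * S ^ k = star S ^ m := by
  rw [pow_add, mul_assoc, star_pow_mul_pow hS, mul_one]

theorem norm_pow_mul_le (hS : star S * S = 1) (m : ℕ) (a : B) : ‖S ^ m * a‖ ≤ ‖a‖ := by
  induction m with
  | zero => simp
  | succ m ih =>
    rw [pow_succ', mul_assoc]
    refine (norm_mul_le _ _).trans (le_trans ?_ ih)
    exact mul_le_of_le_one_left (norm_nonneg _) (norm_le_one hS)

theorem norm_star_pow_mul_le (hS : star S * S = 1) (m : ℕ) (a : B) :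
    ‖star S ^ m * a‖ ≤ ‖a‖ := by
  induction m with
  | zero => simp
  | succ m ih =>
    rw [pow_succ', mul_assoc]
    refine (norm_mul_le _ _).trans (le_trans ?_ ih)
    exact mul_le_of_le_one_left (norm_nonneg _) (by rw [norm_star]; exact norm_le_one hS)

theorem norm_mul_pow_le (hS : star S * S = 1) (m : ℕ) (a : B) : ‖a * S ^ m‖ ≤ ‖a‖ := by
  have := norm_star_pow_mul_le hS m (star a)
  rwa [← star_pow, ← star_mul, norm_star, norm_star] at this

theorem norm_mul_star_pow_le (hS : star S * S = 1) (m : ℕ) (a : B) : ‖a * star S ^ m‖ ≤ ‖a‖ := by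
  have := norm_pow_mul_le hS m (star a)
  rw [← norm_star] at this
  simpa using this

/-- The elements `a` with `S*^m a → 0`. -/
def vanishing (S : B) : Submodule ℂ B where
  carrier := {a | Tendsto (fun m : ℕ => star S ^ m * a) atTop (𝓝 0)}
  zero_mem' := by simp
  add_mem' {a b} ha hb := by
    have h : Tendsto _ _ _ := ha.add hb
    simp only [← mul_add, add_zero] at h
    exact h
  smul_mem' c a ha := by
    have h : Tendsto _ _ _ := ha.const_smul c
    simp only [← mul_smul_comm, smul_zero] at h
    exact h

theorem mem_vanishing {a : B} :
    a ∈ vanishing S ↔ Tendsto (fun m : ℕ => star S ^ m * a) atTop (𝓝 0) := Iff.rfl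

theorem mul_mem_vanishing {a : B} (ha : a ∈ vanishing S) (b : B) : a * b ∈ vanishing S := by
  have h : Tendsto _ _ _ := ha.mul_const b
  rw [mem_vanishing]
  simpa only [zero_mul, mul_assoc] using h

/-- The operators S*^m are contractions, so convergence to 0 passes to norm limits. -/
theorem isClosed_vanishing (hS : star S * S = 1) : IsClosed (vanishing S : Set B) := by
  refine isClosed_of_closure_subset fun a ha => ?_
  refine Metric.tendsto_atTop.2 fun ε hε => ?_
  obtain ⟨b, hb, hab⟩ := Metric.mem_closure_iff.1 ha (ε / 2) (half_pos hε)
  obtain ⟨N, hN⟩ := Metric.tendsto_atTop.1 hb (ε / 2) (half_pos hε)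
  refine ⟨N, fun m hm => ?_⟩
  have h1 := hN m hm
  rw [dist_eq_norm] at hab
  rw [dist_zero_right] at h1 ⊢
  have h2 := norm_star_pow_mul_le hS m (a - b)
  have h3 : star S ^ m * a = star S ^ m * (a - b) + star S ^ m * b := by rw [mul_sub]; abel
  rw [h3]
  refine (norm_add_le _ _).trans_lt ?_
  linarith

/-- Multiplication by S only shifts the sequence by one index, as S*^(m+1) S a = S*^m a. -/
theorem self_mul_mem_vanishing (hS : star S * S = 1) {a : B} (ha : a ∈ vanishing S) :
    S * a ∈ vanishing S := by
  rw [mem_vanishing, ← tendsto_add_atTop_iff_nat 1]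
  refine Tendsto.congr (fun m => ?_) ha
  rw [pow_succ, mul_assoc, ← mul_assoc (star S), hS, one_mul]

theorem star_mul_mem_vanishing {a : B} (ha : a ∈ vanishing S) : star S * a ∈ vanishing S := by
  rw [mem_vanishing]
  have h : Tendsto _ _ _ := ha.const_mul (star S)
  rw [mul_zero] at h
  refine Tendsto.congr (fun m => ?_) h
  rw [← mul_assoc, ← mul_assoc, ← pow_succ, ← pow_succ']

/-- The elements which, together with their adjoints, map `vanishing S` to itself. -/
def multipliers (S : B) : StarSubalgebra ℂ B where
  carrier := {b | (∀ a ∈ vanishing S, b * a ∈ vanishing S) ∧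
    ∀ a ∈ vanishing S, star b * a ∈ vanishing S}
  mul_mem' {b c} hb hc :=
    ⟨fun a ha => by rw [mul_assoc]; exact hb.1 _ (hc.1 a ha),
      fun a ha => by rw [star_mul, mul_assoc]; exact hc.2 _ (hb.2 a ha)⟩
  add_mem' {b c} hb hc :=
    ⟨fun a ha => by rw [add_mul]; exact add_mem (hb.1 a ha) (hc.1 a ha),
      fun a ha => by rw [star_add, add_mul]; exact add_mem (hb.2 a ha) (hc.2 a ha)⟩
  algebraMap_mem' c := by
    refine ⟨fun a ha => ?_, fun a ha => ?_⟩
    · rw [← Algebra.smul_def]; exact Submodule.smul_mem _ c ha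
    · rw [← algebraMap_star_comm, ← Algebra.smul_def]; exact Submodule.smul_mem _ _ ha
  star_mem' {b} hb := ⟨hb.2, by rw [star_star]; exact hb.1⟩

theorem isClosed_multipliers (hS : star S * S = 1) : IsClosed (multipliers S : Set B) := by
  have h : (multipliers S : Set B) = ⋂ a ∈ vanishing S,
      {b | b * a ∈ vanishing S} ∩ {b | star b * a ∈ vanishing S} := by
    ext b
    simp only [Set.mem_iInter, Set.mem_inter_iff, SetLike.mem_coe]
    exact ⟨fun h a ha => ⟨h.1 a ha, h.2 a ha⟩, fun h => ⟨fun a ha => (h a ha).1,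
      fun a ha => (h a ha).2⟩⟩
  rw [h]
  refine isClosed_biInter fun a _ => IsClosed.inter ?_ ?_
  · exact (isClosed_vanishing hS).preimage (continuous_mul_const a)
  · exact (isClosed_vanishing hS).preimage (continuous_star.mul continuous_const)

theorem self_mem_multipliers (hS : star S * S = 1) : S ∈ multipliers S :=
  ⟨fun _ => self_mul_mem_vanishing hS, fun _ => star_mul_mem_vanishing⟩

/-- The self-adjoint part of `vanishing S`, an ideal of `multipliers S`. -/
def ideal (S : B) : Submodule ℂ B where
  carrier := {a | a ∈ vanishing S ∧ star a ∈ vanishing S}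
  zero_mem' := ⟨zero_mem _, by rw [star_zero]; exact zero_mem _⟩
  add_mem' ha hb := ⟨add_mem ha.1 hb.1, by rw [star_add]; exact add_mem ha.2 hb.2⟩
  smul_mem' c a ha := ⟨Submodule.smul_mem _ c ha.1, by
    rw [star_smul]; exact Submodule.smul_mem _ _ ha.2⟩

theorem star_mem_ideal {a : B} (ha : a ∈ ideal S) : star a ∈ ideal S :=
  ⟨ha.2, by rw [star_star]; exact ha.1⟩

theorem mul_mem_ideal {a b : B} (hb : b ∈ multipliers S) (ha : a ∈ ideal S) : b * a ∈ ideal S :=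
  ⟨hb.1 a ha.1, by rw [star_mul]; exact mul_mem_vanishing ha.2 _⟩

theorem mul_mem_ideal' {a b : B} (ha : a ∈ ideal S) (hb : b ∈ multipliers S) : a * b ∈ ideal S := by
  have := star_mem_ideal (mul_mem_ideal (star_mem hb) (star_mem_ideal ha))
  rwa [star_mul, star_star, star_star] at this

/-- `vanishing S` is a right ideal, so left multiplication by any of its elements maps everything
into it. -/
theorem mem_multipliers_of_mem_ideal {a : B} (ha : a ∈ ideal S) : a ∈ multipliers S :=
  ⟨fun b _ => mul_mem_vanishing ha.1 b, fun b _ => mul_mem_vanishing ha.2 b⟩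

/-- S* (1 - S S*) = 0, so the sequence vanishes from m = 1 on. -/
theorem one_sub_mem_ideal (hS : star S * S = 1) : 1 - S * star S ∈ ideal S := by
  have h : 1 - S * star S ∈ vanishing S := by
    refine tendsto_const_nhds.congr' ?_
    filter_upwards [eventually_ge_atTop 1] with m hm
    obtain ⟨k, rfl⟩ := Nat.exists_eq_add_of_le' hm
    rw [mul_sub, mul_one, ← mul_assoc, pow_succ, mul_assoc _ (star S) S, hS, mul_one, sub_self]
  exact ⟨h, by simpa using h⟩

/-- An element of `ideal S` is the limit of its corners. -/
theorem tendsto_corner (hS : star S * S = 1) {a : B} (ha : a ∈ ideal S) :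
    Tendsto (fun m : ℕ => (1 - S ^ m * star S ^ m) * a * (1 - S ^ m * star S ^ m)) atTop (𝓝 a) := by
  rw [tendsto_iff_norm_sub_tendsto_zero]
  have h1 : Tendsto (fun m : ℕ => ‖star S ^ m * a‖) atTop (𝓝 0) := by simpa using ha.1.norm
  have h2 : Tendsto (fun m : ℕ => ‖star S ^ m * star a‖) atTop (𝓝 0) := by simpa using ha.2.norm
  refine squeeze_zero (fun _ => norm_nonneg _) (fun m => ?_)
    (by simpa using (h1.add (h2.add h2)))
  -- Each term on the right contains S*^m a or a S^m. As S and S* are contractions, its norm is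
  -- bounded by that of S*^m a or of S*^m a*.
  have e : (1 - S ^ m * star S ^ m) * a * (1 - S ^ m * star S ^ m) - a =
      -(S ^ m * (star S ^ m * a)) - (a * S ^ m * star S ^ m -
        S ^ m * (star S ^ m * (a * S ^ m * star S ^ m))) := by noncomm_ring
  have h3 : ‖a * S ^ m * star S ^ m‖ ≤ ‖star S ^ m * star a‖ := by
    refine (norm_mul_star_pow_le hS m _).trans ?_
    rw [← star_pow, ← star_mul, norm_star]
  rw [e]
  refine (norm_sub_le _ _).trans (add_le_add ?_ ((norm_sub_le _ _).trans (add_le_add h3 ?_)))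
  · rw [norm_neg]; exact norm_pow_mul_le hS m _
  · exact (norm_pow_mul_le hS m _).trans ((norm_star_pow_mul_le hS m _).trans h3)

/-- `S ^ k` for `k ≥ 0` and `S* ^ (-k)` for `k < 0`. -/
noncomputable def zpow (S : B) : ℤ → B
  | Int.ofNat k => S ^ k
  | Int.negSucc k => star S ^ (k + 1)

theorem star_zpow_mem {L : Submodule ℂ B} (h : ∀ k, zpow S k ∈ L) (k : ℤ) :
    star (zpow S k) ∈ L := by
  cases k with
  | ofNat k =>
    rcases k with _ | k
    · simpa [zpow] using h 0
    · simpa [zpow] using h (Int.negSucc k)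
  | negSucc k => simpa [zpow] using h (Int.ofNat (k + 1))

theorem zpow_mem {A : StarSubalgebra ℂ B} (h : S ∈ A) (k : ℤ) : zpow S k ∈ A := by
  cases k with
  | ofNat k => exact pow_mem h k
  | negSucc k => exact pow_mem (star_mem h) _

/-- The compressions x ↦ S*^m x S^m fix the Laurent monomials and tend to 0 on the ideal, so in the
limit they single out the Laurent part. -/
theorem star_pow_mul_zpow_mul_pow (hS : star S * S = 1) (m : ℕ) (k : ℤ) :
    star S ^ m * zpow S k * S ^ m = zpow S k := by
  cases k with
  | ofNat k =>
    change star S ^ m * S ^ k * S ^ m = S ^ k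
    rw [mul_assoc, ← pow_add, add_comm, pow_add, ← mul_assoc, star_pow_mul_pow hS, one_mul]
  | negSucc k =>
    change star S ^ m * star S ^ (k + 1) * S ^ m = star S ^ (k + 1)
    rw [← pow_add, add_comm, star_pow_add_mul_pow hS]

/-- The span of the powers of `S` and `S*` and the elements of the ideal which lie in `A`. -/
noncomputable def laurent (S : B) (A : StarSubalgebra ℂ B) : Submodule ℂ B :=
  Submodule.span ℂ (Set.range (zpow S)) ⊔ (ideal S ⊓ A.toSubalgebra.toSubmodule)

variable {A : StarSubalgebra ℂ B}

theorem zpow_mem_laurent (k : ℤ) : zpow S k ∈ laurent S A :=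
  Submodule.mem_sup_left (Submodule.subset_span ⟨k, rfl⟩)

theorem mem_laurent_of_mem_ideal {a : B} (h : a ∈ ideal S) (hA : a ∈ A) : a ∈ laurent S A :=
  Submodule.mem_sup_right ⟨h, hA⟩

theorem one_mem_laurent : (1 : B) ∈ laurent S A := by
  simpa [zpow] using zpow_mem_laurent (S := S) (A := A) (Int.ofNat 0)

theorem laurent_induction {p : B → Prop} (hz : ∀ k, p (zpow S k))
    (hi : ∀ a ∈ ideal S, a ∈ A → p a) (hadd : ∀ a b, a ∈ laurent S A → b ∈ laurent S A →
      p a → p b → p (a + b)) (h0 : p 0) (hsmul : ∀ (c : ℂ) a, a ∈ laurent S A → p a → p (c • a)) {a : B}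
    (ha : a ∈ laurent S A) : p a := by
  rw [laurent, Submodule.mem_sup] at ha
  obtain ⟨y, hy, z, hz', rfl⟩ := ha
  refine hadd _ _ (Submodule.mem_sup_left hy) (Submodule.mem_sup_right hz') ?_ (hi z hz'.1 hz'.2)
  induction hy using Submodule.span_induction with
  | mem x hx => obtain ⟨k, rfl⟩ := hx; exact hz k
  | zero => exact h0
  | add x y hx hy h1 h2 =>
    exact hadd _ _ (Submodule.mem_sup_left hx) (Submodule.mem_sup_left hy) h1 h2
  | smul c x hx h => exact hsmul c x (Submodule.mem_sup_left hx) h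

theorem mul_mem_laurent_of_forall {b : B} (hz : ∀ k, b * zpow S k ∈ laurent S A)
    (hi : ∀ a ∈ ideal S, a ∈ A → b * a ∈ laurent S A) {a : B} (ha : a ∈ laurent S A) :
    b * a ∈ laurent S A :=
  laurent_induction (p := fun a => b * a ∈ laurent S A) hz hi
    (fun x y _ _ hx hy => by rw [mul_add]; exact add_mem hx hy) (by simp)
    (fun c x _ hx => by rw [mul_smul_comm]; exact Submodule.smul_mem _ c hx) ha

theorem self_mul_mem_laurent (hS : star S * S = 1) (hSA : S ∈ A) {a : B} (ha : a ∈ laurent S A) :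
    S * a ∈ laurent S A := by
  refine mul_mem_laurent_of_forall (fun k => ?_) (fun a ha hA => mem_laurent_of_mem_ideal
    (mul_mem_ideal (self_mem_multipliers hS) ha) (mul_mem hSA hA)) ha
  cases k with
  | ofNat k =>
    have : S * zpow S (Int.ofNat k) = zpow S (Int.ofNat (k + 1)) := (pow_succ' S k).symm
    rw [this]
    exact zpow_mem_laurent _
  | negSucc k =>
    -- This is the only product that leaves the Laurent monomials; the correction lies in the ideal
    -- because 1 - S S* does.
    have h1 : S * zpow S (Int.negSucc k) = star S ^ k - (1 - S * star S) * star S ^ k := by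
      change S * star S ^ (k + 1) = _
      rw [pow_succ', sub_mul, one_mul, mul_assoc]
      abel
    have h2 : star S ^ k ∈ laurent S A := by
      rcases k with _ | k
      · rw [pow_zero]; exact one_mem_laurent
      · exact zpow_mem_laurent (S := S) (Int.negSucc k)
    rw [h1]
    refine sub_mem h2 (mem_laurent_of_mem_ideal (mul_mem_ideal' (one_sub_mem_ideal hS)
      (pow_mem (star_mem (self_mem_multipliers hS)) k)) ?_)
    exact mul_mem (sub_mem (one_mem _) (mul_mem hSA (star_mem hSA))) (pow_mem (star_mem hSA) k)

theorem star_mul_mem_laurent (hS : star S * S = 1) (hSA : S ∈ A) {a : B} (ha : a ∈ laurent S A) :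
    star S * a ∈ laurent S A := by
  refine mul_mem_laurent_of_forall (fun k => ?_) (fun a ha hA => mem_laurent_of_mem_ideal
    (mul_mem_ideal (star_mem (self_mem_multipliers hS)) ha) (mul_mem (star_mem hSA) hA)) ha
  cases k with
  | ofNat k =>
    rcases k with _ | k
    · have : star S * zpow S (Int.ofNat 0) = zpow S (Int.negSucc 0) := by simp [zpow]
      rw [this]
      exact zpow_mem_laurent _
    · have : star S * zpow S (Int.ofNat (k + 1)) = zpow S (Int.ofNat k) := by
        change star S * S ^ (k + 1) = S ^ k
        rw [pow_succ', ← mul_assoc, hS, one_mul]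
      rw [this]
      exact zpow_mem_laurent _
  | negSucc k =>
    have : star S * zpow S (Int.negSucc k) = zpow S (Int.negSucc (k + 1)) :=
      (pow_succ' (star S) (k + 1)).symm
    rw [this]
    exact zpow_mem_laurent _

theorem mul_mem_laurent (hS : star S * S = 1) (hSA : S ∈ A) {a b : B}
    (hb : b ∈ laurent S A) (ha : a ∈ laurent S A) : b * a ∈ laurent S A := by
  refine laurent_induction (p := fun b => b * a ∈ laurent S A) (fun k => ?_) (fun b hb hbA => ?_)
    (fun x y _ _ hx hy => by rw [add_mul]; exact add_mem hx hy) (by simp)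
    (fun c x _ hx => by rw [smul_mul_assoc]; exact Submodule.smul_mem _ c hx) hb
  · cases k with
    | ofNat k =>
      change S ^ k * a ∈ _
      induction k with
      | zero => simpa
      | succ k ih => rw [pow_succ', mul_assoc]; exact self_mul_mem_laurent hS hSA ih
    | negSucc k =>
      change star S ^ (k + 1) * a ∈ _
      generalize k + 1 = k
      induction k with
      | zero => simpa
      | succ k ih => rw [pow_succ', mul_assoc]; exact star_mul_mem_laurent hS hSA ih
  · refine mul_mem_laurent_of_forall (fun k => ?_) (fun a ha hA => ?_) ha
    · exact mem_laurent_of_mem_ideal (mul_mem_ideal' hb (zpow_mem (self_mem_multipliers hS) k))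
        (mul_mem hbA (zpow_mem hSA k))
    · exact mem_laurent_of_mem_ideal (mul_mem_ideal (mem_multipliers_of_mem_ideal hb) ha)
        (mul_mem hbA hA)

theorem star_mem_laurent {a : B} (ha : a ∈ laurent S A) : star a ∈ laurent S A :=
  laurent_induction (p := fun a => star a ∈ laurent S A)
    (star_zpow_mem zpow_mem_laurent)
    (fun a ha hA => mem_laurent_of_mem_ideal (star_mem_ideal ha) (star_mem hA))
    (fun x y _ _ hx hy => by rw [star_add]; exact add_mem hx hy) (by simp)
    (fun c x _ hx => by rw [star_smul]; exact Submodule.smul_mem _ _ hx) ha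

/-- `laurent S A` is itself a *-subalgebra, so it suffices to test generators. -/
theorem adjoin_le_laurent (hS : star S * S = 1) (hSA : S ∈ A) {s : Set B}
    (hs : s ⊆ laurent S A) : (StarAlgebra.adjoin ℂ s : Set B) ⊆ laurent S A := by
  let T : StarSubalgebra ℂ B :=
    { carrier := laurent S A
      mul_mem' := mul_mem_laurent hS hSA
      add_mem' := add_mem
      algebraMap_mem' := fun c => by
        rw [Algebra.algebraMap_eq_smul_one]
        exact Submodule.smul_mem _ c one_mem_laurent
      star_mem' := star_mem_laurent }
  exact StarAlgebra.adjoin_le (S := T) hs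

/-- The compressions `S*^m a S^m` converge for `a` in the closure of `laurent S A`. -/
theorem cauchySeq_compression (hS : star S * S = 1) {a : B}
    (ha : a ∈ closure (laurent S A : Set B)) : CauchySeq fun m : ℕ => star S ^ m * a * S ^ m := by
  have hL : ∀ a ∈ laurent S A,
      ∃ l, Tendsto (fun m : ℕ => star S ^ m * a * S ^ m) atTop (𝓝 l) := fun a ha => by
    refine laurent_induction
      (p := fun a => ∃ l, Tendsto (fun m : ℕ => star S ^ m * a * S ^ m) atTop (𝓝 l))
      (fun k => ?_) (fun a ha _ => ?_) (fun x y _ _ hx hy => ?_) ?_ (fun c x _ hx => ?_) ha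
    · simp only [star_pow_mul_zpow_mul_pow hS]
      exact ⟨_, tendsto_const_nhds⟩
    · refine ⟨0, squeeze_zero_norm (fun m => norm_mul_pow_le hS m _) ?_⟩
      simpa using ha.1.norm
    · obtain ⟨l, hl⟩ := hx
      obtain ⟨l', hl'⟩ := hy
      exact ⟨l + l', by simpa only [mul_add, add_mul] using hl.add hl'⟩
    · exact ⟨0, by simp⟩
    · obtain ⟨l, hl⟩ := hx
      exact ⟨c • l, by simpa only [mul_smul_comm, smul_mul_assoc] using hl.const_smul c⟩
  refine Metric.cauchySeq_iff'.2 fun ε hε => ?_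
  obtain ⟨b, hb, hab⟩ := Metric.mem_closure_iff.1 ha (ε / 3) (by positivity)
  obtain ⟨N, hN⟩ := Metric.cauchySeq_iff'.1 (hL b hb).choose_spec.cauchySeq (ε / 3) (by positivity)
  refine ⟨N, fun m hm => ?_⟩
  have h1 := hN m hm
  rw [dist_eq_norm] at hab h1 ⊢
  have h2 : ∀ m : ℕ, ‖star S ^ m * (a - b) * S ^ m‖ ≤ ‖a - b‖ := fun m =>
    (norm_mul_pow_le hS m _).trans (norm_star_pow_mul_le hS m _)
  -- Compressions are contractive, so a may be replaced by a nearby b for which they converge.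
  have h3 : star S ^ m * a * S ^ m - star S ^ N * a * S ^ N =
      star S ^ m * (a - b) * S ^ m + (star S ^ m * b * S ^ m - star S ^ N * b * S ^ N) -
        star S ^ N * (a - b) * S ^ N := by noncomm_ring
  rw [h3]
  refine (norm_sub_le _ _).trans_lt ?_
  have := norm_add_le (star S ^ m * (a - b) * S ^ m)
    (star S ^ m * b * S ^ m - star S ^ N * b * S ^ N)
  have := h2 m
  have := h2 N
  linarith

/-- A multiplier whose compressions tend to `0` lies in `vanishing S`. -/
theorem mem_vanishing_of_tendsto (hS : star S * S = 1) {a : B} (ha : a ∈ multipliers S)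
    (h : Tendsto (fun m : ℕ => star S ^ m * a * S ^ m) atTop (𝓝 0)) : a ∈ vanishing S := by
  refine Metric.tendsto_atTop.2 fun ε hε => ?_
  obtain ⟨k, hk⟩ := Metric.tendsto_atTop.1 h (ε / 2) (half_pos hε)
  have hE : 1 - S ^ k * star S ^ k ∈ vanishing S := by
    refine tendsto_const_nhds.congr' ?_
    filter_upwards [eventually_ge_atTop k] with m hm
    obtain ⟨l, rfl⟩ := Nat.exists_eq_add_of_le' hm
    rw [mul_sub, mul_one, ← mul_assoc, star_pow_add_mul_pow hS, ← pow_add, sub_self]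
  obtain ⟨N, hN⟩ := Metric.tendsto_atTop.1 (ha.1 _ hE) (ε / 2) (half_pos hε)
  refine ⟨max N k, fun m hm => ?_⟩
  have h1 := hN m (le_of_max_le_left hm)
  have h2 := hk k le_rfl
  rw [dist_zero_right] at h1 h2 ⊢
  obtain ⟨l, rfl⟩ := Nat.exists_eq_add_of_le' (le_of_max_le_right hm)
  -- The element a is split along 1 = (1 - S^k S*^k) + S^k S*^k. The first part tends to 0 because a
  -- multiplies `vanishing S` into itself; the second is bounded, uniformly in l, by the norm of the
  -- compression at k.
  have e : star S ^ (l + k) * a = star S ^ (l + k) * (a * (1 - S ^ k * star S ^ k)) +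
      star S ^ l * (star S ^ k * a * S ^ k) * star S ^ k := by
    rw [pow_add]; noncomm_ring
  rw [e]
  refine (norm_add_le _ _).trans_lt ?_
  have h3 := (norm_mul_star_pow_le hS k (star S ^ l * (star S ^ k * a * S ^ k))).trans
    (norm_star_pow_mul_le hS l _)
  linarith

end IsometryIdeal

/-! ### The isometry in the algebra of the sphere -/

namespace QuantumSphere

open IsometryIdeal

variable {n : ℕ}

theorem star_weightedComp_apply_of_notMem {ι : Type} [DecidableEq ι] (φ : ι → ι)
    (hφ : Function.Injective φ) (c : ι → ℂ) (hc : ∀ i, ‖c i‖ ≤ 1)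
    (f : lp (fun _ : ι => ℂ) 2) {y : ι} (hy : y ∉ Set.range φ) :
    star (weightedComp φ hφ c hc) f y = 0 := by
  have h : weightedComp φ hφ c hc (lp.single 2 y 1) = 0 := by
    ext j
    have : φ j ≠ y := fun h => hy ⟨j, h⟩
    rw [weightedComp_apply]
    simp [this]
  have h2 := ContinuousLinearMap.adjoint_inner_right (weightedComp φ hφ c hc) (lp.single 2 y 1) f
  rw [h, inner_zero_left, lp.inner_single_left] at h2
  simpa [ContinuousLinearMap.star_eq_adjoint] using h2

/-- The isometry `t ⊗ s ⊗ 1^{⊗ (n-1)}`, with `s` the unilateral shift (and `t` if `n = 0`). -/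
noncomputable def shift (n : ℕ) : Hilb n →L[ℂ] Hilb n :=
  star (weightedComp (stepIdx 0) (stepIdx_injective 0) (fun _ => 1) fun _ => by simp)

theorem star_shift_apply (f : Hilb n) (x : ℤ × (Fin n → ℕ)) :
    star (shift n) f x = f (stepIdx 0 x) := by
  rw [shift, star_star, weightedComp_apply, one_mul]

theorem shift_apply_stepIdx (f : Hilb n) (x : ℤ × (Fin n → ℕ)) :
    shift n f (stepIdx 0 x) = f x := by
  classical
  rw [shift, star_weightedComp_apply]
  simp

theorem shift_apply_of_notMem (f : Hilb n) {y : ℤ × (Fin n → ℕ)}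
    (hy : y ∉ Set.range (stepIdx (n := n) 0)) : shift n f y = 0 := by
  classical
  rw [shift, star_weightedComp_apply_of_notMem _ _ _ _ _ hy]

theorem star_shift_mul_shift : star (shift n) * shift n = 1 := by
  refine ContinuousLinearMap.ext fun f => lp.ext (funext fun x => ?_)
  rw [mul_apply_eq_comp, star_shift_apply, shift_apply_stepIdx]
  rfl

theorem star_gen_apply (q : Set.Ioo (0 : ℝ) 1) (i : Fin (n + 1)) (f : Hilb n)
    (x : ℤ × (Fin n → ℕ)) : star (gen q i) f x = stepWeight q i x * f (stepIdx i x) := by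
  rw [gen, star_star, weightedComp_apply]

theorem iterate_stepIdx (m : ℕ) (x : ℤ × (Fin n → ℕ)) : (stepIdx 0)^[m] x =
    (x.1 + m, fun l : Fin n => if (l : ℕ) = 0 then x.2 l + m else x.2 l) := by
  induction m with
  | zero => simp
  | succ m ih =>
    rw [Function.iterate_succ_apply', ih, stepIdx]
    refine Prod.ext ?_ (funext fun l => ?_)
    · simp; ring
    · by_cases h : (l : ℕ) = 0 <;> simp [h]; ring

theorem mem_range_iterate_stepIdx {m : ℕ} {y : ℤ × (Fin n → ℕ)} :
    y ∈ Set.range (stepIdx (n := n) 0)^[m] ↔ ∀ l : Fin n, (l : ℕ) = 0 → m ≤ y.2 l := by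
  constructor
  · rintro ⟨x, rfl⟩ l hl
    rw [iterate_stepIdx]
    simp [hl]
  · intro h
    refine ⟨(y.1 - m, fun l : Fin n => if (l : ℕ) = 0 then y.2 l - m else y.2 l), ?_⟩
    rw [iterate_stepIdx]
    refine Prod.ext (by simp) (funext fun l => ?_)
    by_cases hl : (l : ℕ) = 0
    · have := h l hl
      simp [hl]
      omega
    · simp [hl]

theorem mem_range_stepIdx {y : ℤ × (Fin n → ℕ)} :
    y ∈ Set.range (stepIdx (n := n) 0) ↔ ∀ l : Fin n, (l : ℕ) = 0 → 1 ≤ y.2 l :=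
  mem_range_iterate_stepIdx (m := 1)

theorem star_shift_pow_apply (m : ℕ) (f : Hilb n) (x : ℤ × (Fin n → ℕ)) :
    (star (shift n) ^ m) f x = f ((stepIdx 0)^[m] x) := by
  induction m generalizing f with
  | zero => rfl
  | succ m ih =>
    rw [pow_succ, mul_apply_eq_comp, ih, star_shift_apply, Function.iterate_succ_apply']

theorem shift_pow_apply_iterate (m : ℕ) (f : Hilb n) (x : ℤ × (Fin n → ℕ)) :
    (shift n ^ m) f ((stepIdx 0)^[m] x) = f x := by
  rw [← star_shift_pow_apply, ← mul_apply_eq_comp, star_pow_mul_pow star_shift_mul_shift]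
  rfl

theorem shift_pow_apply_of_notMem (m : ℕ) (f : Hilb n) {y : ℤ × (Fin n → ℕ)}
    (hy : y ∉ Set.range (stepIdx (n := n) 0)^[m]) : (shift n ^ m) f y = 0 := by
  induction m generalizing f y with
  | zero => exact absurd ⟨y, rfl⟩ hy
  | succ m ih =>
    rw [pow_succ', mul_apply_eq_comp]
    by_cases h : y ∈ Set.range (stepIdx (n := n) 0)
    · obtain ⟨z, rfl⟩ := h
      rw [shift_apply_stepIdx]
      refine ih _ fun ⟨x, hx⟩ => hy ⟨x, ?_⟩
      rw [Function.iterate_succ_apply', hx]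
    · exact shift_apply_of_notMem _ h

theorem one_sub_shift_pow_mul (m : ℕ) : 1 - shift n ^ m * star (shift n) ^ m =
    diagProj {x : ℤ × (Fin n → ℕ) | ∃ l : Fin n, (l : ℕ) = 0 ∧ x.2 l < m} := by
  refine ContinuousLinearMap.ext fun f => lp.ext (funext fun y => ?_)
  rw [diagProj_apply, sub_apply, lp.coeFn_sub, Pi.sub_apply, mul_apply_eq_comp]
  by_cases h : y ∈ Set.range (stepIdx (n := n) 0)^[m]
  · have h' : y ∉ {x : ℤ × (Fin n → ℕ) | ∃ l : Fin n, (l : ℕ) = 0 ∧ x.2 l < m} := by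
      rintro ⟨l, hl, hlt⟩
      exact absurd (mem_range_iterate_stepIdx.1 h l hl) (by omega)
    rw [Set.indicator_of_notMem h']
    obtain ⟨x, rfl⟩ := h
    rw [shift_pow_apply_iterate, star_shift_pow_apply]
    simp
  · have h' : y ∈ {x : ℤ × (Fin n → ℕ) | ∃ l : Fin n, (l : ℕ) = 0 ∧ x.2 l < m} := by
      rw [mem_range_iterate_stepIdx] at h
      push Not at h
      exact h
    rw [Set.indicator_of_mem h', shift_pow_apply_of_notMem _ _ h]
    simp

theorem stepIdx_comm (i : Fin (n + 1)) (x : ℤ × (Fin n → ℕ)) :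
    stepIdx i (stepIdx 0 x) = stepIdx 0 (stepIdx i x) := by
  refine Prod.ext rfl (funext fun l => ?_)
  simp only [stepIdx]
  split_ifs <;> rfl

/-- For i ≠ 0 the first tensor factor of the generator is γ, and one step up in this factor
multiplies its eigenvalue by q. -/
theorem stepWeight_stepIdx (q : Set.Ioo (0 : ℝ) 1) {i : Fin (n + 1)} (hi : i ≠ 0)
    (x : ℤ × (Fin n → ℕ)) : stepWeight q i (stepIdx 0 x) = q * stepWeight q i x := by
  obtain _ | n := n
  · exact absurd (Fin.ext (by omega)) hi
  have hi' : 0 < (i : ℕ) := Nat.pos_of_ne_zero fun h => hi (Fin.ext h)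
  rw [stepWeight, stepWeight, Fin.prod_univ_succ, Fin.prod_univ_succ, ← mul_assoc]
  congr 1
  simp [hi', stepIdx, pow_succ']

theorem stepWeight_zero_succ (q : Set.Ioo (0 : ℝ) 1) (x : ℤ × (Fin (n + 1) → ℕ)) :
    stepWeight q 0 x = √(1 - (q : ℝ) ^ (2 * (x.2 0 + 1))) := by
  rw [stepWeight, Fin.prod_univ_succ]
  simp

/-- The relation γ s = q s γ in the first tensor factor. The relations with the adjoints of the
shift and the generator are proved beside it, because both S*^m a and S*^m a* have to be controlled.
-/
theorem star_gen_mul_shift (q : Set.Ioo (0 : ℝ) 1) {i : Fin (n + 1)} (hi : i ≠ 0) :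
    star (gen q i) * shift n = (q : ℂ) • (shift n * star (gen q i)) := by
  refine ContinuousLinearMap.ext fun f => lp.ext (funext fun y => ?_)
  rw [mul_apply_eq_comp, star_gen_apply, smul_apply, lp.coeFn_smul, Pi.smul_apply,
    mul_apply_eq_comp]
  by_cases h : y ∈ Set.range (stepIdx (n := n) 0)
  · obtain ⟨x, rfl⟩ := h
    rw [stepIdx_comm, shift_apply_stepIdx, shift_apply_stepIdx, star_gen_apply,
      stepWeight_stepIdx q hi]
    push_cast
    simp [mul_assoc]
  · have h' : stepIdx i y ∉ Set.range (stepIdx (n := n) 0) := by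
      rw [mem_range_stepIdx] at h ⊢
      push Not at h ⊢
      obtain ⟨l, hl, hlt⟩ := h
      refine ⟨l, hl, ?_⟩
      have : (l : ℕ) ≠ i := fun h => hi (Fin.ext (by rw [← h, hl]; rfl))
      simpa [stepIdx, this] using hlt
    rw [shift_apply_of_notMem _ h, shift_apply_of_notMem _ h']
    simp

theorem star_shift_mul_gen (q : Set.Ioo (0 : ℝ) 1) {i : Fin (n + 1)} (hi : i ≠ 0) :
    star (shift n) * gen q i = (q : ℂ) • (gen q i * star (shift n)) := by
  have := congrArg star (star_gen_mul_shift q hi)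
  simpa using this

theorem star_shift_mul_star_gen (q : Set.Ioo (0 : ℝ) 1) {i : Fin (n + 1)} (hi : i ≠ 0) :
    star (shift n) * star (gen q i) = (q : ℂ) • (star (gen q i) * star (shift n)) := by
  refine ContinuousLinearMap.ext fun f => lp.ext (funext fun y => ?_)
  rw [mul_apply_eq_comp, star_shift_apply, star_gen_apply, smul_apply, lp.coeFn_smul,
    Pi.smul_apply, mul_apply_eq_comp, star_gen_apply, star_shift_apply, stepIdx_comm,
    stepWeight_stepIdx q hi]
  push_cast
  simp [mul_assoc]

theorem gen_mul_shift (q : Set.Ioo (0 : ℝ) 1) {i : Fin (n + 1)} (hi : i ≠ 0) :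
    gen q i * shift n = (q : ℂ) • (shift n * gen q i) := by
  have := congrArg star (star_shift_mul_star_gen q hi)
  simpa using this

/-- Moving S*^m past a produces the factor q^m, which tends to 0. -/
theorem mem_vanishing_of_star_shift_mul (q : Set.Ioo (0 : ℝ) 1) {a : Hilb n →L[ℂ] Hilb n}
    (h : star (shift n) * a = (q : ℂ) • (a * star (shift n))) : a ∈ vanishing (shift n) := by
  have h0 := q.2.1
  have hm : ∀ m : ℕ, star (shift n) ^ m * a = ((q : ℂ) ^ m) • (a * star (shift n) ^ m) := by
    intro m
    induction m with
    | zero => simp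
    | succ m ih =>
      rw [pow_succ', mul_assoc, ih, mul_smul_comm, ← mul_assoc, h, smul_mul_assoc, smul_smul,
        mul_assoc, ← pow_succ, ← pow_succ']
  rw [mem_vanishing]
  refine squeeze_zero_norm (a := fun m => (q : ℝ) ^ m * ‖a‖) (fun m => ?_) ?_
  · rw [hm, norm_smul, norm_pow, Complex.norm_real, Real.norm_of_nonneg h0.le]
    exact mul_le_mul_of_nonneg_left (norm_mul_star_pow_le star_shift_mul_shift _ _) (by positivity)
  · simpa using (tendsto_pow_atTop_nhds_zero_of_lt_one h0.le q.2.2).mul_const ‖a‖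

theorem gen_mem_ideal (q : Set.Ioo (0 : ℝ) 1) {i : Fin (n + 1)} (hi : i ≠ 0) :
    gen q i ∈ ideal (shift n) :=
  ⟨mem_vanishing_of_star_shift_mul q (star_shift_mul_gen q hi),
    mem_vanishing_of_star_shift_mul q (star_shift_mul_star_gen q hi)⟩

/-- The diagonal part of the generator `u_{n+1,n+1}`. -/
noncomputable def genDiag (q : Set.Ioo (0 : ℝ) 1) : Hilb n →L[ℂ] Hilb n :=
  weightedComp id Function.injective_id (fun x => (stepWeight q 0 x : ℂ)) (norm_stepWeight_le q 0)

theorem isDiag_genDiag (q : Set.Ioo (0 : ℝ) 1) :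
    IsDiag (genDiag (n := n) q) fun x => (stepWeight q 0 x : ℂ) := fun _ _ => rfl

theorem IsDiag.star_eq {ι : Type} {T : lp (fun _ : ι => ℂ) 2 →L[ℂ] lp (fun _ : ι => ℂ) 2}
    {c : ι → ℝ} (hT : IsDiag T fun i => (c i : ℂ)) : star T = T := by
  classical
  refine ContinuousLinearMap.ext fun f => lp.ext (funext fun x => ?_)
  have h : T (lp.single 2 x 1) = (c x : ℂ) • lp.single 2 x 1 := by
    ext j
    rw [hT, lp.coeFn_smul, Pi.smul_apply, smul_eq_mul]
    by_cases hj : j = x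
    · subst hj; simp
    · simp [hj]
  have h2 := ContinuousLinearMap.adjoint_inner_right T (lp.single 2 x 1) f
  rw [h, inner_smul_left, lp.inner_single_left, lp.inner_single_left] at h2
  rw [hT]
  simpa [ContinuousLinearMap.star_eq_adjoint, mul_comm] using h2

theorem gen_zero_eq (q : Set.Ioo (0 : ℝ) 1) : gen (n := n) q 0 = shift n * genDiag q := by
  have h : star (gen (n := n) q 0) = genDiag q * star (shift n) := by
    refine ContinuousLinearMap.ext fun f => lp.ext (funext fun x => ?_)
    rw [star_gen_apply, mul_apply_eq_comp, isDiag_genDiag, star_shift_apply]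
  have := congrArg star h
  rwa [star_star, star_mul, star_star, (isDiag_genDiag q).star_eq] at this

/-- S*^m T only sees the entries of T beyond the m-th level, so its norm is at most their supremum.
-/
theorem IsDiag.mem_vanishing {T : Hilb n →L[ℂ] Hilb n} {c : ℤ × (Fin n → ℕ) → ℂ}
    (hT : IsDiag T c) {b : ℕ → ℝ} (hb : ∀ m x, ‖c ((stepIdx 0)^[m] x)‖ ≤ b m)
    (hb0 : Tendsto b atTop (𝓝 0)) : T ∈ vanishing (shift n) := by
  refine squeeze_zero_norm (fun m => ?_) hb0
  have hbm : 0 ≤ b m := (norm_nonneg _).trans (hb m 0)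
  refine ContinuousLinearMap.opNorm_le_bound _ hbm fun f => ?_
  have h1 : ‖(star (shift n) ^ m) f‖ ≤ ‖f‖ := by
    have h2 : ‖star (shift n) ^ m‖ ≤ 1 := by
      have := norm_star_pow_mul_le (star_shift_mul_shift (n := n)) m 1
      rw [mul_one] at this
      exact this.trans ContinuousLinearMap.norm_id_le
    simpa using ContinuousLinearMap.le_of_opNorm_le _ h2 f
  refine le_trans ?_ (mul_le_mul_of_nonneg_left h1 hbm)
  rw [← Real.norm_of_nonneg hbm, ← norm_smul]
  refine lp.norm_mono (by norm_num) fun i => ?_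
  rw [mul_apply_eq_comp, star_shift_pow_apply, hT]
  simp only [lp.coeFn_smul, Pi.smul_apply, norm_mul, norm_smul, Real.norm_of_nonneg hbm,
    star_shift_pow_apply]
  exact mul_le_mul_of_nonneg_right (hb m i) (norm_nonneg _)

/-- With t = q^(2(w_0 + 1)) ≤ q^m one has 1 - t ≤ √(1 - t) ≤ 1. If n = 0 the weight is the empty
product. -/
theorem abs_stepWeight_zero_sub_one_le (q : Set.Ioo (0 : ℝ) 1) {m : ℕ} {x : ℤ × (Fin n → ℕ)}
    (hx : ∀ l : Fin n, (l : ℕ) = 0 → m ≤ x.2 l) : |stepWeight q 0 x - 1| ≤ (q : ℝ) ^ m := by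
  have h0 := q.2.1
  have h1 := q.2.2
  obtain _ | n := n
  · simp [stepWeight]; positivity
  rw [stepWeight_zero_succ]
  set t := (q : ℝ) ^ (2 * (x.2 0 + 1)) with ht
  have ht0 : 0 ≤ t := by positivity
  have htm : t ≤ (q : ℝ) ^ m := pow_le_pow_of_le_one h0.le h1.le (by have := hx 0 rfl; omega)
  have ht1 : t ≤ 1 := pow_le_one₀ h0.le h1.le
  have h2 : √(1 - t) ≤ 1 := Real.sqrt_le_one.2 (by linarith)
  have h3 : 1 - t ≤ √(1 - t) := Real.le_sqrt_of_sq_le (by nlinarith)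
  rw [abs_le]
  constructor <;> linarith

theorem isDiag_genDiag_sub_one (q : Set.Ioo (0 : ℝ) 1) :
    IsDiag (genDiag (n := n) q - 1) fun x => ((stepWeight q 0 x - 1 : ℝ) : ℂ) := by
  convert! (isDiag_genDiag q).sub IsDiag.one using 1
  funext x
  simp

theorem genDiag_sub_one_mem_vanishing (q : Set.Ioo (0 : ℝ) 1) :
    genDiag (n := n) q - 1 ∈ vanishing (shift n) := by
  refine (isDiag_genDiag_sub_one q).mem_vanishing (b := fun m => (q : ℝ) ^ m) (fun m x => ?_)
    (tendsto_pow_atTop_nhds_zero_of_lt_one q.2.1.le q.2.2)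
  rw [Complex.norm_real, Real.norm_eq_abs]
  exact abs_stepWeight_zero_sub_one_le q (mem_range_iterate_stepIdx.1 ⟨x, rfl⟩)

/-- The difference is S (D - 1), where D is the diagonal factor of the generator; its entries
approach 1 geometrically in w_0. -/
theorem gen_zero_sub_shift_mem_ideal (q : Set.Ioo (0 : ℝ) 1) :
    gen (n := n) q 0 - shift n ∈ ideal (shift n) := by
  have h : gen (n := n) q 0 - shift n = shift n * (genDiag q - 1) := by
    rw [gen_zero_eq, mul_sub, mul_one]
  rw [h]
  have h1 := genDiag_sub_one_mem_vanishing (n := n) q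
  have h2 := (isDiag_genDiag_sub_one (n := n) q).star_eq
  exact mul_mem_ideal (self_mem_multipliers star_shift_mul_shift) ⟨h1, by rwa [h2]⟩

/-- The isometry `shift n` lies in the algebra of the sphere. -/
theorem shift_mem (q : Set.Ioo (0 : ℝ) 1) : shift n ∈ sphereAlgebra n q := by
  have h0 := q.2.1
  have h1 := q.2.2
  obtain _ | n := n
  · have : shift 0 = gen q 0 := by
      have h : genDiag (n := 0) q = 1 := by
        refine (isDiag_genDiag q).ext ?_
        convert! IsDiag.one using 1
      rw [gen_zero_eq, h, mul_one]
    rw [this]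
    exact gen_mem q 0
  have hps : ∀ x : ℤ × (Fin (n + 1) → ℕ), partialSum 1 x = x.2 0 := fun x => by
    simp [partialSum]
  have hpos : ∀ x : ℤ × (Fin (n + 1) → ℕ), stepWeight q 0 x ≠ 0 := fun x => by
    rw [stepWeight_zero_succ]
    have : (q : ℝ) ^ (2 * (x.2 0 + 1)) < 1 := pow_lt_one₀ h0.le h1 (by omega)
    exact (Real.sqrt_pos.2 (by linarith)).ne'
  -- C inverts the diagonal factor of the generator on the levels w_0 < M and is 1 above. The weight
  -- is constant on each level, so a new level costs a multiple of one diagonal projection of the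
  -- algebra; y is a sample point of that level.
  have key : ∀ M : ℕ, ∃ C ∈ sphereAlgebra (n + 1) q, IsDiag C
      (fun x => if x.2 0 < M then ((stepWeight q 0 x)⁻¹ : ℂ) else 1) := by
    intro M
    induction M with
    | zero => exact ⟨1, one_mem _, by simpa using! IsDiag.one⟩
    | succ M ih =>
      obtain ⟨C, hC, hd⟩ := ih
      let y : ℤ × (Fin (n + 1) → ℕ) := (0, fun _ => M)
      refine ⟨C + ((stepWeight q 0 y)⁻¹ - 1 : ℂ) •
        (diagProj {x | partialSum 1 x < M + 1} - diagProj {x | partialSum 1 x < M}),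
        add_mem hC (SMulMemClass.smul_mem _ (sub_mem (diagProj_partialSum_mem q 1 (by omega) _)
          (diagProj_partialSum_mem q 1 (by omega) _))), ?_⟩
      convert! hd.add (((IsDiag.diagProj {x | partialSum 1 x < M + 1}).sub
        (IsDiag.diagProj {x | partialSum 1 x < M})).smul ((stepWeight q 0 y)⁻¹ - 1 : ℂ)) using 1
      funext x
      simp only [Pi.add_apply, Pi.smul_apply, Pi.sub_apply, Set.indicator, Set.mem_ofPred_eq, hps,
        Pi.one_apply, smul_eq_mul]
      rcases lt_trichotomy (x.2 0) M with h | h | h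
      · simp [h, show x.2 0 < M + 1 by omega]
      · have : stepWeight q 0 y = stepWeight q 0 x := by
          rw [stepWeight_zero_succ, stepWeight_zero_succ, h]
        simp [h, this]
      · simp [show ¬ x.2 0 < M + 1 by omega, show ¬ x.2 0 < M by omega]
  choose C hC hd using key
  refine (sphereAlgebra_isClosed (n + 1) q).mem_of_tendsto (f := fun M => gen q 0 * C M)
    (b := atTop) ?_ (Eventually.of_forall fun M => mul_mem (gen_mem q 0) (hC M))
  rw [tendsto_iff_norm_sub_tendsto_zero]
  refine squeeze_zero (fun _ => norm_nonneg _) (fun M => ?_)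
    (tendsto_pow_atTop_nhds_zero_of_lt_one h0.le h1)
  -- The error is S (D C - 1): its diagonal part vanishes below level M and is at most q^M above.
  have e : gen q 0 * C M - shift (n + 1) = shift (n + 1) ^ 1 * (genDiag q * C M - 1) := by
    rw [gen_zero_eq, pow_one, mul_sub, mul_one, mul_assoc]
  rw [e]
  refine (norm_pow_mul_le star_shift_mul_shift 1 _).trans ?_
  refine (((isDiag_genDiag q).mul (hd M)).sub IsDiag.one).norm_le (by positivity) fun x => ?_
  simp only [Pi.sub_apply, Pi.mul_apply, Pi.one_apply]
  split_ifs with h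
  · have : (stepWeight q 0 x : ℂ) ≠ 0 := by exact_mod_cast hpos x
    rw [mul_inv_cancel₀ this, sub_self, norm_zero]
    positivity
  · rw [mul_one, ← Complex.ofReal_one, ← Complex.ofReal_sub, Complex.norm_real, Real.norm_eq_abs]
    refine abs_stepWeight_zero_sub_one_le q fun l hl => ?_
    obtain rfl : l = 0 := Fin.ext hl
    omega

theorem gen_mem_laurent (q : Set.Ioo (0 : ℝ) 1) (i : Fin (n + 1)) :
    gen q i ∈ laurent (shift n) (sphereAlgebra n q) := by
  by_cases hi : i = 0
  · subst hi
    rw [← add_sub_cancel (shift n) (gen q 0)]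
    refine add_mem ?_ (mem_laurent_of_mem_ideal (gen_zero_sub_shift_mem_ideal q)
      (sub_mem (gen_mem q 0) (shift_mem q)))
    simpa [zpow] using zpow_mem_laurent (S := shift n) (A := sphereAlgebra n q) (Int.ofNat 1)
  · exact mem_laurent_of_mem_ideal (gen_mem_ideal q hi) (gen_mem q i)

theorem mem_closure_laurent (q : Set.Ioo (0 : ℝ) 1) {a : Hilb n →L[ℂ] Hilb n}
    (ha : a ∈ sphereAlgebra n q) :
    a ∈ closure (laurent (shift n) (sphereAlgebra n q) : Set (Hilb n →L[ℂ] Hilb n)) :=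
  closure_mono (adjoin_le_laurent star_shift_mul_shift (shift_mem q)
    (Set.range_subset_iff.2 (gen_mem_laurent q))) ha

theorem sphereAlgebra_le {T : StarSubalgebra ℂ (Hilb n →L[ℂ] Hilb n)} {q : Set.Ioo (0 : ℝ) 1}
    (hT : IsClosed (T : Set (Hilb n →L[ℂ] Hilb n))) (h : ∀ i, gen q i ∈ T) :
    sphereAlgebra n q ≤ T :=
  StarSubalgebra.topologicalClosure_minimal
    (StarAlgebra.adjoin_le (Set.range_subset_iff.2 h)) hT

/-- Each generator is S plus an element of the ideal, or lies in the ideal; both kinds of summand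
are multipliers. This makes the ideal of S, cut down to the algebra, a two-sided ideal. -/
theorem sphereAlgebra_le_multipliers (q : Set.Ioo (0 : ℝ) 1) :
    sphereAlgebra n q ≤ multipliers (shift n) := by
  refine sphereAlgebra_le (isClosed_multipliers star_shift_mul_shift) fun i => ?_
  by_cases hi : i = 0
  · subst hi
    rw [← add_sub_cancel (shift n) (gen q 0)]
    exact add_mem (self_mem_multipliers star_shift_mul_shift)
      (mem_multipliers_of_mem_ideal (gen_zero_sub_shift_mem_ideal q))
  · exact mem_multipliers_of_mem_ideal (gen_mem_ideal q hi)

end QuantumSphere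

/-! ### Characters from approximate eigenvectors -/

section Approximate

variable {H : Type*} [NormedAddCommGroup H] [InnerProductSpace ℂ H]
  {X : Type*} [TopologicalSpace X] (ξ : ℕ → X → H)

/-- The vectors `ξ m s` are, uniformly in `s`, approximate eigenvectors of `a` with eigenvalues
`c s`. -/
def IsApproxEigen (a : H →L[ℂ] H) (c : C(X, ℂ)) : Prop :=
  ∀ ε > 0, ∀ᶠ m in atTop, ∀ s, ‖a (ξ m s) - c s • ξ m s‖ ≤ ε

namespace IsApproxEigen

variable {ξ} {a b : H →L[ℂ] H} {c d : C(X, ℂ)}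

theorem add (ha : IsApproxEigen ξ a c) (hb : IsApproxEigen ξ b d) :
    IsApproxEigen ξ (a + b) (c + d) := fun ε hε => by
  filter_upwards [ha (ε / 2) (half_pos hε), hb (ε / 2) (half_pos hε)] with m h1 h2 s
  have e : (a + b) (ξ m s) - (c + d) s • ξ m s =
      (a (ξ m s) - c s • ξ m s) + (b (ξ m s) - d s • ξ m s) := by
    simp only [ContinuousMap.add_apply, add_smul, add_apply]
    abel
  rw [e]
  have := norm_add_le (a (ξ m s) - c s • ξ m s) (b (ξ m s) - d s • ξ m s)
  have := h1 s
  have := h2 s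
  linarith

theorem algebraMap (z : ℂ) :
    IsApproxEigen ξ (algebraMap ℂ (H →L[ℂ] H) z) (algebraMap ℂ C(X, ℂ) z) := fun ε hε => by
  refine Eventually.of_forall fun m s => ?_
  simp [Algebra.algebraMap_eq_smul_one, hε.le]

variable [CompactSpace X]

/-- Evaluating on the unit vectors ξ m s bounds the difference of the eigenvalues by the norm of the
difference of the operators. Uniqueness of the symbol and its extension to closures follow. -/
theorem norm_symbol_sub_le (hξ : ∀ m s, ‖ξ m s‖ = 1) (ha : IsApproxEigen ξ a c)
    (hb : IsApproxEigen ξ b d) : ‖c - d‖ ≤ ‖a - b‖ := by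
  refine (ContinuousMap.norm_le _ (norm_nonneg _)).2 fun s => ?_
  refine le_of_forall_pos_le_add fun ε hε => ?_
  obtain ⟨m, h1, h2⟩ := ((ha (ε / 2) (half_pos hε)).and (hb (ε / 2) (half_pos hε))).exists
  have e : (c - d) s • ξ m s = (a - b) (ξ m s) - (a (ξ m s) - c s • ξ m s) +
      (b (ξ m s) - d s • ξ m s) := by
    simp only [ContinuousMap.sub_apply, sub_smul, sub_apply]
    abel
  have h3 : ‖(c - d) s‖ = ‖(c - d) s • ξ m s‖ := by rw [norm_smul, hξ, mul_one]
  have h4 : ‖(a - b) (ξ m s)‖ ≤ ‖a - b‖ := by simpa [hξ] using (a - b).le_opNorm (ξ m s)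
  rw [h3, e]
  have h5 := norm_add_le ((a - b) (ξ m s) - (a (ξ m s) - c s • ξ m s)) (b (ξ m s) - d s • ξ m s)
  have h6 := norm_sub_le ((a - b) (ξ m s)) (a (ξ m s) - c s • ξ m s)
  have := h1 s
  have := h2 s
  linarith

theorem unique (hξ : ∀ m s, ‖ξ m s‖ = 1) (hc : IsApproxEigen ξ a c)
    (hd : IsApproxEigen ξ a d) : c = d := by
  have := norm_symbol_sub_le hξ hc hd
  rw [sub_self, norm_zero] at this
  exact sub_eq_zero.1 (norm_le_zero_iff.1 this)

theorem mul (ha : IsApproxEigen ξ a c) (hb : IsApproxEigen ξ b d) :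
    IsApproxEigen ξ (a * b) (c * d) := fun ε hε => by
  have hK : 0 < ‖a‖ + ‖d‖ + 1 := by positivity
  filter_upwards [ha (ε / (‖a‖ + ‖d‖ + 1)) (by positivity),
    hb (ε / (‖a‖ + ‖d‖ + 1)) (by positivity)] with m h1 h2 s
  have e : (a * b) (ξ m s) - (c * d) s • ξ m s =
      a (b (ξ m s) - d s • ξ m s) + d s • (a (ξ m s) - c s • ξ m s) := by
    simp only [ContinuousMap.mul_apply, mul_apply_eq_comp, map_sub, map_smul, smul_sub, smul_smul,
      mul_comm (d s)]
    abel
  rw [e]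
  have h3 : ‖a (b (ξ m s) - d s • ξ m s)‖ ≤ ‖a‖ * (ε / (‖a‖ + ‖d‖ + 1)) :=
    (a.le_opNorm _).trans (mul_le_mul_of_nonneg_left (h2 s) (norm_nonneg _))
  have h4 : ‖d s • (a (ξ m s) - c s • ξ m s)‖ ≤ ‖d‖ * (ε / (‖a‖ + ‖d‖ + 1)) := by
    rw [norm_smul]
    exact mul_le_mul (d.norm_coe_le_norm s) (h1 s) (norm_nonneg _) (norm_nonneg _)
  calc _ ≤ ‖a‖ * (ε / (‖a‖ + ‖d‖ + 1)) + ‖d‖ * (ε / (‖a‖ + ‖d‖ + 1)) :=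
        (norm_add_le _ _).trans (add_le_add h3 h4)
    _ ≤ (‖a‖ + ‖d‖ + 1) * (ε / (‖a‖ + ‖d‖ + 1)) := by
        have : 0 < ε / (‖a‖ + ‖d‖ + 1) := by positivity
        nlinarith
    _ = ε := mul_div_cancel₀ _ hK.ne'

/-- The symbols of an approximating sequence are Cauchy by `norm_symbol_sub_le`; their limit is the
symbol of a by an ε/3 argument. -/
theorem exists_of_mem_closure (hξ : ∀ m s, ‖ξ m s‖ = 1) {T : Set (H →L[ℂ] H)}
    {f : T → C(X, ℂ)} (hf : ∀ a : T, IsApproxEigen ξ a (f a)) (ha : a ∈ closure T) :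
    ∃ c, IsApproxEigen ξ a c := by
  obtain ⟨u, hu, hua⟩ := mem_closure_iff_seq_limit.1 ha
  have hcauchy : CauchySeq fun k => f ⟨u k, hu k⟩ := by
    refine Metric.cauchySeq_iff.2 fun ε hε => ?_
    obtain ⟨N, hN⟩ := Metric.cauchySeq_iff.1 hua.cauchySeq ε hε
    refine ⟨N, fun k hk l hl => lt_of_le_of_lt ?_ (hN k hk l hl)⟩
    rw [dist_eq_norm, dist_eq_norm]
    exact norm_symbol_sub_le hξ (hf ⟨u k, hu k⟩) (hf ⟨u l, hu l⟩)
  obtain ⟨c, hc⟩ := cauchySeq_tendsto_of_complete hcauchy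
  refine ⟨c, fun ε hε => ?_⟩
  have h1 := (Metric.tendsto_nhds.1 hua) (ε / 3) (by positivity)
  have h2 := (Metric.tendsto_nhds.1 hc) (ε / 3) (by positivity)
  obtain ⟨k, hk1, hk2⟩ := (h1.and h2).exists
  rw [dist_comm, dist_eq_norm] at hk1
  rw [dist_eq_norm] at hk2
  filter_upwards [hf ⟨u k, hu k⟩ (ε / 3) (by positivity)] with m hm s
  have e : a (ξ m s) - c s • ξ m s = (a - u k) (ξ m s) +
      (u k (ξ m s) - f ⟨u k, hu k⟩ s • ξ m s) + (f ⟨u k, hu k⟩ - c) s • ξ m s := by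
    simp only [ContinuousMap.sub_apply, sub_smul, sub_apply]
    abel
  have h4 : ‖(a - u k) (ξ m s)‖ ≤ ‖a - u k‖ := by simpa [hξ] using (a - u k).le_opNorm (ξ m s)
  have h5 : ‖(f ⟨u k, hu k⟩ - c) s • ξ m s‖ ≤ ‖f ⟨u k, hu k⟩ - c‖ := by
    rw [norm_smul, hξ, mul_one]
    exact ContinuousMap.norm_coe_le_norm _ s
  have h6 := hm s
  rw [e]
  refine (norm_add₃_le ..).trans ?_
  change ‖u k (ξ m s) - f ⟨u k, hu k⟩ s • ξ m s‖ ≤ ε / 3 at h6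
  linarith

end IsApproxEigen

variable [CompactSpace X] [CompleteSpace H]

/-- The *-algebra of operators for which the `ξ m s` are approximate eigenvectors. -/
def approxEigenAlgebra : StarSubalgebra ℂ (H →L[ℂ] H) where
  carrier := {a | ∃ c, IsApproxEigen ξ a c ∧ IsApproxEigen ξ (star a) (star c)}
  mul_mem' := by
    rintro a b ⟨c, hc, hc'⟩ ⟨d, hd, hd'⟩
    exact ⟨c * d, hc.mul hd, by rw [star_mul, star_mul]; exact hd'.mul hc'⟩
  add_mem' := by
    rintro a b ⟨c, hc, hc'⟩ ⟨d, hd, hd'⟩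
    exact ⟨c + d, hc.add hd, by rw [star_add, star_add]; exact hc'.add hd'⟩
  algebraMap_mem' z := ⟨_, .algebraMap z, by
    rw [← algebraMap_star_comm, ← algebraMap_star_comm]; exact .algebraMap _⟩
  star_mem' := by
    rintro a ⟨c, hc, hc'⟩
    exact ⟨star c, hc', by rwa [star_star, star_star]⟩

variable {ξ}

theorem isClosed_approxEigenAlgebra (hξ : ∀ m s, ‖ξ m s‖ = 1) :
    IsClosed (approxEigenAlgebra ξ : Set (H →L[ℂ] H)) := by
  refine isClosed_of_closure_subset fun a ha => ?_
  have ha' : star a ∈ closure (approxEigenAlgebra ξ : Set (H →L[ℂ] H)) :=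
    map_mem_closure continuous_star ha fun b hb => star_mem hb
  choose f hf _ using fun a : (approxEigenAlgebra ξ : Set (H →L[ℂ] H)) => a.2
  obtain ⟨c, hc⟩ := IsApproxEigen.exists_of_mem_closure hξ hf ha
  obtain ⟨d, hd⟩ := IsApproxEigen.exists_of_mem_closure hξ hf ha'
  -- The limits for a and for its adjoint arise independently. They are conjugate because ⟨a ξ, ξ⟩ =
  -- ⟨ξ, a* ξ⟩ at every unit vector ξ.
  have hcd : d = star c := by
    refine ContinuousMap.ext fun s => ?_
    have key : ∀ ε > 0, ‖d s - star (c s)‖ ≤ ε := fun ε hε => by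
      obtain ⟨m, h1, h2⟩ := ((hc (ε / 2) (half_pos hε)).and (hd (ε / 2) (half_pos hε))).exists
      have e1 : inner ℂ (ξ m s) (ξ m s) = (1 : ℂ) := by
        rw [inner_self_eq_norm_sq_to_K, hξ]; simp
      have e2 : d s - star (c s) = inner ℂ (a (ξ m s) - c s • ξ m s) (ξ m s) -
          inner ℂ (ξ m s) (star a (ξ m s) - d s • ξ m s) := by
        rw [inner_sub_left, inner_sub_right, inner_smul_left, inner_smul_right, e1,
          ContinuousLinearMap.star_eq_adjoint, ContinuousLinearMap.adjoint_inner_right]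
        simp
      have e3 := norm_inner_le_norm (𝕜 := ℂ) (a (ξ m s) - c s • ξ m s) (ξ m s)
      have e4 := norm_inner_le_norm (𝕜 := ℂ) (ξ m s) (star a (ξ m s) - d s • ξ m s)
      rw [hξ] at e3 e4
      rw [e2]
      refine (norm_sub_le _ _).trans ?_
      have := h1 s
      have := h2 s
      linarith
    have := le_of_forall_pos_le_add (a := ‖d s - star (c s)‖) (b := 0)
      fun ε hε => by simpa using key ε hε
    exact sub_eq_zero.1 (norm_le_zero_iff.1 this)
  exact ⟨c, hc, hcd ▸ hd⟩

/-- The homomorphism which sends an operator to its approximate eigenvalues. -/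
noncomputable def approxEigenHom (hξ : ∀ m s, ‖ξ m s‖ = 1) :
    approxEigenAlgebra ξ →⋆ₐ[ℂ] C(X, ℂ) where
  toFun a := a.2.choose
  map_one' := IsApproxEigen.unique hξ (Exists.choose_spec (p := fun c => IsApproxEigen ξ _ c ∧ _) _).1
    (by simpa using IsApproxEigen.algebraMap (ξ := ξ) 1)
  map_mul' a b := IsApproxEigen.unique hξ (Subtype.prop (a * b)).choose_spec.1
    (a.2.choose_spec.1.mul b.2.choose_spec.1)
  map_zero' := IsApproxEigen.unique hξ (Exists.choose_spec (p := fun c => IsApproxEigen ξ _ c ∧ _) _).1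
    (by simpa using IsApproxEigen.algebraMap (ξ := ξ) 0)
  map_add' a b := IsApproxEigen.unique hξ (Subtype.prop (a + b)).choose_spec.1
    (a.2.choose_spec.1.add b.2.choose_spec.1)
  commutes' z := IsApproxEigen.unique hξ
    (Subtype.prop (algebraMap ℂ (approxEigenAlgebra ξ) z)).choose_spec.1 (.algebraMap z)
  map_star' a := IsApproxEigen.unique hξ (Subtype.prop (star a)).choose_spec.1 a.2.choose_spec.2

theorem approxEigenHom_eq (hξ : ∀ m s, ‖ξ m s‖ = 1) {a : approxEigenAlgebra ξ} {c : C(X, ℂ)}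
    (h : IsApproxEigen ξ a.1 c) : approxEigenHom hξ a = c :=
  IsApproxEigen.unique hξ a.2.choose_spec.1 h

end Approximate

/-! ### Automatic continuity on closed *-subalgebras -/

namespace StarAlgHom

variable {B : Type*} [CStarAlgebra B] {X : Type*} [TopologicalSpace X] [CompactSpace X]
  {A : StarSubalgebra ℂ B}

theorem norm_apply_le_of_isClosed (hA : IsClosed (A : Set B)) (φ : A →⋆ₐ[ℂ] C(X, ℂ)) (a : A) : ‖φ a‖ ≤ ‖(a : B)‖ := by
  let : CStarAlgebra A := StarSubalgebra.cstarAlgebra A (h_closed := hA)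
  exact NonUnitalStarAlgHom.norm_apply_le φ a

theorem surjective_of_isClosed (hA : IsClosed (A : Set B)) (φ : A →⋆ₐ[ℂ] C(X, ℂ))
    (hφ : φ.range.SeparatesPoints) : Function.Surjective φ := by
  let : CStarAlgebra A := StarSubalgebra.cstarAlgebra A (h_closed := hA)
  exact surjective_of_separatesPoints φ hφ

/-- A *-homomorphism on a C*-algebra is contractive, hence determined by its values on the dense
*-subalgebra, hence on generators. -/
theorem ext_of_eqOn_adjoin {s : Set B}
    (φ ψ : (StarAlgebra.adjoin ℂ s).topologicalClosure →⋆ₐ[ℂ] C(X, ℂ))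
    (h : ∀ x ∈ s, ∀ hx, φ ⟨x, hx⟩ = ψ ⟨x, hx⟩) : φ = ψ := by
  have hcont : ∀ φ : (StarAlgebra.adjoin ℂ s).topologicalClosure →⋆ₐ[ℂ] C(X, ℂ),
      Continuous φ := fun φ =>
    AddMonoidHomClass.continuous_of_bound φ 1 fun a => by
      rw [one_mul]
      exact norm_apply_le_of_isClosed (StarSubalgebra.isClosed_topologicalClosure _) φ a
  refine StarAlgHom.ext_topologicalClosure (hcont φ) (hcont ψ) ?_
  refine StarAlgHom.ext_adjoin ?_
  rintro ⟨x, hx⟩ hxs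
  exact h x hxs _

end StarAlgHom

namespace IsometryIdeal

theorem norm_mul_pow_eq {B : Type*} [CStarAlgebra B] {S : B} (m : ℕ) (a : B) :
    ‖a * S ^ m‖ = ‖star S ^ m * star a‖ := by
  rw [← star_pow, ← star_mul, norm_star]

end IsometryIdeal

/-! ### Construction of the symbol map -/

namespace QuantumSphere

open IsometryIdeal

variable {n : ℕ}

theorem norm_star_shift_pow_le (m : ℕ) : ‖star (shift n) ^ m‖ ≤ 1 := by
  have := norm_star_pow_mul_le (star_shift_mul_shift (n := n)) m 1
  rw [mul_one] at this
  exact this.trans ContinuousLinearMap.norm_id_le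

theorem shift_single (x : ℤ × (Fin n → ℕ)) :
    shift n (lp.single 2 x 1) = lp.single 2 (stepIdx 0 x) 1 := by
  refine lp.ext (funext fun y => ?_)
  by_cases h : y ∈ Set.range (stepIdx (n := n) 0)
  · obtain ⟨z, rfl⟩ := h
    rw [shift_apply_stepIdx]
    by_cases hz : z = x
    · subst hz; simp
    · have : stepIdx 0 z ≠ stepIdx 0 x := fun h => hz (stepIdx_injective 0 h)
      simp [hz, this]
  · rw [shift_apply_of_notMem _ h]
    have : y ≠ stepIdx 0 x := fun h' => h ⟨x, h'.symm⟩
    simp [this]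

theorem shift_pow_single (m : ℕ) (x : ℤ × (Fin n → ℕ)) :
    (shift n ^ m) (lp.single 2 x 1) = lp.single 2 ((stepIdx 0)^[m] x) 1 := by
  induction m with
  | zero => rfl
  | succ m ih =>
    rw [pow_succ', mul_apply_eq_comp, ih, shift_single, Function.iterate_succ_apply']

theorem orthonormal_single {ι : Type} [DecidableEq ι] :
    Orthonormal ℂ fun i : ι => (lp.single 2 i 1 : lp (fun _ : ι => ℂ) 2) := by
  rw [orthonormal_iff_ite]
  intro i j
  rw [lp.inner_single_left]
  by_cases h : i = j
  · subst h; simp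
  · simp [h]

/-- The unit vectors `m^{-1/2} ∑_{k < m} s^{-k} S^{m+k} e_0` (with `m + 1` for `m`), approximate
eigenvectors of the shift. -/
noncomputable def approxVec (n : ℕ) (m : ℕ) (s : Circle) : Hilb n :=
  ((√(m + 1 : ℝ))⁻¹ : ℂ) • ∑ k ∈ Finset.range (m + 1),
    (star (s : ℂ)) ^ k • (shift n ^ (k + m)) (lp.single 2 0 1)

/-- The vectors S^(m+k) e_0 are distinct basis vectors, and the m + 1 coefficients have modulus one.
-/
theorem norm_approxVec (m : ℕ) (s : Circle) : ‖approxVec n m s‖ = 1 := by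
  have hinj : Function.Injective fun k : ℕ => (stepIdx (n := n) 0)^[k + m] 0 := fun k l h => by
    simp only [iterate_stepIdx, Prod.mk.injEq] at h
    have := h.1
    push_cast at this
    omega
  have ho := (orthonormal_single (ι := ℤ × (Fin n → ℕ))).comp _ hinj
  have h1 := ho.inner_sum (fun k => star (s : ℂ) ^ k) (fun k => star (s : ℂ) ^ k)
    (Finset.range (m + 1))
  have h2 : ∀ k : ℕ, starRingEnd ℂ (star (s : ℂ) ^ k) * star (s : ℂ) ^ k = 1 := fun k => by
    rw [map_pow, ← mul_pow, ← starRingEnd_apply, Complex.conj_conj, Complex.mul_conj]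
    simp
  simp only [h2, Function.comp_def, inner_self_eq_norm_sq_to_K, Finset.sum_const,
    Finset.card_range, nsmul_eq_mul, mul_one] at h1
  have h3 : ‖∑ k ∈ Finset.range (m + 1),
      (star (s : ℂ)) ^ k • (shift n ^ (k + m)) (lp.single 2 0 1)‖ = √(m + 1 : ℝ) := by
    simp only [shift_pow_single]
    refine (Real.sqrt_eq_iff_eq_sq (by positivity) (norm_nonneg _)).2 ?_ |>.symm
    refine Complex.ofReal_injective ?_
    rw [Complex.ofReal_pow]
    refine Eq.trans ?_ h1.symm
    push_cast
    rfl
  have h4 : 0 < √(m + 1 : ℝ) := by positivity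
  rw [approxVec, norm_smul, h3, norm_inv, Complex.norm_real, Real.norm_of_nonneg h4.le,
    inv_mul_cancel₀ h4.ne']

/-- The exponents start at m so that the vector lies in the range of S^m: then a moves it by at most
‖a S^m‖ = ‖S*^m a*‖. -/
theorem approxVec_eq (m : ℕ) (s : Circle) : ∃ v : Hilb n, ‖v‖ ≤ 1 ∧
    approxVec n m s = (shift n ^ m) v := by
  have h : approxVec n m s = (shift n ^ m) (((√(m + 1 : ℝ))⁻¹ : ℂ) •
      ∑ k ∈ Finset.range (m + 1), (star (s : ℂ)) ^ k • (shift n ^ k) (lp.single 2 0 1)) := by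
    rw [approxVec, map_smul, map_sum]
    congr 1
    refine Finset.sum_congr rfl fun k _ => ?_
    rw [map_smul, add_comm, pow_add, mul_apply_eq_comp]
  refine ⟨_, ?_, h⟩
  generalize ((√(m + 1 : ℝ))⁻¹ : ℂ) • ∑ k ∈ Finset.range (m + 1),
    (star (s : ℂ)) ^ k • (shift n ^ k) (lp.single 2 0 1) = v at h
  have h1 : v = (star (shift n) ^ m) (approxVec n m s) := by
    rw [h, ← mul_apply_eq_comp, star_pow_mul_pow star_shift_mul_shift]; rfl
  rw [h1]
  simpa [norm_approxVec] using ContinuousLinearMap.le_of_opNorm_le _ (norm_star_shift_pow_le m)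
    (approxVec n m s)

/-- The identity function of the circle. -/
def circleId : C(Circle, ℂ) := ⟨fun s => s, continuous_subtype_val⟩

theorem norm_shift_approxVec_sub_le (m : ℕ) (s : Circle) :
    ‖shift n (approxVec n m s) - (s : ℂ) • approxVec n m s‖ ≤ 2 * (√(m + 1 : ℝ))⁻¹ := by
  rw [approxVec]
  have hs : (s : ℂ) * star (s : ℂ) = 1 := by
    rw [← starRingEnd_apply, Complex.mul_conj]; simp
  have hs' : ‖(s : ℂ)‖ = 1 := s.norm_coe
  generalize (s : ℂ) = z at *
  set v : ℕ → Hilb n := fun k =>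
    (z * star z ^ k) • (shift n ^ (k + m)) (lp.single 2 0 1) with hv
  -- The sum telescopes. Only two terms of norm one survive, against the normalisation √(m + 1).
  have h0 : ∀ k, shift n (star z ^ k • (shift n ^ (k + m)) (lp.single 2 0 1)) -
      z • (star z ^ k • (shift n ^ (k + m)) (lp.single 2 0 1)) = v (k + 1) - v k := fun k => by
    have e1 : z * star z ^ (k + 1) = star z ^ k := by rw [pow_succ', ← mul_assoc, hs, one_mul]
    have e2 : k + 1 + m = (k + m) + 1 := by omega
    simp only [hv, e1, e2]
    rw [map_smul, pow_succ', mul_apply_eq_comp, smul_smul]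
  have h1 : shift n (((√(m + 1 : ℝ))⁻¹ : ℂ) • ∑ k ∈ Finset.range (m + 1),
      star z ^ k • (shift n ^ (k + m)) (lp.single 2 0 1)) -
      z • (((√(m + 1 : ℝ))⁻¹ : ℂ) • ∑ k ∈ Finset.range (m + 1),
      star z ^ k • (shift n ^ (k + m)) (lp.single 2 0 1)) =
      ((√(m + 1 : ℝ))⁻¹ : ℂ) • (v (m + 1) - v 0) := by
    rw [← Finset.sum_range_sub v, map_smul, map_sum, smul_comm z, ← smul_sub,
      Finset.smul_sum, ← Finset.sum_sub_distrib]
    congr 1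
    exact Finset.sum_congr rfl fun k _ => h0 k
  have h2 : ∀ k, ‖v k‖ = 1 := fun k => by
    simp only [hv, norm_smul, norm_mul, norm_pow, norm_star, shift_pow_single, hs']
    simp [lp.norm_single]
  have h4 : 0 < √(m + 1 : ℝ) := by positivity
  rw [h1, norm_smul, norm_inv, Complex.norm_real, Real.norm_of_nonneg h4.le, mul_comm]
  refine mul_le_mul_of_nonneg_right ((norm_sub_le _ _).trans ?_) (by positivity)
  rw [h2, h2]
  norm_num

theorem tendsto_two_mul_inv_sqrt :
    Tendsto (fun m : ℕ => 2 * (√(m + 1 : ℝ))⁻¹) atTop (𝓝 0) := by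
  have h : Tendsto (fun m : ℕ => √(m + 1 : ℝ)) atTop atTop :=
    Real.tendsto_sqrt_atTop.comp (tendsto_atTop_add_const_right _ _ tendsto_natCast_atTop_atTop)
  simpa using h.inv_tendsto_atTop.const_mul 2

theorem isApproxEigen_shift : IsApproxEigen (approxVec n) (shift n) circleId := fun ε hε => by
  filter_upwards [(tendsto_two_mul_inv_sqrt).eventually_le_const hε] with m hm s
  exact (norm_shift_approxVec_sub_le m s).trans hm

/-- Applying S* to the relation S ξ ≈ s ξ and multiplying by the conjugate of s gives it, as S* S =
1 and |s| = 1. -/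
theorem isApproxEigen_star_shift :
    IsApproxEigen (approxVec n) (star (shift n)) (star circleId) := fun ε hε => by
  filter_upwards [isApproxEigen_shift (n := n) ε hε] with m hm s
  have hs : star (s : ℂ) * (s : ℂ) = 1 := by
    rw [← starRingEnd_apply, mul_comm, Complex.mul_conj]; simp
  have h1 : star (shift n) (shift n (approxVec n m s)) = approxVec n m s := by
    rw [← mul_apply_eq_comp, star_shift_mul_shift]; rfl
  have e : star (shift n) (approxVec n m s) - (star circleId : C(Circle, ℂ)) s • approxVec n m s =
      -(star (s : ℂ) • star (shift n) (shift n (approxVec n m s) - (s : ℂ) • approxVec n m s)) := by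
    rw [map_sub, map_smul, h1, smul_sub, smul_smul, hs, one_smul, neg_sub]
    rfl
  rw [e, norm_neg, norm_smul, norm_star, Circle.norm_coe, one_mul]
  have h2 : ‖star (shift n)‖ ≤ 1 := by
    simpa using norm_star_shift_pow_le (n := n) 1
  refine (ContinuousLinearMap.le_of_opNorm_le _ h2 _).trans ?_
  rw [one_mul]
  exact hm s

theorem isApproxEigen_of_star_mem_vanishing {a : Hilb n →L[ℂ] Hilb n}
    (ha : star a ∈ vanishing (shift n)) : IsApproxEigen (approxVec n) a 0 := fun ε hε => by
  have h : Tendsto (fun m : ℕ => ‖star (shift n) ^ m * star a‖) atTop (𝓝 0) := by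
    simpa using ha.norm
  filter_upwards [h.eventually_le_const hε] with m hm s
  obtain ⟨v, hv, hv'⟩ := approxVec_eq (n := n) m s
  rw [← norm_mul_pow_eq] at hm
  have := ContinuousLinearMap.le_of_opNorm_le _ hm v
  rw [mul_apply_eq_comp, ← hv'] at this
  simpa using this.trans (mul_le_of_le_one_right hε.le hv)

theorem isApproxEigen_gen_zero (q : Set.Ioo (0 : ℝ) 1) :
    IsApproxEigen (approxVec n) (gen q 0) circleId ∧
      IsApproxEigen (approxVec n) (star (gen q 0)) (star circleId) := by
  have h := gen_zero_sub_shift_mem_ideal (n := n) q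
  have h1 := isApproxEigen_shift.add (isApproxEigen_of_star_mem_vanishing h.2)
  have h2 := isApproxEigen_star_shift.add
    (isApproxEigen_of_star_mem_vanishing (star_mem_ideal h).2)
  rw [add_zero, add_sub_cancel] at h1
  rw [star_sub, add_zero, add_sub_cancel] at h2
  exact ⟨h1, h2⟩

theorem sphereAlgebra_le_approxEigenAlgebra (q : Set.Ioo (0 : ℝ) 1) :
    sphereAlgebra n q ≤ approxEigenAlgebra (approxVec n) := by
  refine sphereAlgebra_le (isClosed_approxEigenAlgebra norm_approxVec) fun i => ?_
  by_cases hi : i = 0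
  · subst hi
    exact ⟨_, isApproxEigen_gen_zero q⟩
  · have h := gen_mem_ideal q hi
    exact ⟨0, isApproxEigen_of_star_mem_vanishing h.2, by
      rw [star_zero]; exact isApproxEigen_of_star_mem_vanishing (star_mem_ideal h).2⟩

/-- The quotient map `η : C(S_q^{2n+1}) → C(𝕋)`. -/
noncomputable def symbol (n : ℕ) (q : Set.Ioo (0 : ℝ) 1) :
    sphereAlgebra n q →⋆ₐ[ℂ] C(Circle, ℂ) :=
  (approxEigenHom norm_approxVec).comp
    (StarSubalgebra.inclusion (sphereAlgebra_le_approxEigenAlgebra q))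

theorem symbol_eq {q : Set.Ioo (0 : ℝ) 1} {a : sphereAlgebra n q} {c : C(Circle, ℂ)}
    (h : IsApproxEigen (approxVec n) a.1 c) : symbol n q a = c :=
  approxEigenHom_eq norm_approxVec h

theorem symbol_gen_zero (q : Set.Ioo (0 : ℝ) 1) :
    symbol n q ⟨gen q 0, gen_mem q 0⟩ = circleId :=
  symbol_eq (a := ⟨gen q 0, gen_mem q 0⟩) (isApproxEigen_gen_zero q).1

theorem symbol_shift (q : Set.Ioo (0 : ℝ) 1) :
    symbol n q ⟨shift n, shift_mem q⟩ = circleId :=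
  symbol_eq (a := ⟨shift n, shift_mem q⟩) isApproxEigen_shift

theorem symbol_eq_zero {q : Set.Ioo (0 : ℝ) 1} {a : sphereAlgebra n q}
    (ha : a.1 ∈ ideal (shift n)) : symbol n q a = 0 :=
  symbol_eq (isApproxEigen_of_star_mem_vanishing ha.2)

theorem isSymbolMap_symbol (q : Set.Ioo (0 : ℝ) 1) : IsSymbolMap (symbol n q) := by
  refine ⟨fun s => ?_, fun i hi => symbol_eq_zero (a := ⟨gen q i, gen_mem q i⟩) (gen_mem_ideal q hi)⟩
  rw [symbol_gen_zero]
  rfl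

theorem IsSymbolMap.eq {q : Set.Ioo (0 : ℝ) 1} {η η' : sphereAlgebra n q →⋆ₐ[ℂ] C(Circle, ℂ)}
    (h : IsSymbolMap η) (h' : IsSymbolMap η') : η = η' := by
  refine StarAlgHom.ext_of_eqOn_adjoin (s := Set.range (gen q)) η η' ?_
  rintro _ ⟨i, rfl⟩ hx
  by_cases hi : i = 0
  · subst hi
    refine ContinuousMap.ext fun s => ?_
    exact (h.1 s).trans (h'.1 s).symm
  · exact (h.2 i hi).trans (h'.2 i hi).symm

theorem existsUnique_isSymbolMap (n : ℕ) (q : Set.Ioo (0 : ℝ) 1) :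
    ∃! η : sphereAlgebra n q →⋆ₐ[ℂ] C(Circle, ℂ), IsSymbolMap η :=
  ⟨symbol n q, isSymbolMap_symbol q, fun _ h => h.eq (isSymbolMap_symbol q)⟩

/-- The range contains the identity function of the circle, which separates points. -/
theorem symbol_surjective (n : ℕ) (q : Set.Ioo (0 : ℝ) 1) : Function.Surjective (symbol n q) := by
  refine StarAlgHom.surjective_of_isClosed (sphereAlgebra_isClosed n q) _ fun s t hst => ?_
  refine ⟨_, ⟨circleId, ⟨⟨gen q 0, gen_mem q 0⟩, symbol_gen_zero q⟩, rfl⟩, ?_⟩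
  exact fun h => hst (Subtype.ext h)

theorem norm_symbol_le {q : Set.Ioo (0 : ℝ) 1} (a : sphereAlgebra n q) :
    ‖symbol n q a‖ ≤ ‖a.1‖ :=
  StarAlgHom.norm_apply_le_of_isClosed (sphereAlgebra_isClosed n q) _ a

end QuantumSphere

/-! ### The kernel of the symbol map -/

/-- The Fourier coefficients of a function on the circle. -/
noncomputable def circleFourierCoeff (k : ℤ) (c : C(Circle, ℂ)) : ℂ :=
  (2 * Real.pi : ℂ)⁻¹ *
    ∫ x in (0 : ℝ)..(2 * Real.pi), c (Circle.exp x) * Complex.exp (-(k * (x * Complex.I)))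

theorem intervalIntegrable_circleFourierCoeff (k : ℤ) (c : C(Circle, ℂ)) :
    IntervalIntegrable (fun x : ℝ => c (Circle.exp x) * Complex.exp (-(k * (x * Complex.I))))
      MeasureTheory.volume 0 (2 * Real.pi) := by
  refine Continuous.intervalIntegrable ?_ _ _
  have : Continuous fun x : ℝ => c (Circle.exp x) := c.continuous.comp Circle.exp.continuous
  fun_prop

theorem circleFourierCoeff_add (k : ℤ) (c d : C(Circle, ℂ)) :
    circleFourierCoeff k (c + d) = circleFourierCoeff k c + circleFourierCoeff k d := by
  simp only [circleFourierCoeff, ContinuousMap.add_apply, add_mul]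
  rw [intervalIntegral.integral_add (intervalIntegrable_circleFourierCoeff k c)
    (intervalIntegrable_circleFourierCoeff k d), mul_add]

theorem circleFourierCoeff_smul (k : ℤ) (z : ℂ) (c : C(Circle, ℂ)) :
    circleFourierCoeff k (z • c) = z * circleFourierCoeff k c := by
  simp only [circleFourierCoeff, ContinuousMap.smul_apply, smul_eq_mul, mul_assoc]
  rw [intervalIntegral.integral_const_mul]
  ring

theorem norm_circleFourierCoeff_le (k : ℤ) (c : C(Circle, ℂ)) :
    ‖circleFourierCoeff k c‖ ≤ ‖c‖ := by
  have hpi : (0 : ℝ) < 2 * Real.pi := by positivity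
  have h := intervalIntegral.norm_integral_le_of_norm_le_const (a := (0 : ℝ)) (b := 2 * Real.pi)
    (C := ‖c‖) (f := fun x : ℝ => c (Circle.exp x) * Complex.exp (-(k * (x * Complex.I))))
    fun x _ => by
      have : -((k : ℂ) * (x * Complex.I)) = ((-(k * x) : ℝ) : ℂ) * Complex.I := by
        push_cast; ring
      rw [norm_mul, this, Complex.norm_exp_ofReal_mul_I, mul_one]
      exact c.norm_coe_le_norm _
  rw [sub_zero, abs_of_pos hpi] at h
  rw [circleFourierCoeff, norm_mul, norm_inv]
  have h2 : ‖(2 * Real.pi : ℂ)‖ = 2 * Real.pi := by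
    rw [← Complex.ofReal_ofNat, ← Complex.ofReal_mul, Complex.norm_real, Real.norm_of_nonneg hpi.le]
  rw [h2, inv_mul_le_iff₀ hpi]
  exact h.trans_eq (mul_comm _ _)

theorem circleFourierCoeff_of_zpow {k j : ℤ} {c : C(Circle, ℂ)}
    (hc : ∀ s : Circle, c s = (s : ℂ) ^ j) : circleFourierCoeff k c = if j = k then 1 else 0 := by
  have hpi : (2 * Real.pi : ℂ) ≠ 0 := by simp [Real.pi_ne_zero]
  have h : ∀ x : ℝ, c (Circle.exp x) * Complex.exp (-(k * (x * Complex.I))) =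
      Complex.exp (((j - k : ℤ) * Complex.I) * x) := fun x => by
    rw [hc, Circle.coe_exp, ← Complex.exp_int_mul, ← Complex.exp_add]
    congr 1
    push_cast
    ring
  simp only [circleFourierCoeff, h]
  split_ifs with hjk
  · subst hjk
    simp only [sub_self, Int.cast_zero, zero_mul, Complex.exp_zero,
      intervalIntegral.integral_const, sub_zero, Complex.real_smul, mul_one]
    push_cast
    exact inv_mul_cancel₀ hpi
  · have h0 : ((j - k : ℤ) : ℂ) ≠ 0 := by exact_mod_cast sub_ne_zero.2 hjk
    rw [integral_exp_mul_complex (mul_ne_zero h0 Complex.I_ne_zero)]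
    have : Complex.exp (((j - k : ℤ) : ℂ) * Complex.I * ((2 * Real.pi : ℝ) : ℂ)) = 1 := by
      rw [Complex.exp_eq_one_iff]
      exact ⟨j - k, by push_cast; ring⟩
    rw [this]
    simp

namespace QuantumSphere

open IsometryIdeal

variable {n : ℕ}

/-- S raises the coordinate in ℤ by one, so a single matrix entry sees only one power of S, hence
only one Fourier coefficient of the symbol. -/
theorem zpow_shift_single_apply_eq_zero {k : ℤ} {x y : ℤ × (Fin n → ℕ)} (h : k ≠ y.1 - x.1) :
    zpow (shift n) k (lp.single 2 x 1) y = 0 := by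
  cases k with
  | ofNat k =>
    change (shift n ^ k) (lp.single 2 x 1) y = 0
    rw [shift_pow_single, iterate_stepIdx]
    have : y ≠ (x.1 + k, fun l : Fin n => if (l : ℕ) = 0 then x.2 l + k else x.2 l) := by
      rintro rfl
      exact h (by simp)
    simp [this]
  | negSucc k =>
    change (star (shift n) ^ (k + 1)) (lp.single 2 x 1) y = 0
    rw [star_shift_pow_apply, iterate_stepIdx]
    have : (y.1 + (k + 1 : ℕ), fun l : Fin n => if (l : ℕ) = 0 then y.2 l + (k + 1) else y.2 l) ≠ x := by
      rintro rfl
      refine h ?_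
      simp only [Int.negSucc_eq]
      push_cast
      ring
    rw [lp.single_apply, Pi.single_eq_of_ne this]

theorem norm_apply_single_apply_le (a : Hilb n →L[ℂ] Hilb n) (x y : ℤ × (Fin n → ℕ)) :
    ‖a (lp.single 2 x 1) y‖ ≤ ‖a‖ := by
  refine (lp.norm_apply_le_norm (by norm_num) _ y).trans ?_
  simpa [lp.norm_single] using a.le_opNorm (lp.single 2 x 1)

theorem norm_zpow_shift_le (k : ℤ) : ‖zpow (shift n) k‖ ≤ 1 := by
  cases k with
  | ofNat k =>
    have := norm_pow_mul_le (star_shift_mul_shift (n := n)) k 1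
    rw [mul_one] at this
    exact this.trans ContinuousLinearMap.norm_id_le
  | negSucc k => exact norm_star_shift_pow_le (k + 1)

theorem zpow_shift_mem (q : Set.Ioo (0 : ℝ) 1) (k : ℤ) : zpow (shift n) k ∈ sphereAlgebra n q :=
  zpow_mem (shift_mem q) k

theorem symbol_zpow_shift (q : Set.Ioo (0 : ℝ) 1) (k : ℤ) (s : Circle) :
    symbol n q ⟨zpow (shift n) k, zpow_shift_mem q k⟩ s = (s : ℂ) ^ k := by
  cases k with
  | ofNat k =>
    have : (⟨zpow (shift n) (Int.ofNat k), zpow_shift_mem q _⟩ : sphereAlgebra n q) =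
        ⟨shift n, shift_mem q⟩ ^ k := rfl
    rw [this, map_pow, symbol_shift]
    rfl
  | negSucc k =>
    have : (⟨zpow (shift n) (Int.negSucc k), zpow_shift_mem q _⟩ : sphereAlgebra n q) =
        star (⟨shift n, shift_mem q⟩ : sphereAlgebra n q) ^ (k + 1) :=
      Subtype.ext (SubmonoidClass.coe_pow (star (⟨shift n, shift_mem q⟩ : sphereAlgebra n q))
        (k + 1)).symm
    rw [this, map_pow, map_star, symbol_shift]
    have hs : star (s : ℂ) = (s : ℂ)⁻¹ := by rw [← Circle.coe_inv, Circle.coe_inv_eq_conj]; rfl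
    change star (s : ℂ) ^ (k + 1) = _
    rw [hs, zpow_negSucc, inv_pow]

theorem laurent_shift_le (q : Set.Ioo (0 : ℝ) 1) {a : Hilb n →L[ℂ] Hilb n}
    (ha : a ∈ laurent (shift n) (sphereAlgebra n q)) : a ∈ sphereAlgebra n q :=
  laurent_induction (p := (· ∈ sphereAlgebra n q)) (zpow_mem (shift_mem q)) (fun _ _ h => h)
    (fun _ _ _ _ => add_mem) (zero_mem _) (fun c _ _ h => SMulMemClass.smul_mem c h) ha

/-- The matrix entries of the compressions `S*^m a S^m` converge to Fourier coefficients of the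
symbol of `a`, up to a factor. -/
theorem tendsto_compression_apply (q : Set.Ioo (0 : ℝ) 1) (x y : ℤ × (Fin n → ℕ))
    {a : Hilb n →L[ℂ] Hilb n} (ha : a ∈ laurent (shift n) (sphereAlgebra n q)) :
    Tendsto (fun m : ℕ => (star (shift n) ^ m * a * shift n ^ m) (lp.single 2 x 1) y) atTop
      (𝓝 (zpow (shift n) (y.1 - x.1) (lp.single 2 x 1) y *
        circleFourierCoeff (y.1 - x.1) (symbol n q ⟨a, laurent_shift_le q ha⟩))) := by
  have key : ∀ h : a ∈ sphereAlgebra n q,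
      Tendsto (fun m : ℕ => (star (shift n) ^ m * a * shift n ^ m) (lp.single 2 x 1) y) atTop
      (𝓝 (zpow (shift n) (y.1 - x.1) (lp.single 2 x 1) y *
        circleFourierCoeff (y.1 - x.1) (symbol n q ⟨a, h⟩))) := by
    refine laurent_induction (p := fun a => ∀ h : a ∈ sphereAlgebra n q,
      Tendsto (fun m : ℕ => (star (shift n) ^ m * a * shift n ^ m) (lp.single 2 x 1) y) atTop
      (𝓝 (zpow (shift n) (y.1 - x.1) (lp.single 2 x 1) y *
        circleFourierCoeff (y.1 - x.1) (symbol n q ⟨a, h⟩))))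
      (fun k h => ?_) (fun a ha _ h => ?_) (fun a b ha hb ha' hb' h => ?_) (fun h => ?_)
      (fun c a ha ha' h => ?_) ha
    · simp only [star_pow_mul_zpow_mul_pow star_shift_mul_shift]
      rw [circleFourierCoeff_of_zpow (symbol_zpow_shift q k)]
      split_ifs with hk
      · rw [hk, mul_one]; exact tendsto_const_nhds
      · rw [zpow_shift_single_apply_eq_zero hk, mul_zero]; exact tendsto_const_nhds
    · have h0 : circleFourierCoeff (y.1 - x.1) (symbol n q ⟨a, h⟩) = 0 := by
        rw [symbol_eq_zero (a := ⟨a, h⟩) ha]; simp [circleFourierCoeff]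
      rw [h0, mul_zero]
      refine squeeze_zero_norm (fun m => (norm_apply_single_apply_le _ x y).trans
        (norm_mul_pow_le star_shift_mul_shift m _)) ?_
      simpa using ha.1.norm
    · have e : (⟨a + b, h⟩ : sphereAlgebra n q) =
        ⟨a, laurent_shift_le q ha⟩ + ⟨b, laurent_shift_le q hb⟩ := rfl
      rw [e, map_add, circleFourierCoeff_add, mul_add]
      simpa only [mul_add, add_mul] using! (ha' _).add (hb' _)
    · have e : (⟨0, h⟩ : sphereAlgebra n q) = 0 := rfl
      rw [e, map_zero]
      simp [circleFourierCoeff]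
    · have e : (⟨c • a, h⟩ : sphereAlgebra n q) = c • ⟨a, laurent_shift_le q ha⟩ := rfl
      rw [e, map_smul, circleFourierCoeff_smul, mul_left_comm]
      simpa only [mul_smul_comm, smul_mul_assoc] using! (ha' _).const_mul c
  exact key _

theorem eq_zero_of_apply_single_apply {T : Hilb n →L[ℂ] Hilb n}
    (h : ∀ x y, T (lp.single 2 x 1) y = 0) : T = 0 := by
  have hx : ∀ x, star T (lp.single 2 x 1) = 0 := fun x => by
    refine lp.ext (funext fun y => ?_)
    have h2 := ContinuousLinearMap.adjoint_inner_right T (lp.single 2 y 1) (lp.single 2 x 1)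
    rw [lp.inner_single_left, lp.inner_single_right, h y x] at h2
    simpa [ContinuousLinearMap.star_eq_adjoint] using h2
  refine ContinuousLinearMap.ext fun f => lp.ext (funext fun x => ?_)
  have h2 := ContinuousLinearMap.adjoint_inner_left T f (lp.single 2 x 1)
  rw [← ContinuousLinearMap.star_eq_adjoint, hx, inner_zero_left, lp.inner_single_left] at h2
  simpa using h2.symm

/-- The compressions S*^m a S^m converge in norm to an operator T. Approximating a by Laurent
elements, each matrix entry of T is approximated by a bounded multiple of a Fourier coefficient of a
symbol close to that of a, which is 0. So T = 0, and `mem_vanishing_of_tendsto` applies. -/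
theorem mem_vanishing_of_symbol_eq_zero {q : Set.Ioo (0 : ℝ) 1} {a : sphereAlgebra n q}
    (ha : symbol n q a = 0) : a.1 ∈ vanishing (shift n) := by
  refine mem_vanishing_of_tendsto star_shift_mul_shift (sphereAlgebra_le_multipliers q a.2) ?_
  have hcl := mem_closure_laurent q a.2
  obtain ⟨T, hT⟩ := cauchySeq_tendsto_of_complete (cauchySeq_compression star_shift_mul_shift hcl)
  suffices T = 0 by rwa [this] at hT
  refine eq_zero_of_apply_single_apply fun x y => ?_
  have hT' : Tendsto (fun m : ℕ => (star (shift n) ^ m * a.1 * shift n ^ m) (lp.single 2 x 1) y)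
      atTop (𝓝 (T (lp.single 2 x 1) y)) := by
    rw [tendsto_iff_norm_sub_tendsto_zero] at hT ⊢
    exact squeeze_zero (fun _ => norm_nonneg _)
      (fun m => norm_apply_single_apply_le (star (shift n) ^ m * a.1 * shift n ^ m - T) x y) hT
  have key : ∀ ε > 0, ‖T (lp.single 2 x 1) y‖ ≤ ε := fun ε hε => by
    obtain ⟨b, hb, hab⟩ := Metric.mem_closure_iff.1 hcl (ε / 2) (half_pos hε)
    rw [dist_eq_norm] at hab
    have h1 := (hT'.sub (tendsto_compression_apply q x y hb)).norm
    set l := zpow (shift n) (y.1 - x.1) (lp.single 2 x 1) y *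
        circleFourierCoeff (y.1 - x.1) (symbol n q ⟨b, laurent_shift_le q hb⟩) with hl
    have h2 : ‖T (lp.single 2 x 1) y - l‖ ≤ ε / 2 := by
      refine le_of_tendsto h1 (Eventually.of_forall fun m => ?_)
      have e : (star (shift n) ^ m * a.1 * shift n ^ m) (lp.single 2 x 1) y -
          (star (shift n) ^ m * b * shift n ^ m) (lp.single 2 x 1) y =
          (star (shift n) ^ m * (a.1 - b) * shift n ^ m) (lp.single 2 x 1) y := by
        rw [mul_sub, sub_mul]; rfl
      rw [e]
      exact ((norm_apply_single_apply_le _ x y).trans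
        ((norm_mul_pow_le star_shift_mul_shift m _).trans
          (norm_star_pow_mul_le star_shift_mul_shift m _))).trans hab.le
    have h3 : ‖l‖ ≤ ε / 2 := by
      -- The symbol of b is that of b - a, so it is small by contractivity.
      have e : symbol n q ⟨b, laurent_shift_le q hb⟩ =
          symbol n q (⟨b, laurent_shift_le q hb⟩ - a) := by rw [map_sub, ha, sub_zero]
      rw [hl, norm_mul, e]
      have h4 : ‖zpow (shift n) (y.1 - x.1) (lp.single 2 x 1) y‖ ≤ 1 :=
        (norm_apply_single_apply_le _ x y).trans (norm_zpow_shift_le _)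
      refine (mul_le_of_le_one_left (norm_nonneg _) h4).trans
        ((norm_circleFourierCoeff_le _ _).trans ((norm_symbol_le _).trans ?_))
      change ‖b - a.1‖ ≤ ε / 2
      rw [norm_sub_rev]
      exact hab.le
    have h5 : T (lp.single 2 x 1) y = (T (lp.single 2 x 1) y - l) + l := by ring
    rw [h5]
    refine (norm_add_le _ _).trans ?_
    linarith
  exact norm_le_zero_iff.1 (le_of_forall_pos_le_add fun ε hε => by simpa using key ε hε)

/-- The kernel of the symbol map is the ideal of the isometry `shift n`. -/
theorem symbol_eq_zero_iff {q : Set.Ioo (0 : ℝ) 1} {a : sphereAlgebra n q} :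
    symbol n q a = 0 ↔ a.1 ∈ ideal (shift n) := by
  refine ⟨fun h => ⟨mem_vanishing_of_symbol_eq_zero h, ?_⟩, symbol_eq_zero⟩
  exact mem_vanishing_of_symbol_eq_zero (a := star a) (by rw [map_star, h, star_zero])

end QuantumSphere

/-! ### The rank of an idempotent -/

namespace IdempotentClass

open Matrix

/-- An idempotent over `C(X)` which is equivalent to the identity of size `r` has rank `r` at every
point. -/
theorem rank_eq_of_mk_eq_mk_one {X : Type*} [TopologicalSpace X] {Q : IdempotentOver C(X, ℂ)} {r : ℕ}
    (h : mk Q = mk (IdempotentOver.one r)) (s : X) : (Q.mat.map fun c => c s).rank = r := by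
  obtain ⟨U, V, hUV, hVU⟩ := (IdempotentOver.equivalent_iff _ _).1 (mk_eq_mk_iff.1 h)
  change Matrix (Fin Q.size) (Fin r) C(X, ℂ) at U
  change Matrix (Fin r) (Fin Q.size) C(X, ℂ) at V
  replace hVU : V * U = (1 : Matrix (Fin r) (Fin r) C(X, ℂ)) := hVU
  let f : C(X, ℂ) →+* ℂ :=
    { toFun := fun c => c s
      map_one' := rfl
      map_mul' := fun _ _ => rfl
      map_zero' := rfl
      map_add' := fun _ _ => rfl }
  change (Q.mat.map f).rank = r
  have h1 : U.map f * V.map f = Q.mat.map f := 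
    (Matrix.map_mul (f := f)).symm.trans (congrArg (fun M => M.map f) hUV)
  have h2 : V.map f * U.map f = 1 := 
    (Matrix.map_mul (f := f)).symm.trans ((congrArg (fun M => M.map f) hVU).trans
      (Matrix.map_one _ (_root_.map_zero f) (_root_.map_one f)))
  refine le_antisymm ?_ ?_
  · rw [← h1]
    exact (rank_mul_le_right _ _).trans (rank_le_height _)
  · have h3 : V.map f * (Q.mat.map f * U.map f) = 1 := by
      rw [← h1, Matrix.mul_assoc, h2, Matrix.mul_one, h2]
    calc r = (V.map f * (Q.mat.map f * U.map f)).rank := by rw [h3, rank_one, Fintype.card_fin]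
      _ ≤ _ := (rank_mul_le_right _ _).trans (rank_mul_le_left _ _)

theorem mk_one_injective {X : Type*} [TopologicalSpace X] [Nonempty X] :
    Function.Injective fun r => mk (IdempotentOver.one (A := C(X, ℂ)) r) := fun r r' h => by
  have s := Classical.arbitrary X
  rw [← rank_eq_of_mk_eq_mk_one (Q := IdempotentOver.one r) rfl s]
  exact rank_eq_of_mk_eq_mk_one h s

end IdempotentClass

/-! ### Ranks over the sphere and reduction to a corner -/

namespace QuantumSphere

open IsometryIdeal IdempotentClass

variable {n : ℕ} {q : Set.Ioo (0 : ℝ) 1}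

/-- The map induced by the symbol map on classes of idempotents. -/
noncomputable def symbolClass (n : ℕ) (q : Set.Ioo (0 : ℝ) 1) :
    IdempotentClass (sphereAlgebra n q) → IdempotentClass C(Circle, ℂ) :=
  IdempotentClass.map (((symbol n q : sphereAlgebra n q →+* C(Circle, ℂ)) :
    sphereAlgebra n q →ₙ+* C(Circle, ℂ)))

theorem symbolClass_mk_one (r : ℕ) :
    symbolClass n q (mk (IdempotentOver.one r)) = mk (IdempotentOver.one r) := by
  rw [symbolClass, mk_one, map_ofMatrix, mk_one]
  exact ofMatrix_congr _ (Matrix.map_one _ (_root_.map_zero (symbol n q))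
    (_root_.map_one (symbol n q)))

theorem symbolClass_add (x y : IdempotentClass (sphereAlgebra n q)) :
    symbolClass n q (x + y) = symbolClass n q x + symbolClass n q y :=
  map_add _ x y

/-- The symbol map is unique and every class over C(𝕋) is that of some identity matrix, whose size
is read off from the rank at a single point. -/
theorem mem_rankClasses_iff {x : IdempotentClass (sphereAlgebra n q)} {r : ℕ} :
    x ∈ rankClasses n q r ↔ symbolClass n q x = mk (IdempotentOver.one r) := by
  have key : ∀ (P : IdempotentOver (sphereAlgebra n q)) (r : ℕ),
      symbolClass n q (mk P) = mk (IdempotentOver.one r) →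
        ∀ s : Circle, (P.mat.map fun a => symbol n q a s).rank = r := fun P r h s =>
    rank_eq_of_mk_eq_mk_one (Q := ⟨P.size, P.mat.map (symbol n q), _⟩) h s
  constructor
  · rintro ⟨P, ⟨η, hη, hr⟩, rfl⟩
    obtain rfl := hη.eq (isSymbolMap_symbol q)
    obtain ⟨r', h⟩ := exists_eq_mk_one (symbolClass n q (mk P))
    rw [h, ← hr 1, key P r' h 1]
  · intro h
    obtain ⟨P, rfl⟩ := Quotient.exists_rep x
    exact ⟨P, ⟨symbol n q, isSymbolMap_symbol q, key P r h⟩, rfl⟩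

theorem existsUnique_mem_rankClasses (x : IdempotentClass (sphereAlgebra n q)) :
    ∃! r : ℕ, x ∈ rankClasses n q r := by
  obtain ⟨r, h⟩ := exists_eq_mk_one (symbolClass n q x)
  refine ⟨r, mem_rankClasses_iff.2 h, fun r' h' => ?_⟩
  exact mk_one_injective ((mem_rankClasses_iff.1 h').symm.trans h)

/-- The isometry `shift n` as an element of the algebra of the sphere. -/
noncomputable def shiftElem (n : ℕ) (q : Set.Ioo (0 : ℝ) 1) : sphereAlgebra n q :=
  ⟨shift n, shift_mem q⟩

theorem star_shiftElem_mul : star (shiftElem n q) * shiftElem n q = 1 :=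
  Subtype.ext star_shift_mul_shift

instance (n : ℕ) (q : Set.Ioo (0 : ℝ) 1) : CompleteSpace (sphereAlgebra n q) :=
  (sphereAlgebra_isClosed n q).completeSpace_coe

/-- An idempotent of rank `r` is equivalent to the sum of the identity of size `r` and an idempotent
over a corner `1 - S^m S*^m`. -/
theorem exists_eq_mk_one_add {x : IdempotentClass (sphereAlgebra n q)} {r : ℕ}
    (h : symbolClass n q x = mk (IdempotentOver.one r)) :
    ∃ (N m : ℕ) (p : Matrix (Fin N ⊕ Fin N) (Fin N ⊕ Fin N) (sphereAlgebra n q))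
      (hp : IsIdempotentElem p), (∀ i j,
        (1 - shiftElem n q ^ m * star (shiftElem n q) ^ m) * p i j = p i j ∧
        p i j * (1 - shiftElem n q ^ m * star (shiftElem n q) ^ m) = p i j) ∧
      x = mk (IdempotentOver.one r) + ofMatrix p hp := by
  obtain ⟨N, M, hM, s, hs, rfl, hMs⟩ := exists_map_eq_diagonal
    (symbol n q : sphereAlgebra n q →+* C(Circle, ℂ)) (symbol_surjective n q) x r h
  have hnorm : ∀ m, ‖1 - shiftElem n q ^ m * star (shiftElem n q) ^ m‖ ≤ 1 := fun m => by
    change ‖1 - shift n ^ m * star (shift n) ^ m‖ ≤ 1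
    rw [one_sub_shift_pow_mul]
    refine (IsDiag.diagProj _).norm_le zero_le_one fun x => ?_
    by_cases hx : x ∈ {x : ℤ × (Fin n → ℕ) | ∃ l : Fin n, (l : ℕ) = 0 ∧ x.2 l < m}
    · rw [Set.indicator_of_mem hx]; simp
    · rw [Set.indicator_of_notMem hx]; simp
  obtain ⟨m, p, hp, hcorner, hx⟩ := exists_ofMatrix_eq_one_add hM s (star_shiftElem_mul (q := q))
    hnorm fun i j => by
      set a := (M - Matrix.diagonal fun i => if i ∈ s then (1 : sphereAlgebra n q) else 0) i j
        with ha
      -- The entries of M - diag(1_s) are killed by the symbol map, so they lie in the ideal and are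
      -- limits of their corners.
      have h0 : symbol n q a = 0 := by
        have h1 := congrFun (congrFun hMs i) j
        change symbol n q (M i j) = _ at h1
        rw [ha, Matrix.sub_apply, map_sub, h1, Matrix.diagonal_apply, Matrix.diagonal_apply]
        split_ifs <;> simp
      rw [tendsto_subtype_rng]
      exact tendsto_corner star_shift_mul_shift (symbol_eq_zero_iff.1 h0)
  exact ⟨N, m, p, hp, hcorner, by rw [hx, hs]⟩

end QuantumSphere

/-! ### Idempotents over the corners of an isometry -/

namespace IdempotentClass

open Matrix

variable {A B : Type*} [Ring A] [Ring B] {ι : Type} [Fintype ι]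

section Isometry

variable {s t : B}

theorem pow_mul_pow_eq_one (hts : t * s = 1) (m : ℕ) : t ^ m * s ^ m = 1 := by
  induction m with
  | zero => simp
  | succ m ih => rw [pow_succ, pow_succ', mul_assoc, ← mul_assoc t, hts, one_mul, ih]

theorem isIdempotentElem_pow_mul_pow (hts : t * s = 1) (m : ℕ) :
    IsIdempotentElem (s ^ m * t ^ m) := by
  rw [IsIdempotentElem, mul_assoc, ← mul_assoc (t ^ m), pow_mul_pow_eq_one hts, one_mul]

theorem isIdempotentElem_one_sub (hts : t * s = 1) (m : ℕ) :
    IsIdempotentElem (1 - s ^ m * t ^ m) :=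
  (isIdempotentElem_pow_mul_pow hts m).one_sub

/-- The sum telescopes. It exhibits 1 - s^m t^m as built from m copies of 1 - s t, which carries the
passage between the two corners. -/
theorem sum_corner_eq (s t : B) (m : ℕ) :
    ∑ k ∈ Finset.range m, s ^ k * (1 - s * t) * t ^ k = 1 - s ^ m * t ^ m := by
  have h : ∀ k, s ^ k * (1 - s * t) * t ^ k = s ^ k * t ^ k - s ^ (k + 1) * t ^ (k + 1) := fun k => by
    rw [pow_succ, pow_succ']; noncomm_ring
  simp only [h]
  rw [Finset.sum_range_sub']
  simp

/-- `[1] ⊞ [1 - s^m t^m] = [1]`. -/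
theorem mk_one_add_ofElem_one_sub (hts : t * s = 1) (m : ℕ) :
    mk (IdempotentOver.one 1) + ofElem (1 - s ^ m * t ^ m) (isIdempotentElem_one_sub hts m) =
      mk (IdempotentOver.one 1) := by
  have hi := isIdempotentElem_pow_mul_pow hts m
  have h1 : ofElem (s ^ m * t ^ m) hi = ofElem 1 .one :=
    ofElem_eq_of_mul _ _ rfl (pow_mul_pow_eq_one hts m)
  have h2 : s ^ m * t ^ m + (1 - s ^ m * t ^ m) = 1 := by abel
  have h3 : IsIdempotentElem (s ^ m * t ^ m + (1 - s ^ m * t ^ m)) := h2.symm ▸ .one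
  rw [← ofElem_one, ← h1, ← ofElem_add hi _ h3 hi.mul_one_sub_self hi.one_sub_mul_self,
    ofElem_congr _ h2, h1]

/-- `[1 - s^(m+1) t^(m+1)] = [1 - s^m t^m] ⊞ [1 - s t]`. -/
theorem ofElem_one_sub_succ (hts : t * s = 1) (m : ℕ) :
    ofElem (1 - s ^ (m + 1) * t ^ (m + 1)) (isIdempotentElem_one_sub hts (m + 1)) =
      ofElem (1 - s ^ m * t ^ m) (isIdempotentElem_one_sub hts m) +
        ofElem (1 - s ^ 1 * t ^ 1) (isIdempotentElem_one_sub hts 1) := by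
  have hm := pow_mul_pow_eq_one hts m
  have h1 := isIdempotentElem_one_sub hts 1
  rw [pow_one, pow_one] at h1
  have hi := isIdempotentElem_pow_mul_pow hts m
  have hc : IsIdempotentElem (s ^ m * (1 - s * t) * t ^ m) := by
    calc s ^ m * (1 - s * t) * t ^ m * (s ^ m * (1 - s * t) * t ^ m)
        = s ^ m * (1 - s * t) * (t ^ m * s ^ m) * (1 - s * t) * t ^ m := by
          simp only [mul_assoc]
      _ = s ^ m * ((1 - s * t) * (1 - s * t)) * t ^ m := by rw [hm, mul_one]; simp only [mul_assoc]
      _ = _ := by rw [h1.eq]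
  have h2 : ofElem (1 - s ^ 1 * t ^ 1) (isIdempotentElem_one_sub hts 1) =
      ofElem (s ^ m * (1 - s * t) * t ^ m) hc := by
    refine ofElem_eq_of_mul (x := (1 - s * t) * t ^ m) (y := s ^ m * (1 - s * t)) _ _ ?_ ?_
    · rw [mul_assoc, ← mul_assoc (t ^ m), hm, one_mul, h1.eq, pow_one, pow_one]
    · rw [mul_assoc, ← mul_assoc (1 - s * t) (1 - s * t), h1.eq, mul_assoc]
  have h3 : 1 - s ^ (m + 1) * t ^ (m + 1) = (1 - s ^ m * t ^ m) + s ^ m * (1 - s * t) * t ^ m := by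
    rw [pow_succ, pow_succ']; noncomm_ring
  have e1 : (1 - s ^ m * t ^ m) * (s ^ m * (1 - s * t) * t ^ m) = 0 := by
    have : (1 - s ^ m * t ^ m) * s ^ m = 0 := by
      rw [sub_mul, mul_assoc, hm, mul_one, one_mul, sub_self]
    rw [← mul_assoc, ← mul_assoc, this, zero_mul, zero_mul]
  have e2 : (s ^ m * (1 - s * t) * t ^ m) * (1 - s ^ m * t ^ m) = 0 := by
    have : t ^ m * (1 - s ^ m * t ^ m) = 0 := by
      rw [mul_sub, ← mul_assoc, hm, mul_one, one_mul, sub_self]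
    rw [mul_assoc, this, mul_zero]
  rw [ofElem_congr _ h3, h2, ofElem_add _ hc _ e1 e2]

theorem ofElem_one_sub_zero (hts : t * s = 1) :
    ofElem (1 - s ^ 0 * t ^ 0) (isIdempotentElem_one_sub hts 0) = 0 := by
  rw [ofElem_eq_ofMatrix, ← ofMatrix_zero (ι := Fin 1)]
  refine ofMatrix_congr _ ?_
  ext i j
  simp

variable (f : A →ₙ+* B)

/-- The unit of A goes to 1 - s t, and 1 - s^k t^k is the sum of k orthogonal idempotents equivalent
to it. -/
theorem map_mk_one_eq (hts : t * s = 1) (hf1 : f 1 = 1 - s * t) (k : ℕ) :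
    map f (mk (IdempotentOver.one k)) =
      ofElem (1 - s ^ k * t ^ k) (isIdempotentElem_one_sub hts k) := by
  induction k with
  | zero => rw [mk_one_zero, map_zero, ofElem_one_sub_zero hts]
  | succ k ih =>
    rw [← mk_one_add, map_add, ih, ofElem_one_sub_succ hts, ← ofElem_one, map_ofElem]
    congr 1
    exact ofElem_congr _ (by rw [hf1, pow_one, pow_one])

/-- If `f` is an isomorphism onto the corner of `1 - s t`, then the idempotents over the corners
of `1 - s^m t^m` come from `A`. -/
theorem exists_map_eq_ofMatrix (hf : Function.Injective f)
    (hcorner : ∀ b : B, ∃ a : A, f a = f 1 * b * f 1) (hf1 : f 1 = 1 - s * t)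
    {p : Matrix ι ι B} (hp : IsIdempotentElem p) {m : ℕ}
    (hpm : ∀ i j, (1 - s ^ m * t ^ m) * p i j = p i j) :
    ∃ x : IdempotentClass A, map f x = ofMatrix p hp := by
  choose g hg using hcorner
  -- By `sum_corner_eq` the corner of 1 - s^m t^m consists of m × m matrices over the corner of 1 -
  -- s t. X and Y cut p along this decomposition; Y X then has entries in the smaller corner, that
  -- is in the image of f.
  let X : Matrix ι (ι × Fin m) B := fun a b => p a b.1 * s ^ (b.2 : ℕ) * f 1
  let Y : Matrix (ι × Fin m) ι B := fun a b => f 1 * t ^ (a.2 : ℕ) * p a.1 b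
  let p' : Matrix (ι × Fin m) (ι × Fin m) A := fun a b =>
    g (t ^ (a.2 : ℕ) * p a.1 b.1 * s ^ (b.2 : ℕ))
  have hf1' : f 1 * f 1 = f 1 := by rw [← _root_.map_mul, one_mul]
  have hpp : ∀ a c, ∑ b, p a b * p b c = p a c := fun a c => by
    rw [← Matrix.mul_apply, hp.eq]
  have hXY : X * Y = p := by
    ext a c
    rw [Matrix.mul_apply, Fintype.sum_prod_type]
    have : ∀ b, ∑ k : Fin m, X a (b, k) * Y (b, k) c = p a b * p b c := fun b => by
      have h1 : ∀ k : Fin m, X a (b, k) * Y (b, k) c =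
          p a b * (s ^ (k : ℕ) * (1 - s * t) * t ^ (k : ℕ)) * p b c := fun k => by
        simp only [X, Y, ← hf1]
        calc p a b * s ^ (k : ℕ) * f 1 * (f 1 * t ^ (k : ℕ) * p b c)
            = p a b * s ^ (k : ℕ) * (f 1 * f 1) * t ^ (k : ℕ) * p b c := by simp only [mul_assoc]
          _ = _ := by rw [hf1']; simp only [mul_assoc]
      simp only [h1]
      rw [← Finset.sum_mul, ← Finset.mul_sum,
        Fin.sum_univ_eq_sum_range (fun k => s ^ k * (1 - s * t) * t ^ k) m, sum_corner_eq, mul_assoc,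
        hpm]
    simp only [this, hpp]
  have hYX : Y * X = p'.map f := by
    ext a c
    rw [Matrix.mul_apply]
    change _ = f (g _)
    rw [hg]
    simp only [X, Y]
    have h1 : ∀ b, f 1 * t ^ (a.2 : ℕ) * p a.1 b * (p b c.1 * s ^ (c.2 : ℕ) * f 1) =
        f 1 * t ^ (a.2 : ℕ) * (p a.1 b * p b c.1) * (s ^ (c.2 : ℕ) * f 1) := fun b => by
      simp only [mul_assoc]
    simp only [h1]
    rw [← Finset.sum_mul, ← Finset.mul_sum, hpp]
    simp only [mul_assoc]
  have hp' : IsIdempotentElem p' := by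
    have h1 : Y * p = Y := by
      ext a c
      rw [Matrix.mul_apply]
      simp only [Y, mul_assoc (f 1 * _)]
      rw [← Finset.mul_sum, hpp]
    refine Matrix.map_injective hf ?_
    calc (p' * p').map f = p'.map f * p'.map f := Matrix.map_mul
      _ = Y * (X * Y) * X := by rw [← hYX]; simp only [Matrix.mul_assoc]
      _ = p'.map f := by rw [hXY, h1, hYX]
  refine ⟨ofMatrix p' hp', ?_⟩
  rw [map_ofMatrix, eq_comm, ofMatrix_eq_ofMatrix_iff]
  exact ⟨X, Y, hXY, hYX⟩

end Isometry

end IdempotentClass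

/-! ### The corner embedding of the algebra of the preceding sphere -/

namespace QuantumSphere

open IsometryIdeal ContinuousLinearMap
open scoped ENNReal

variable {n : ℕ}

/-- The inclusion `(z, w) ↦ (z, (0, w))` of `ℤ × ℕⁿ` in `ℤ × ℕⁿ⁺¹`. -/
def consIdx (x : ℤ × (Fin n → ℕ)) : ℤ × (Fin (n + 1) → ℕ) := (x.1, Fin.cons 0 x.2)

theorem consIdx_injective : Function.Injective (consIdx (n := n)) := by
  rintro ⟨a, w⟩ ⟨b, v⟩ h
  simp only [consIdx, Prod.mk.injEq, Fin.cons_inj] at h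
  exact Prod.ext h.1 h.2.2

theorem mem_range_consIdx {y : ℤ × (Fin (n + 1) → ℕ)} :
    y ∈ Set.range (consIdx (n := n)) ↔ y.2 0 = 0 := by
  constructor
  · rintro ⟨x, rfl⟩
    rfl
  · intro h
    exact ⟨(y.1, Fin.tail y.2), Prod.ext rfl (by rw [consIdx, ← h]; exact Fin.cons_self_tail y.2)⟩

/-- The restriction of functions along `consIdx`. -/
noncomputable def restrict (n : ℕ) : Hilb (n + 1) →L[ℂ] Hilb n :=
  have summ : ∀ f : Hilb (n + 1), Summable fun x => ‖f (consIdx x)‖ ^ (2 : ℝ≥0∞).toReal := fun f =>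
    ((lp.memℓp f).summable (by norm_num)).comp_injective consIdx_injective
  LinearMap.mkContinuous
    { toFun := fun f => ⟨fun x => f (consIdx x), memℓp_gen (summ f)⟩
      map_add' := fun f g => rfl
      map_smul' := fun a f => rfl } 1 (fun f => by
    rw [one_mul]
    refine lp.norm_le_of_tsum_le (by norm_num) (norm_nonneg _) ?_
    rw [lp.norm_rpow_eq_tsum (by norm_num) f]
    exact tsum_comp_le_tsum_of_inj ((lp.memℓp f).summable (by norm_num))
      (fun i => by positivity) consIdx_injective)

theorem restrict_apply (f : Hilb (n + 1)) (x : ℤ × (Fin n → ℕ)) :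
    restrict n f x = f (consIdx x) := rfl

/-- The isometry `e_x ↦ e_{consIdx x}`. -/
noncomputable def extend (n : ℕ) : Hilb n →L[ℂ] Hilb (n + 1) := adjoint (restrict n)

theorem extend_apply_eq_inner (f : Hilb n) (y : ℤ × (Fin (n + 1) → ℕ)) :
    extend n f y = inner ℂ (restrict n (lp.single 2 y 1)) f := by
  have h := adjoint_inner_right (restrict n) (lp.single 2 y 1) f
  rw [lp.inner_single_left] at h
  simpa [extend] using h

theorem extend_apply_consIdx (f : Hilb n) (x : ℤ × (Fin n → ℕ)) :
    extend n f (consIdx x) = f x := by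
  have h : restrict n (lp.single 2 (consIdx x) 1) = lp.single 2 x 1 := by
    refine lp.ext (funext fun y => ?_)
    rw [restrict_apply]
    by_cases hy : y = x
    · subst hy; simp
    · have : consIdx y ≠ consIdx x := fun h => hy (consIdx_injective h)
      simp [hy, this]
  rw [extend_apply_eq_inner, h, lp.inner_single_left]
  simp

theorem extend_apply_of_ne (f : Hilb n) {y : ℤ × (Fin (n + 1) → ℕ)} (hy : y.2 0 ≠ 0) :
    extend n f y = 0 := by
  have h : restrict n (lp.single 2 y 1) = 0 := by
    refine lp.ext (funext fun x => ?_)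
    have : consIdx x ≠ y := fun h => hy (mem_range_consIdx.1 ⟨x, h⟩)
    rw [restrict_apply]
    simp [this]
  rw [extend_apply_eq_inner, h, inner_zero_left]

theorem restrict_extend (f : Hilb n) : restrict n (extend n f) = f :=
  lp.ext (funext fun x => by rw [restrict_apply, extend_apply_consIdx])

/-- The corner embedding of operators, `b ↦ W b W*` with `W = extend n`. -/
noncomputable def inflate (b : Hilb n →L[ℂ] Hilb n) : Hilb (n + 1) →L[ℂ] Hilb (n + 1) :=
  extend n ∘L b ∘L restrict n

/-- The compression of operators, `a ↦ W* a W` with `W = extend n`. -/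
noncomputable def compress (a : Hilb (n + 1) →L[ℂ] Hilb (n + 1)) : Hilb n →L[ℂ] Hilb n :=
  restrict n ∘L a ∘L extend n

theorem inflate_apply (b : Hilb n →L[ℂ] Hilb n) (f : Hilb (n + 1)) :
    inflate b f = extend n (b (restrict n f)) := rfl

theorem compress_apply (a : Hilb (n + 1) →L[ℂ] Hilb (n + 1)) (f : Hilb n) :
    compress a f = restrict n (a (extend n f)) := rfl

theorem star_inflate (b : Hilb n →L[ℂ] Hilb n) : star (inflate b) = inflate (star b) := by
  rw [inflate, inflate, star_eq_adjoint, adjoint_comp, adjoint_comp, extend, adjoint_adjoint,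
    star_eq_adjoint, comp_assoc]

theorem star_compress (a : Hilb (n + 1) →L[ℂ] Hilb (n + 1)) :
    star (compress a) = compress (star a) := by
  rw [compress, compress, star_eq_adjoint, adjoint_comp, adjoint_comp, extend, adjoint_adjoint,
    star_eq_adjoint, comp_assoc]

theorem compress_inflate (b : Hilb n →L[ℂ] Hilb n) : compress (inflate b) = b :=
  ContinuousLinearMap.ext fun f => by
    rw [compress_apply, inflate_apply, restrict_extend, restrict_extend]

theorem inflate_mul (b c : Hilb n →L[ℂ] Hilb n) : inflate (b * c) = inflate b * inflate c :=
  ContinuousLinearMap.ext fun f => by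
    rw [mul_apply_eq_comp, inflate_apply, inflate_apply, inflate_apply, restrict_extend,
      mul_apply_eq_comp]

theorem inflate_add (b c : Hilb n →L[ℂ] Hilb n) : inflate (b + c) = inflate b + inflate c := by
  rw [inflate, inflate, inflate, add_comp, comp_add]

theorem inflate_smul (z : ℂ) (b : Hilb n →L[ℂ] Hilb n) : inflate (z • b) = z • inflate b := by
  rw [inflate, inflate, smul_comp, comp_smul]

theorem inflate_zero : inflate (0 : Hilb n →L[ℂ] Hilb n) = 0 := by
  rw [inflate, zero_comp, comp_zero]

theorem compress_add (b c : Hilb (n + 1) →L[ℂ] Hilb (n + 1)) :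
    compress (b + c) = compress b + compress c := by
  rw [compress, compress, compress, add_comp, comp_add]

theorem compress_smul (z : ℂ) (b : Hilb (n + 1) →L[ℂ] Hilb (n + 1)) :
    compress (z • b) = z • compress b := by
  rw [compress, compress, smul_comp, comp_smul]

theorem continuous_inflate : Continuous (inflate (n := n)) := by
  unfold inflate
  fun_prop

theorem continuous_compress : Continuous (compress (n := n)) := by
  unfold compress
  fun_prop

theorem inflate_diagProj (s : Set (ℤ × (Fin n → ℕ))) :
    inflate (diagProj s) = diagProj (Set.image consIdx s) := by
  refine ContinuousLinearMap.ext fun f => lp.ext (funext fun y => ?_)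
  rw [inflate_apply, diagProj_apply]
  by_cases hy : y ∈ Set.range (consIdx (n := n))
  · obtain ⟨x, rfl⟩ := hy
    rw [extend_apply_consIdx, diagProj_apply, restrict_apply]
    congr 1
    by_cases hx : x ∈ s
    · rw [Set.indicator_of_mem hx, Set.indicator_of_mem (Set.mem_image_of_mem _ hx)]; rfl
    · rw [Set.indicator_of_notMem hx, Set.indicator_of_notMem]
      rintro ⟨x', hx', h⟩
      exact hx (consIdx_injective h ▸ hx')
  · rw [Set.indicator_of_notMem fun h => hy (Set.image_subset_range _ _ h), zero_mul,
      extend_apply_of_ne _ fun h => hy (mem_range_consIdx.2 h)]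

theorem inflate_one : inflate (1 : Hilb n →L[ℂ] Hilb n) = 1 - shift (n + 1) * star (shift (n + 1)) := by
  have h1 : (1 : Hilb n →L[ℂ] Hilb n) = diagProj Set.univ :=
    (IsDiag.one).ext (by simpa using! IsDiag.diagProj (Set.univ : Set (ℤ × (Fin n → ℕ))))
  have h2 := one_sub_shift_pow_mul (n := n + 1) 1
  rw [pow_one, pow_one] at h2
  rw [h1, inflate_diagProj, h2]
  congr 1
  ext y
  rw [Set.image_univ, mem_range_consIdx]
  constructor
  · intro h
    exact ⟨0, rfl, by omega⟩
  · rintro ⟨l, hl, h⟩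
    obtain rfl : l = 0 := Fin.ext hl
    omega

theorem inflate_stdOp (j : Fin n) (k : ℕ) : inflate (stdOp j k) = stdOp j.succ k := by
  rw [stdOp, inflate_diagProj, stdOp]
  congr 1
  ext y
  constructor
  · rintro ⟨x, ⟨hx, hk⟩, rfl⟩
    refine ⟨fun l hl => ?_, hk⟩
    induction l using Fin.cases with
    | zero => rfl
    | succ l => exact hx l (Fin.succ_lt_succ_iff.1 hl)
  · rintro ⟨hy, hk⟩
    obtain ⟨x, rfl⟩ := mem_range_consIdx.2 (hy 0 (Fin.succ_pos j))
    exact ⟨x, ⟨fun l hl => hy l.succ (Fin.succ_lt_succ_iff.2 hl), hk⟩, rfl⟩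

theorem stdOp_zero (k : ℕ) :
    stdOp (0 : Fin (n + 1)) k = 1 - shift (n + 1) ^ k * star (shift (n + 1)) ^ k := by
  rw [one_sub_shift_pow_mul, stdOp]
  congr 1
  ext x
  constructor
  · rintro ⟨-, h⟩
    exact ⟨0, rfl, h⟩
  · rintro ⟨l, hl, h⟩
    obtain rfl : l = 0 := Fin.ext hl
    exact ⟨fun l hl => absurd hl (Fin.not_lt_zero l), h⟩

theorem stepIdx_consIdx (l : Fin (n + 1)) (x : ℤ × (Fin n → ℕ)) :
    stepIdx l.succ (consIdx x) = consIdx (stepIdx l x) := by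
  refine Prod.ext rfl (funext fun i => ?_)
  induction i using Fin.cases with
  | zero => simp [stepIdx, consIdx]
  | succ i => simp [stepIdx, consIdx]

theorem stepWeight_consIdx (q : Set.Ioo (0 : ℝ) 1) (l : Fin (n + 1)) (x : ℤ × (Fin n → ℕ)) :
    stepWeight q l.succ (consIdx x) = stepWeight q l x := by
  rw [stepWeight, stepWeight, Fin.prod_univ_succ]
  simp [consIdx]

theorem restrict_star_gen (q : Set.Ioo (0 : ℝ) 1) (l : Fin (n + 1)) (f : Hilb (n + 1)) :
    restrict n (star (gen q l.succ) f) = star (gen q l) (restrict n f) :=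
  lp.ext (funext fun x => by
    rw [restrict_apply, star_gen_apply, star_gen_apply, restrict_apply, stepIdx_consIdx,
      stepWeight_consIdx])

/-- Restriction intertwines the adjoint generators pointwise; the relation for the generators
follows by taking adjoints. -/
theorem gen_extend (q : Set.Ioo (0 : ℝ) 1) (l : Fin (n + 1)) (f : Hilb n) :
    gen q l.succ (extend n f) = extend n (gen q l f) := by
  have h : restrict n ∘L star (gen q l.succ) = star (gen q l) ∘L restrict n :=
    ContinuousLinearMap.ext (restrict_star_gen q l)
  have h2 := congrArg adjoint h
  rw [adjoint_comp, adjoint_comp, ← star_eq_adjoint, ← star_eq_adjoint, star_star, star_star] at h2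
  exact DFunLike.congr_fun h2 f

/-- The algebra of the sphere embeds in a corner of the algebra of the next sphere. -/
theorem inflate_mem (q : Set.Ioo (0 : ℝ) 1) {b : Hilb n →L[ℂ] Hilb n}
    (hb : b ∈ sphereAlgebra n q) : inflate b ∈ sphereAlgebra (n + 1) q := by
  have h1 : inflate (1 : Hilb n →L[ℂ] Hilb n) ∈ sphereAlgebra (n + 1) q := by
    rw [inflate_one]
    exact sub_mem (one_mem _) (mul_mem (shift_mem q) (star_mem (shift_mem q)))
  let T : StarSubalgebra ℂ (Hilb n →L[ℂ] Hilb n) :=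
    { carrier := {b | inflate b ∈ sphereAlgebra (n + 1) q}
      mul_mem' := fun {a b} ha hb => by
        change inflate (a * b) ∈ sphereAlgebra (n + 1) q
        rw [inflate_mul]
        exact mul_mem ha hb
      add_mem' := fun {a b} ha hb => by
        change inflate (a + b) ∈ sphereAlgebra (n + 1) q
        rw [inflate_add]
        exact add_mem ha hb
      algebraMap_mem' := fun z => by
        change inflate (algebraMap ℂ (Hilb n →L[ℂ] Hilb n) z) ∈ sphereAlgebra (n + 1) q
        rw [Algebra.algebraMap_eq_smul_one, inflate_smul]
        exact SMulMemClass.smul_mem _ h1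
      star_mem' := fun {a} ha => by
        change inflate (star a) ∈ sphereAlgebra (n + 1) q
        rw [← star_inflate]
        exact star_mem ha }
  have hT : IsClosed (T : Set (Hilb n →L[ℂ] Hilb n)) :=
    (sphereAlgebra_isClosed (n + 1) q).preimage continuous_inflate
  refine sphereAlgebra_le hT (fun l => ?_) hb
  change inflate (gen q l) ∈ sphereAlgebra (n + 1) q
  have : inflate (gen q l) = gen q l.succ * inflate 1 := ContinuousLinearMap.ext fun f => by
    rw [mul_apply_eq_comp, inflate_apply, inflate_apply, gen_extend]
    rfl
  rw [this]
  exact mul_mem (gen_mem q _) h1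

theorem star_shift_extend (f : Hilb n) : star (shift (n + 1)) (extend n f) = 0 :=
  lp.ext (funext fun x => by
    rw [star_shift_apply, extend_apply_of_ne]
    · rfl
    · simp [stepIdx])

theorem restrict_shift (f : Hilb (n + 1)) : restrict n (shift (n + 1) f) = 0 :=
  lp.ext (funext fun x => by
    rw [restrict_apply, shift_apply_of_notMem]
    · rfl
    · rw [mem_range_stepIdx]
      push Not
      exact ⟨0, rfl, Nat.zero_lt_one⟩)

/-- Write W for `extend n`, the isometry onto the level w_0 = 0. Then S* W = 0 and W* S = 0, so only
equal powers leave something, namely W* W = 1. -/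
theorem compress_star_shift_pow_mul (i j : ℕ) :
    compress (star (shift (n + 1)) ^ i * shift (n + 1) ^ j) = if i = j then 1 else 0 := by
  refine ContinuousLinearMap.ext fun f => ?_
  rw [compress_apply]
  rcases lt_trichotomy i j with h | h | h
  · obtain ⟨k, rfl⟩ := Nat.exists_eq_add_of_lt h
    rw [if_neg h.ne, add_assoc, pow_add, ← mul_assoc, star_pow_mul_pow star_shift_mul_shift, one_mul,
      pow_succ', mul_apply_eq_comp, restrict_shift]
    rfl
  · subst h
    rw [if_pos rfl, star_pow_mul_pow star_shift_mul_shift]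
    exact restrict_extend f
  · obtain ⟨k, rfl⟩ := Nat.exists_eq_add_of_lt h
    rw [if_neg h.ne', show j + k + 1 = (k + 1) + j by omega,
      star_pow_add_mul_pow star_shift_mul_shift, pow_succ, mul_apply_eq_comp, star_shift_extend,
      map_zero, map_zero]
    rfl

theorem compress_mul_inflate_one_mul (a b : Hilb (n + 1) →L[ℂ] Hilb (n + 1)) :
    compress (a * inflate 1 * b) = compress a * compress b := rfl

theorem compress_mul_inflate_one (a : Hilb (n + 1) →L[ℂ] Hilb (n + 1)) :
    compress (a * inflate 1) = compress a :=
  ContinuousLinearMap.ext fun f => by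
    rw [compress_apply, compress_apply, mul_apply_eq_comp, inflate_apply, restrict_extend]
    rfl

/-- The vectors concerned are supported on the level w_0 = j, where the diagonal factor is a scalar.
-/
theorem genDiag_shift_pow_extend (q : Set.Ioo (0 : ℝ) 1) (j : ℕ) (f : Hilb n) :
    genDiag q ((shift (n + 1) ^ j) (extend n f)) =
      (√(1 - (q : ℝ) ^ (2 * (j + 1))) : ℂ) • (shift (n + 1) ^ j) (extend n f) := by
  refine lp.ext (funext fun y => ?_)
  rw [isDiag_genDiag, lp.coeFn_smul, Pi.smul_apply, smul_eq_mul]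
  by_cases hy : y ∈ Set.range (stepIdx (n := n + 1) 0)^[j]
  · obtain ⟨x, rfl⟩ := hy
    rw [shift_pow_apply_iterate]
    by_cases hx : x.2 0 = 0
    · have h : stepWeight q 0 ((stepIdx (n := n + 1) 0)^[j] x) =
          √(1 - (q : ℝ) ^ (2 * (j + 1))) := by
        rw [stepWeight_zero_succ, iterate_stepIdx]
        simp [hx]
      rw [← h]
    · rw [extend_apply_of_ne _ hx, mul_zero, mul_zero]
  · rw [shift_pow_apply_of_notMem _ _ hy, mul_zero, mul_zero]

theorem gen_mul_shift_pow (q : Set.Ioo (0 : ℝ) 1) {i : Fin (n + 1)} (hi : i ≠ 0) (j : ℕ) :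
    gen q i * shift n ^ j = ((q : ℂ) ^ j) • (shift n ^ j * gen q i) := by
  induction j with
  | zero => simp
  | succ j ih =>
    rw [pow_succ, ← mul_assoc, ih, smul_mul_assoc, mul_assoc, gen_mul_shift q hi, mul_smul_comm,
      smul_smul, pow_succ, mul_assoc]

/-- For the first generator the diagonal factor becomes a scalar on level j, and powers of S and S*
compress to 0 or 1. Every other generator passes S^j at the cost of q^j and acts on the level w_0 =
0 as a generator of the preceding sphere. -/
theorem compress_gen_mem (q : Set.Ioo (0 : ℝ) 1) (l : Fin (n + 2)) (i j : ℕ) :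
    compress (star (shift (n + 1)) ^ i * gen q l * shift (n + 1) ^ j) ∈ sphereAlgebra n q := by
  induction l using Fin.cases with
  | zero =>
    have h : compress (star (shift (n + 1)) ^ i * gen q 0 * shift (n + 1) ^ j) =
        (√(1 - (q : ℝ) ^ (2 * (j + 1))) : ℂ) •
          compress (star (shift (n + 1)) ^ i * shift (n + 1) ^ (j + 1)) := by
      refine ContinuousLinearMap.ext fun f => ?_
      rw [compress_apply, smul_apply, compress_apply, mul_apply_eq_comp, mul_apply_eq_comp,
        gen_zero_eq, mul_apply_eq_comp, genDiag_shift_pow_extend, map_smul, map_smul, map_smul,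
        pow_succ', mul_apply_eq_comp, mul_apply_eq_comp]
    rw [h, compress_star_shift_pow_mul]
    refine SMulMemClass.smul_mem _ ?_
    split_ifs
    · exact one_mem _
    · exact zero_mem _
  | succ l =>
    have h : compress (star (shift (n + 1)) ^ i * gen q l.succ * shift (n + 1) ^ j) =
        ((q : ℂ) ^ j) • (compress (star (shift (n + 1)) ^ i * shift (n + 1) ^ j) * gen q l) := by
      rw [mul_assoc, gen_mul_shift_pow q (Fin.succ_ne_zero l), mul_smul_comm, compress_smul]
      congr 1
      refine ContinuousLinearMap.ext fun f => ?_
      rw [compress_apply, mul_apply_eq_comp, mul_apply_eq_comp, gen_extend, mul_apply_eq_comp,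
        compress_apply, mul_apply_eq_comp]
    rw [h, compress_star_shift_pow_mul]
    refine SMulMemClass.smul_mem _ (mul_mem ?_ (gen_mem q l))
    split_ifs
    · exact one_mem _
    · exact zero_mem _

/-- Compression is not multiplicative. Inserting ∑ S^k (1 - S S*) S*^k between a and b makes the
compression of a b a limit of finite sums of products of compressions; the sums converge because
S*^m b is small on the level w_0 = 0. -/
theorem compress_mul_mem (q : Set.Ioo (0 : ℝ) 1) {a b : Hilb (n + 1) →L[ℂ] Hilb (n + 1)}
    (ha : ∀ k, compress (a * shift (n + 1) ^ k) ∈ sphereAlgebra n q)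
    (hb : ∀ k, compress (star (shift (n + 1)) ^ k * b) ∈ sphereAlgebra n q)
    (hb' : b * inflate 1 ∈ vanishing (shift (n + 1))) : compress (a * b) ∈ sphereAlgebra n q := by
  set S := shift (n + 1) with hS
  have h1 : Tendsto (fun m : ℕ => a * ((1 - S ^ m * star S ^ m) * (b * inflate 1))) atTop
      (𝓝 (a * (b * inflate 1))) := by
    refine Tendsto.const_mul a ?_
    have h2 : Tendsto (fun m : ℕ => S ^ m * (star S ^ m * (b * inflate 1))) atTop (𝓝 0) := by
      refine squeeze_zero_norm (fun m => norm_pow_mul_le star_shift_mul_shift m _) ?_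
      simpa using hb'.norm
    simpa only [sub_mul, one_mul, mul_assoc, sub_zero] using! h2.const_sub (b * inflate 1)
  have h3 := (continuous_compress.tendsto _).comp h1
  rw [← mul_assoc, compress_mul_inflate_one] at h3
  refine (sphereAlgebra_isClosed n q).mem_of_tendsto h3 (Eventually.of_forall fun m => ?_)
  have h4 : a * ((1 - S ^ m * star S ^ m) * (b * inflate 1)) =
      ∑ k ∈ Finset.range m, (a * S ^ k) * inflate 1 * (star S ^ k * b * inflate 1) := by
    rw [← IdempotentClass.sum_corner_eq, ← inflate_one, Finset.sum_mul, Finset.mul_sum]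
    refine Finset.sum_congr rfl fun k _ => ?_
    simp only [mul_assoc]
  have h5 : ∀ t : Finset ℕ, compress (∑ k ∈ t, (a * S ^ k) * inflate 1 *
      (star S ^ k * b * inflate 1)) ∈ sphereAlgebra n q := fun t => by
    induction t using Finset.induction_on with
    | empty =>
      rw [Finset.sum_empty]
      have : compress (0 : Hilb (n + 1) →L[ℂ] Hilb (n + 1)) = 0 := by
        rw [compress, zero_comp, comp_zero]
      rw [this]
      exact zero_mem _
    | insert k t hk ih =>
      rw [Finset.sum_insert hk, compress_add, compress_mul_inflate_one_mul,
        compress_mul_inflate_one]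
      exact add_mem (mul_mem (ha k) (hb k)) ih
  simp only [Function.comp_apply]
  rw [h4]
  exact h5 _

/-- Compressions of elements of the algebra of a sphere lie in the algebra of the preceding
sphere. -/
theorem compress_mem (q : Set.Ioo (0 : ℝ) 1) {a : Hilb (n + 1) →L[ℂ] Hilb (n + 1)}
    (ha : a ∈ sphereAlgebra (n + 1) q) : compress a ∈ sphereAlgebra n q := by
  set S := shift (n + 1) with hS
  have h1 : inflate (1 : Hilb n →L[ℂ] Hilb n) ∈ vanishing S := by
    rw [inflate_one]; exact (one_sub_mem_ideal star_shift_mul_shift).1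
  -- All the compressions of S*^i a S^j, the matrix blocks of a between the levels of w_0, are
  -- tracked at once: those of a product involve all of them. The multiplier condition provides the
  -- convergence needed in `compress_mul_mem`.
  let T : StarSubalgebra ℂ (Hilb (n + 1) →L[ℂ] Hilb (n + 1)) :=
    { carrier := {a | a ∈ multipliers S ∧
        ∀ i j, compress (star S ^ i * a * S ^ j) ∈ sphereAlgebra n q}
      mul_mem' := fun {a b} ha hb => by
        refine ⟨mul_mem ha.1 hb.1, fun i j => ?_⟩
        have e : star S ^ i * (a * b) * S ^ j = (star S ^ i * a) * (b * S ^ j) := by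
          simp only [mul_assoc]
        rw [e]
        refine compress_mul_mem q (ha.2 i) (fun k => ?_) ?_
        · rw [← mul_assoc]; exact hb.2 k j
        · exact (mul_mem hb.1 (pow_mem (self_mem_multipliers star_shift_mul_shift) j)).1 _ h1
      add_mem' := fun {a b} ha hb => ⟨add_mem ha.1 hb.1, fun i j => by
        rw [mul_add, add_mul, compress_add]; exact add_mem (ha.2 i j) (hb.2 i j)⟩
      algebraMap_mem' := fun z => ⟨algebraMap_mem _ z, fun i j => by
        rw [Algebra.algebraMap_eq_smul_one, mul_smul_comm, smul_mul_assoc, mul_one, compress_smul,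
          compress_star_shift_pow_mul]
        refine SMulMemClass.smul_mem _ ?_
        split_ifs
        · exact one_mem _
        · exact zero_mem _⟩
      star_mem' := fun {a} ha => ⟨star_mem ha.1, fun i j => by
        have e : star S ^ i * star a * S ^ j = star (star S ^ j * a * S ^ i) := by
          simp only [star_mul, star_pow, star_star, mul_assoc]
        rw [e, ← star_compress]
        exact star_mem (ha.2 j i)⟩ }
  have hT : IsClosed (T : Set (Hilb (n + 1) →L[ℂ] Hilb (n + 1))) := by
    have e : (T : Set (Hilb (n + 1) →L[ℂ] Hilb (n + 1))) = (multipliers S : Set _) ∩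
        ⋂ i : ℕ, ⋂ j : ℕ, Set.preimage (fun a => compress (star S ^ i * a * S ^ j))
          (sphereAlgebra n q) := by
      ext a
      simp only [Set.mem_inter_iff, Set.mem_iInter]
      rfl
    rw [e]
    refine (isClosed_multipliers star_shift_mul_shift).inter
      (isClosed_iInter fun i => isClosed_iInter fun j => ?_)
    exact (sphereAlgebra_isClosed n q).preimage (continuous_compress.comp (by fun_prop))
  have h2 := sphereAlgebra_le (q := q) hT
    (fun l => ⟨sphereAlgebra_le_multipliers q (gen_mem q l), compress_gen_mem q l⟩) ha
  simpa using h2.2 0 0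

end QuantumSphere

/-! ### The classification -/

namespace QuantumSphere

open IsometryIdeal IdempotentClass

variable {n : ℕ} {q : Set.Ioo (0 : ℝ) 1}

/-- The embedding of the algebra of a sphere in a corner of the algebra of the next sphere. -/
noncomputable def inflateHom (n : ℕ) (q : Set.Ioo (0 : ℝ) 1) :
    sphereAlgebra n q →ₙ+* sphereAlgebra (n + 1) q where
  toFun b := ⟨inflate b.1, inflate_mem q b.2⟩
  map_mul' b c := Subtype.ext (inflate_mul b.1 c.1)
  map_zero' := Subtype.ext inflate_zero
  map_add' b c := Subtype.ext (inflate_add b.1 c.1)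

theorem inflateHom_one :
    inflateHom n q 1 = 1 - shiftElem (n + 1) q * star (shiftElem (n + 1) q) :=
  Subtype.ext inflate_one

theorem inflateHom_injective : Function.Injective (inflateHom n q) := fun b c h => by
  have h1 : inflate b.1 = inflate c.1 := congrArg Subtype.val h
  rw [Subtype.ext_iff, ← compress_inflate b.1, h1, compress_inflate]

theorem exists_inflateHom_eq (a : sphereAlgebra (n + 1) q) :
    ∃ b, inflateHom n q b = inflateHom n q 1 * a * inflateHom n q 1 :=
  ⟨⟨compress a.1, compress_mem q a.2⟩, rfl⟩

/-- The map induced by `inflateHom` on classes of idempotents. -/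
noncomputable def inflateClass (n : ℕ) (q : Set.Ioo (0 : ℝ) 1) :
    IdempotentClass (sphereAlgebra n q) → IdempotentClass (sphereAlgebra (n + 1) q) :=
  IdempotentClass.map (inflateHom n q)

/-- The image of `inflateHom` is the full corner of 1 - S S*, compression being the inverse map. -/
theorem inflateClass_injective : Function.Injective (inflateClass n q) :=
  map_injective _ inflateHom_injective exists_inflateHom_eq

theorem inflateClass_zero : inflateClass n q 0 = 0 := IdempotentClass.map_zero _

theorem inflateClass_add (x y : IdempotentClass (sphereAlgebra n q)) :
    inflateClass n q (x + y) = inflateClass n q x + inflateClass n q y :=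
  map_add _ x y

/-- The class of the standard projection `P_{j,k}`. -/
noncomputable def stdClass (n : ℕ) (q : Set.Ioo (0 : ℝ) 1) (j : Fin (n + 1)) (k : ℕ) :
    IdempotentClass (sphereAlgebra n q) :=
  mk (stdProj n q j k)

theorem stdClass_zero (k : ℕ) : stdClass n q 0 k = mk (IdempotentOver.one k) := rfl

theorem stdClass_zero_zero : stdClass n q 0 0 = 0 := mk_one_zero

theorem stdClass_zero_add (k l : ℕ) :
    stdClass n q 0 k + stdClass n q 0 l = stdClass n q 0 (k + l) :=
  mk_one_add k l

theorem isIdempotentElem_stdOp (i : Fin n) (k : ℕ) :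
    IsIdempotentElem (⟨stdOp i k, stdOp_mem q i k⟩ : sphereAlgebra n q) :=
  Subtype.ext (diagProj_isIdempotentElem _)

theorem stdClass_succ (i : Fin n) (k : ℕ) : stdClass n q i.succ k =
    ofElem ⟨stdOp i k, stdOp_mem q i k⟩ (isIdempotentElem_stdOp i k) := rfl

theorem stdClass_one (k : ℕ) : stdClass (n + 1) q (Fin.succ 0) k =
    ofElem (1 - shiftElem (n + 1) q ^ k * star (shiftElem (n + 1) q) ^ k)
      (isIdempotentElem_one_sub star_shiftElem_mul k) := by
  rw [stdClass_succ]
  exact ofElem_congr _ (Subtype.ext (stdOp_zero k))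

/-- The step j = 0 is the relation between 1_k and 1 - S^k S*^k; higher projections acquire a
further factor P₁ in front. -/
theorem inflateClass_stdClass (j : Fin (n + 1)) (k : ℕ) :
    inflateClass n q (stdClass n q j k) = stdClass (n + 1) q j.succ k := by
  induction j using Fin.cases with
  | zero =>
    rw [stdClass_zero, stdClass_one]
    exact map_mk_one_eq _ star_shiftElem_mul inflateHom_one k
  | succ i =>
    rw [stdClass_succ, stdClass_succ, inflateClass, map_ofElem]
    exact ofElem_congr _ (Subtype.ext (inflate_stdOp i k))

theorem stdClass_add_stdClass (j : Fin (n + 1)) (k l : ℕ) :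
    stdClass n q j k + stdClass n q j l = stdClass n q j (k + l) := by
  induction n with
  | zero => rw [Fin.fin_one_eq_zero j]; exact stdClass_zero_add k l
  | succ n ih =>
    induction j using Fin.cases with
    | zero => exact stdClass_zero_add k l
    | succ j =>
      rw [← inflateClass_stdClass, ← inflateClass_stdClass, ← inflateClass_add, ih,
        inflateClass_stdClass]

/-- It all comes from [1] + [1 - S^l S*^l] = [1], which holds because S is an isometry, transported
to deeper levels by the corner embedding. -/
theorem stdClass_add_of_lt {j j' : Fin (n + 1)} {k : ℕ} (h : j < j') (hk : 0 < k) (l : ℕ) :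
    stdClass n q j k + stdClass n q j' l = stdClass n q j k := by
  induction n generalizing k l with
  | zero => exact absurd h (by rw [Fin.fin_one_eq_zero j, Fin.fin_one_eq_zero j']; exact lt_irrefl _)
  | succ n ih =>
    induction j' using Fin.cases with
    | zero => exact absurd h (Fin.not_lt_zero j)
    | succ j' =>
      induction j using Fin.cases with
      | zero =>
        have h1 : ∀ l, stdClass (n + 1) q 0 1 + stdClass (n + 1) q (Fin.succ 0) l =
            stdClass (n + 1) q 0 1 := fun l => by
          rw [stdClass_one]
          exact mk_one_add_ofElem_one_sub star_shiftElem_mul l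
        have h2 : stdClass (n + 1) q 0 1 + stdClass (n + 1) q j'.succ l =
            stdClass (n + 1) q 0 1 := by
          rcases Fin.eq_zero_or_eq_succ j' with rfl | ⟨i, rfl⟩
          · exact h1 l
          · have h3 := congrArg (inflateClass n q) (ih (Fin.succ_pos i) Nat.zero_lt_one l)
            rw [inflateClass_add, inflateClass_stdClass, inflateClass_stdClass] at h3
            rw [← h1 1, add_assoc, h3]
        obtain ⟨k, rfl⟩ : ∃ m, k = m + 1 := ⟨k - 1, by omega⟩
        rw [← stdClass_zero_add, add_assoc]
        exact congrArg (stdClass (n + 1) q 0 k + ·) h2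
      | succ j =>
        rw [← inflateClass_stdClass, ← inflateClass_stdClass, ← inflateClass_add,
          ih (Fin.succ_lt_succ_iff.1 h) hk]

theorem symbolClass_stdClass_zero (k : ℕ) :
    symbolClass n q (stdClass n q 0 k) = mk (IdempotentOver.one k) :=
  symbolClass_mk_one k

/-- The symbol of the projection need not be computed: absorption by the unit gives 1 + r = 1 for
its rank r. -/
theorem symbolClass_stdClass_of_ne_zero {j : Fin (n + 1)} (hj : j ≠ 0) (k : ℕ) :
    symbolClass n q (stdClass n q j k) = mk (IdempotentOver.one 0) := by
  obtain ⟨r, hr⟩ := exists_eq_mk_one (symbolClass n q (stdClass n q j k))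
  have h := congrArg (symbolClass n q)
    (stdClass_add_of_lt (q := q) (Fin.pos_iff_ne_zero.2 hj) Nat.zero_lt_one k)
  rw [symbolClass_add, symbolClass_stdClass_zero, hr, mk_one_add] at h
  have h1 : 1 + r = 1 := mk_one_injective h
  obtain rfl : r = 0 := by omega
  exact hr

/-- The pairs (j, 0) with j ≠ 0 are left out, since they too represent the zero class. The rank
separates identity matrices from each other and reduces a coincidence with some j ≥ 1 to k = 0. What
remains is a coincidence of two classes from the corner, where the embedding is injective. -/
theorem stdClass_injOn : Set.InjOn (fun p : Fin (n + 1) × ℕ => stdClass n q p.1 p.2)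
    {p | p.1 = 0 ∨ 0 < p.2} := by
  have hz : ∀ (n : ℕ) (k l : ℕ), stdClass n q 0 k = stdClass n q 0 l → k = l := fun n k l h => by
    have := congrArg (symbolClass n q) h
    rw [symbolClass_stdClass_zero, symbolClass_stdClass_zero] at this
    exact mk_one_injective this
  induction n with
  | zero =>
    rintro ⟨j, k⟩ - ⟨j', l⟩ - h
    obtain rfl := Fin.fin_one_eq_zero j
    obtain rfl := Fin.fin_one_eq_zero j'
    rw [hz 0 k l h]
  | succ n ih =>
    have key : ∀ (j : Fin (n + 1)) (k l : ℕ), 0 < l →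
        stdClass (n + 1) q 0 k ≠ stdClass (n + 1) q j.succ l := fun j k l hl h => by
      have h1 := congrArg (symbolClass (n + 1) q) h
      rw [symbolClass_stdClass_zero, symbolClass_stdClass_of_ne_zero (Fin.succ_ne_zero j)] at h1
      obtain rfl : k = 0 := mk_one_injective h1
      have h2 : stdClass (n + 1) q 0 0 = inflateClass n q (stdClass n q 0 0) := by
        rw [stdClass_zero_zero, stdClass_zero_zero, inflateClass_zero]
      rw [h2, ← inflateClass_stdClass] at h
      have h3 := @ih (0, 0) (Or.inl rfl) (j, l) (Or.inr hl) (inflateClass_injective h)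
      exact hl.ne (congrArg Prod.snd h3)
    rintro ⟨j, k⟩ hjk ⟨j', l⟩ hjl h
    simp only [Set.mem_ofPred_eq] at hjk hjl h
    induction j using Fin.cases with
    | zero =>
      induction j' using Fin.cases with
      | zero => rw [hz _ k l h]
      | succ j' => exact absurd h (key j' k l (hjl.resolve_left (Fin.succ_ne_zero _)))
    | succ j =>
      have hk := hjk.resolve_left (Fin.succ_ne_zero _)
      induction j' using Fin.cases with
      | zero => exact absurd h.symm (key j l k hk)
      | succ j' =>
        have hl := hjl.resolve_left (Fin.succ_ne_zero _)
        rw [← inflateClass_stdClass, ← inflateClass_stdClass] at h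
        have h3 := @ih (j, k) (Or.inr hk) (j', l) (Or.inr hl)
          (inflateClass_injective h)
        rw [Prod.mk.injEq] at h3
        rw [h3.1, h3.2]

/-- By reduction to a corner every class is [1_r] plus the image of a class over the preceding
sphere, which is standard by induction. If r > 0 the second summand is absorbed; if r = 0 it is all
that is left. -/
theorem exists_eq_stdClass (x : IdempotentClass (sphereAlgebra n q)) :
    ∃ (j : Fin (n + 1)) (k : ℕ), (j = 0 ∨ 0 < k) ∧ x = stdClass n q j k := by
  induction n with
  | zero =>
    obtain ⟨r, hr⟩ := exists_eq_mk_one (symbolClass 0 q x)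
    obtain ⟨N, m, p, hp, hcorner, rfl⟩ := exists_eq_mk_one_add hr
    refine ⟨0, r, Or.inl rfl, ?_⟩
    -- For n = 0 the shift is unitary, so the corners vanish and only the identity summand survives.
    have hE : (1 - shiftElem 0 q ^ m * star (shiftElem 0 q) ^ m : sphereAlgebra 0 q) = 0 := by
      refine Subtype.ext ?_
      change 1 - shift 0 ^ m * star (shift 0) ^ m = 0
      rw [one_sub_shift_pow_mul]
      refine ContinuousLinearMap.ext fun f => lp.ext (funext fun y => ?_)
      rw [diagProj_apply, Set.indicator_of_notMem, zero_mul]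
      · rfl
      · rintro ⟨l, -⟩
        exact l.elim0
    have hp0 : p = 0 := by
      ext1 i j
      rw [← (hcorner i j).1, hE, zero_mul]
      rfl
    rw [ofMatrix_congr hp hp0, ofMatrix_zero, add_zero]
    rfl
  | succ n ih =>
    obtain ⟨r, hr⟩ := exists_eq_mk_one (symbolClass (n + 1) q x)
    obtain ⟨N, m, p, hp, hcorner, rfl⟩ := exists_eq_mk_one_add hr
    obtain ⟨y, hy⟩ := exists_map_eq_ofMatrix (inflateHom n q) inflateHom_injective
      exists_inflateHom_eq inflateHom_one hp fun i j => (hcorner i j).1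
    obtain ⟨j, k, hjk, rfl⟩ := ih y
    have hy' : stdClass (n + 1) q j.succ k = ofMatrix p hp := by
      rw [← hy, ← inflateClass_stdClass]; rfl
    rw [← hy', ← stdClass_zero]
    rcases Nat.eq_zero_or_pos r with rfl | hr0
    · rw [stdClass_zero_zero, zero_add]
      rcases Nat.eq_zero_or_pos k with rfl | hk
      · obtain rfl := hjk.resolve_right (lt_irrefl 0)
        refine ⟨0, 0, Or.inl rfl, ?_⟩
        rw [← inflateClass_stdClass, stdClass_zero_zero, stdClass_zero_zero, inflateClass_zero]
      · exact ⟨j.succ, k, Or.inr hk, rfl⟩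
    · exact ⟨0, r, Or.inl rfl, stdClass_add_of_lt (Fin.succ_pos j) hr0 k⟩

theorem stdClass_mem_rankClasses_zero {j : Fin (n + 1)} (hj : j ≠ 0) (k : ℕ) :
    stdClass n q j k ∈ rankClasses n q 0 :=
  mem_rankClasses_iff.2 (symbolClass_stdClass_of_ne_zero hj k)

theorem stdClass_zero_mem_rankClasses_iff {k r : ℕ} :
    stdClass n q 0 k ∈ rankClasses n q r ↔ k = r := by
  rw [mem_rankClasses_iff, symbolClass_stdClass_zero]
  exact mk_one_injective.eq_iff

theorem rankClasses_zero_eq : rankClasses n q 0 = {stdClass n q 0 0} ∪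
    {x | ∃ (j : Fin (n + 1)) (k : ℕ), j ≠ 0 ∧ 0 < k ∧ x = stdClass n q j k} := by
  ext x
  constructor
  · intro hx
    obtain ⟨j, k, hjk, rfl⟩ := exists_eq_stdClass x
    by_cases hj : j = 0
    · subst hj
      rw [stdClass_zero_mem_rankClasses_iff] at hx
      exact Or.inl (by rw [hx]; rfl)
    · exact Or.inr ⟨j, k, hj, hjk.resolve_left hj, rfl⟩
  · rintro (rfl | ⟨j, k, hj, -, rfl⟩)
    · exact stdClass_zero_mem_rankClasses_iff.2 rfl
    · exact stdClass_mem_rankClasses_zero hj k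

theorem rankClasses_eq {k : ℕ} (hk : 0 < k) : rankClasses n q k = {stdClass n q 0 k} := by
  ext x
  constructor
  · intro hx
    obtain ⟨j, l, hjl, rfl⟩ := exists_eq_stdClass x
    by_cases hj : j = 0
    · subst hj
      rw [stdClass_zero_mem_rankClasses_iff] at hx
      rw [hx]; rfl
    · exact absurd ((existsUnique_mem_rankClasses _).unique hx
        (stdClass_mem_rankClasses_zero hj l)) hk.ne'
  · rintro rfl
    exact stdClass_zero_mem_rankClasses_iff.2 rfl

/-- A class vanishes in the Grothendieck group exactly when some c absorbs it. The rank is additive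
with cancellable values, so rank k > 0 forbids this; for j ≠ 0 the class of the unit is such a c. -/
theorem of_stdClass_eq_zero_iff (j : Fin (n + 1)) (k : ℕ) :
    Algebra.GrothendieckAddGroup.of (stdClass n q j k) = (0 : KZero (sphereAlgebra n q)) ↔
      j ≠ 0 ∨ (j = 0 ∧ k = 0) := by
  constructor
  · intro h
    by_cases hj : j = 0
    · subst hj
      refine Or.inr ⟨rfl, ?_⟩
      rw [← _root_.map_zero (Algebra.GrothendieckAddGroup.of)] at h
      obtain ⟨c, hc⟩ := (AddLocalization.addMonoidOf (⊤ : AddSubmonoid _)).eq_iff_exists.1 h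
      obtain ⟨r, hr⟩ := exists_eq_mk_one (symbolClass n q c)
      have h1 := congrArg (symbolClass n q) hc
      rw [add_zero, symbolClass_add, hr, symbolClass_stdClass_zero, mk_one_add] at h1
      have h2 : r + k = r := mk_one_injective h1
      omega
    · exact Or.inl hj
  · rintro (hj | ⟨rfl, rfl⟩)
    · have h := congrArg Algebra.GrothendieckAddGroup.of
        (stdClass_add_of_lt (q := q) (Fin.pos_iff_ne_zero.2 hj) Nat.zero_lt_one k)
      rw [_root_.map_add] at h
      exact add_eq_left.1 h
    · rw [stdClass_zero_zero, _root_.map_zero]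

end QuantumSphere

theorem theorem1 (n : ℕ) (q : Set.Ioo (0 : ℝ) 1) :
    -- the quotient map `η`, through which the rank is defined, exists and is unique
    (∃! η : sphereAlgebra n q →⋆ₐ[ℂ] C(Circle, ℂ), IsSymbolMap η) ∧
    -- `𝔓` is the disjoint union of the `𝔓_r`
    (∀ x : IdempotentClass (sphereAlgebra n q), ∃! r : ℕ, x ∈ rankClasses n q r) ∧
    -- the classes of rank `0`, which are pairwise distinct
    rankClasses n q 0 = {IdempotentClass.mk (stdProj n q 0 0)} ∪
      {x | ∃ (j : Fin (n + 1)) (k : ℕ), j ≠ 0 ∧ 0 < k ∧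
        x = IdempotentClass.mk (stdProj n q j k)} ∧
    Set.InjOn (fun p : Fin (n + 1) × ℕ => IdempotentClass.mk (stdProj n q p.1 p.2))
      ({(0, 0)} ∪ {p | p.1 ≠ 0 ∧ 0 < p.2}) ∧
    -- the class of rank `k > 0`
    (∀ k : ℕ, 0 < k → rankClasses n q k = {IdempotentClass.mk (stdProj n q 0 k)}) ∧
    -- the monoid structure
    IdempotentClass.mk (stdProj n q 0 0) = 0 ∧
    (∀ (j j' : Fin (n + 1)) (k k' : ℕ), j < j' → 0 < k → 0 < k' →
      IdempotentClass.mk (stdProj n q j k) + IdempotentClass.mk (stdProj n q j' k') =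
        IdempotentClass.mk (stdProj n q j k)) ∧
    (∀ (j : Fin (n + 1)) (k k' : ℕ),
      IdempotentClass.mk (stdProj n q j k) + IdempotentClass.mk (stdProj n q j k') =
        IdempotentClass.mk (stdProj n q j (k + k'))) ∧
    -- vanishing in `K₀`
    (∀ (j : Fin (n + 1)) (k : ℕ),
      Algebra.GrothendieckAddGroup.of (IdempotentClass.mk (stdProj n q j k)) =
        (0 : KZero (sphereAlgebra n q)) ↔ j ≠ 0 ∨ (j = 0 ∧ k = 0)) := by
  refine ⟨existsUnique_isSymbolMap n q, existsUnique_mem_rankClasses, rankClasses_zero_eq,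
    stdClass_injOn.mono ?_, fun k hk => rankClasses_eq hk, stdClass_zero_zero,
    fun j j' k k' h hk _ => stdClass_add_of_lt h hk k', stdClass_add_stdClass,
    of_stdClass_eq_zero_iff⟩
  rintro ⟨j, k⟩ (h | h)
  · rw [Set.mem_singleton_iff, Prod.mk.injEq] at h
    exact Or.inl h.1
  · exact Or.inr h.2
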